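/- \textbf{Theorem (Synthesis onto $W^{m,p}$).} Let $d\ge 1$, $1\le p<\infty$, and let $m\ge 0$ be an integer. Let $(\alpha_j)_{j>0}$ be nonzero real numbers with $|\alpha_j|\to\infty$, put $a_j=\alpha_j I$, and let $b$ be an invertible real $d\times d$ matrix. All functions and sequences are complex valued. Write $\mathcal C=[0,1)^d$, $\beta=|b\mathcal C|^{-1}\mathbf 1_{b\mathcal C}$, and $(M_bf)(x)=|\det b|\,f(bx)$. Let $\eta\in L^p(\mathbb R^d)$ satisfy $\int_{\mathbb R^d}\eta\,dx=1$ and $P|\eta|\in L^p_{loc}$, where $P|\eta|(x)=|\det b|\sum_{k\in\mathbb Z^d}|\eta(x-bk)|$. Define $$\psi=\underbrace{\beta*\cdots*\beta}_{m}*\,\eta,\qquad \psi_{j,k}(x)=|\det a_j|^{1/p}\,\psi(a_jx-bk)\quad(j>0,\ k\in\mathbb Z^d),$$ with $\psi=\eta$ if $m=0$. Let $W^{m,p}=W^{m,p}(\mathbb R^d)$ be the Sobolev space with norm $\|f\|_{W^{m,p}}=\sum_{|\rho|\le m}\|D^\rho f\|_p$. For sequences $c=(c_{j,k})_{j>0,\,k\in\mathbb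 Z^d}$ let $\Delta^\rho=\Delta_1^{\rho_1}\cdots\Delta_d^{\rho_d}$, where $(\Delta_tc)_{j,k}=c_{j,k}-c_{j,k-e_t}$, and let $\ell^1(w^{m,p},\alpha)$ be the space of all $c$ with $$\|c\|_{\ell^1(w^{m,p},\alpha)}=\sum_{|\rho|\le m}\ \sum_{j>0}|\alpha_j|^{|\rho|}\Big(\sum_{k\in\mathbb Z^d}|(\Delta^\rho c)_{j,k}|^p\Big)^{1/p}<\infty .$$ Then the synthesis operator $$S:\ell^1(w^{m,p},\alpha)\to W^{m,p},\qquad Sc=\sum_{j>0}\sum_{k\in\mathbb Z^d}c_{j,k}\psi_{j,k},$$ is well defined, linear and bounded, where for each $j$ the sum over $k$ converges pointwise absolutely a.e. to a function in $W^{m,p}$, and the sum over $j$ converges absolutely in $W^{m,p}$. Moreover $S$ is open and surjective. Indeed, for every $f\in W^{m,p}$ and every $\varepsilon>0$ there is $c\in\ell^1(w^{m,p},\alpha)$ with $Sc=M_b^{-1}f$ (with the convergence just described) and $$\|c\|_{\ell^1(w^{m,p},\alpha)}\le\|f\|_{W^{m,p}}+\varepsilon .$$ -/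

import Mathlib

open MeasureTheory Filter Topology
open scoped ENNReal ContDiff

set_option linter.unusedSectionVars false

noncomputable section

namespace AffineSynthesis

/-- `ℝ^d` with its Euclidean norm and Lebesgue measure. -/
abbrev Space (d : ℕ) : Type := EuclideanSpace ℝ (Fin d)

/-- The multi-indices `ρ` of order `|ρ| = ρ_1 + ⋯ + ρ_d ≤ m`. -/
def multiIndices (d m : ℕ) : Finset (Fin d → ℕ) :=
  (Fintype.piFinset fun _ : Fin d => Finset.range (m + 1)).filter fun ρ => ∑ i, ρ i ≤ m

theorem mem_multiIndices {d m : ℕ} {ρ : Fin d → ℕ} :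
    ρ ∈ multiIndices d m ↔ ∑ i, ρ i ≤ m := by
  simp only [multiIndices, Finset.mem_filter, Fintype.mem_piFinset, Finset.mem_range,
    and_iff_right_iff_imp]
  intro h i
  have := Finset.single_le_sum (f := ρ) (fun _ _ => Nat.zero_le _) (Finset.mem_univ i)
  omega

theorem zero_mem_multiIndices (d m : ℕ) : (0 : Fin d → ℕ) ∈ multiIndices d m := by
  simp [mem_multiIndices]

/-! ### Weak derivatives and the Sobolev space `W^{m,p}(ℝ^d)` -/

/-- The classical partial derivative `∂φ/∂x_t`. -/
def partialDeriv {d : ℕ} (t : Fin d) (φ : Space d → ℝ) : Space d → ℝ :=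
  fun x => fderiv ℝ φ x (EuclideanSpace.single t 1)

/-- The classical iterated derivative `D^ρ φ = D_1^{ρ_1} ⋯ D_d^{ρ_d} φ`. -/
def multiDeriv {d : ℕ} (ρ : Fin d → ℕ) (φ : Space d → ℝ) : Space d → ℝ :=
  (List.finRange d).foldr (fun t g => (partialDeriv t)^[ρ t] g) φ

/-- `g` is the weak derivative `D^ρ f` (both functions locally integrable), tested against
`C_c^∞(ℝ^d)`. -/
def IsWeakDeriv {d : ℕ} (ρ : Fin d → ℕ) (f g : Space d → ℂ) : Prop :=
  ∀ φ : Space d → ℝ, ContDiff ℝ ∞ φ → HasCompactSupport φ →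
    (∫ x, multiDeriv ρ φ x • f x) = (-1) ^ (∑ i, ρ i) * ∫ x, φ x • g x

theorem partialDeriv_test {d : ℕ} (t : Fin d) {φ : Space d → ℝ}
    (h : ContDiff ℝ ∞ φ ∧ HasCompactSupport φ) :
    ContDiff ℝ ∞ (partialDeriv t φ) ∧ HasCompactSupport (partialDeriv t φ) := by
  refine ⟨?_, ?_⟩
  · exact (h.1.fderiv_right (m := ∞) (by simp)).clm_apply contDiff_const
  · exact h.2.fderiv_apply (𝕜 := ℝ) _

theorem multiDeriv_test {d : ℕ} (ρ : Fin d → ℕ) {φ : Space d → ℝ}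
    (h : ContDiff ℝ ∞ φ ∧ HasCompactSupport φ) :
    ContDiff ℝ ∞ (multiDeriv ρ φ) ∧ HasCompactSupport (multiDeriv ρ φ) := by
  unfold multiDeriv
  induction List.finRange d with
  | nil => exact h
  | cons t l ih =>
    simp only [List.foldr_cons]
    induction ρ t with
    | zero => exact ih
    | succ n ihn =>
      rw [Function.iterate_succ_apply']
      exact partialDeriv_test t ihn

section Sobolev

variable {d : ℕ} {p : ℝ≥0∞} [Fact (1 ≤ p)]

theorem integrable_test_smul {φ : Space d → ℝ} (h : ContDiff ℝ ∞ φ ∧ HasCompactSupport φ)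
    (f : Lp ℂ p (volume : Measure (Space d))) : Integrable (fun x => φ x • f x) volume :=
  ((Lp.memLp f).locallyIntegrable Fact.out).integrable_smul_left_of_hasCompactSupport
    h.1.continuous h.2

theorem isWeakDeriv_zero_index (f : Lp ℂ p (volume : Measure (Space d))) :
    IsWeakDeriv 0 f f := by
  intro φ _ _
  have : multiDeriv (0 : Fin d → ℕ) φ = φ := by
    unfold multiDeriv
    induction List.finRange d with
    | nil => rfl
    | cons t l ih => simp
  simp [this]

theorem isWeakDeriv_zero (ρ : Fin d → ℕ) :
    IsWeakDeriv ρ (0 : Lp ℂ p (volume : Measure (Space d)))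
      (0 : Lp ℂ p (volume : Measure (Space d))) := by
  have key : ∀ ψ : Space d → ℝ,
      ∫ x, ψ x • (0 : Lp ℂ p (volume : Measure (Space d))) x = 0 := by
    intro ψ
    refine integral_eq_zero_of_ae ?_
    filter_upwards [Lp.coeFn_zero ℂ p (volume : Measure (Space d))] with x hx
    rw [hx]
    simp
  intro φ _ _
  rw [key, key, mul_zero]

theorem IsWeakDeriv.add {ρ : Fin d → ℕ} {f f' g g' : Lp ℂ p (volume : Measure (Space d))}
    (h : IsWeakDeriv ρ f g) (h' : IsWeakDeriv ρ f' g') :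
    IsWeakDeriv ρ (f + f' : Lp ℂ p (volume : Measure (Space d)))
      (g + g' : Lp ℂ p (volume : Measure (Space d))) := by
  have key : ∀ ψ : Space d → ℝ, ContDiff ℝ ∞ ψ ∧ HasCompactSupport ψ →
      ∀ u v : Lp ℂ p (volume : Measure (Space d)),
      ∫ x, ψ x • (u + v : Lp ℂ p (volume : Measure (Space d))) x
        = (∫ x, ψ x • u x) + ∫ x, ψ x • v x := by
    intro ψ hψ u v
    rw [← integral_add (integrable_test_smul hψ u) (integrable_test_smul hψ v)]
    refine integral_congr_ae ?_
    filter_upwards [Lp.coeFn_add u v] with x hx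
    rw [hx, Pi.add_apply, smul_add]
  intro φ h1 h2
  rw [key _ (multiDeriv_test ρ ⟨h1, h2⟩), key _ ⟨h1, h2⟩, h φ h1 h2, h' φ h1 h2, mul_add]

theorem IsWeakDeriv.smul {ρ : Fin d → ℕ} {f g : Lp ℂ p (volume : Measure (Space d))} (a : ℂ)
    (h : IsWeakDeriv ρ f g) :
    IsWeakDeriv ρ (a • f : Lp ℂ p (volume : Measure (Space d)))
      (a • g : Lp ℂ p (volume : Measure (Space d))) := by
  have key : ∀ ψ : Space d → ℝ, ∀ u : Lp ℂ p (volume : Measure (Space d)),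
      ∫ x, ψ x • (a • u : Lp ℂ p (volume : Measure (Space d))) x = a * ∫ x, ψ x • u x := by
    intro ψ u
    rw [← integral_const_mul]
    refine integral_congr_ae ?_
    filter_upwards [Lp.coeFn_smul a u] with x hx
    rw [hx, Pi.smul_apply, smul_eq_mul, mul_smul_comm]
  intro φ h1 h2
  rw [key, key, h φ h1 h2]
  ring

/-- Weak derivatives are unique. -/
theorem IsWeakDeriv.unique {ρ : Fin d → ℕ} {f g g' : Lp ℂ p (volume : Measure (Space d))}
    (h : IsWeakDeriv ρ f g) (h' : IsWeakDeriv ρ f g') : g = g' := by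
  have hloc : LocallyIntegrable (fun x => g x - g' x) (volume : Measure (Space d)) :=
    ((Lp.memLp g).locallyIntegrable Fact.out).sub ((Lp.memLp g').locallyIntegrable Fact.out)
  have := ae_eq_zero_of_integral_contDiff_smul_eq_zero hloc (fun φ h1 h2 => by
    have e := (h φ h1 h2).symm.trans (h' φ h1 h2)
    have e' := mul_left_cancel₀ (pow_ne_zero _ (by norm_num)) e
    simp only [smul_sub]
    rw [integral_sub (integrable_test_smul ⟨h1, h2⟩ g) (integrable_test_smul ⟨h1, h2⟩ g'), e',
      sub_self])
  refine Lp.ext ?_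
  filter_upwards [this] with x hx
  exact sub_eq_zero.mp hx

open Classical in
/-- The weak derivative `D^ρ f ∈ L^p` of `f ∈ L^p`, if it exists in `L^p` (and `0` otherwise). -/
def weakDeriv (ρ : Fin d → ℕ) (f : Lp ℂ p (volume : Measure (Space d))) :
    Lp ℂ p (volume : Measure (Space d)) :=
  if h : ∃ g : Lp ℂ p (volume : Measure (Space d)), IsWeakDeriv ρ f g then h.choose else 0

theorem isWeakDeriv_weakDeriv {ρ : Fin d → ℕ} {f : Lp ℂ p (volume : Measure (Space d))}
    (h : ∃ g : Lp ℂ p (volume : Measure (Space d)), IsWeakDeriv ρ f g) :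
    IsWeakDeriv ρ f (weakDeriv ρ f) := by
  rw [weakDeriv, dif_pos h]
  exact h.choose_spec

theorem IsWeakDeriv.weakDeriv_eq {ρ : Fin d → ℕ} {f g : Lp ℂ p (volume : Measure (Space d))}
    (h : IsWeakDeriv ρ f g) : weakDeriv ρ f = g :=
  (isWeakDeriv_weakDeriv ⟨g, h⟩).unique h

variable (d p) in
/-- The functions `f ∈ L^p` whose weak derivatives of order at most `m` all belong to `L^p`. -/
def sobolevSubmodule (m : ℕ) : Submodule ℂ (Lp ℂ p (volume : Measure (Space d))) where
  carrier := {f | ∀ ρ ∈ multiIndices d m,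
    ∃ g : Lp ℂ p (volume : Measure (Space d)), IsWeakDeriv ρ f g}
  add_mem' {f f'} h h' ρ hρ := by
    obtain ⟨g, hg⟩ := h ρ hρ
    obtain ⟨g', hg'⟩ := h' ρ hρ
    exact ⟨g + g', hg.add hg'⟩
  zero_mem' ρ _ := ⟨0, isWeakDeriv_zero ρ⟩
  smul_mem' a f h ρ hρ := by
    obtain ⟨g, hg⟩ := h ρ hρ
    exact ⟨a • g, hg.smul a⟩

variable (d p) in
/-- The Sobolev space `W^{m,p}(ℝ^d)`. It is a type of its own, since its norm is not the norm
inherited from `L^p`. -/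
def Sobolev (m : ℕ) : Type := ↥(sobolevSubmodule d p m)

namespace Sobolev

variable {m : ℕ}

instance : AddCommGroup (Sobolev d p m) :=
  inferInstanceAs (AddCommGroup ↥(sobolevSubmodule d p m))

instance : Module ℂ (Sobolev d p m) :=
  inferInstanceAs (Module ℂ ↥(sobolevSubmodule d p m))

/-- The inclusion `W^{m,p} → L^p`. -/
def toLp : Sobolev d p m →ₗ[ℂ] Lp ℂ p (volume : Measure (Space d)) :=
  (sobolevSubmodule d p m).subtype

theorem toLp_injective : Function.Injective (toLp (d := d) (p := p) (m := m)) :=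
  Subtype.val_injective

theorem isWeakDeriv (f : Sobolev d p m) {ρ : Fin d → ℕ} (hρ : ρ ∈ multiIndices d m) :
    IsWeakDeriv ρ (toLp f) (weakDeriv ρ (toLp f)) :=
  isWeakDeriv_weakDeriv (f.2 ρ hρ)

/-- `‖f‖_{W^{m,p}} = ∑_{|ρ| ≤ m} ‖D^ρ f‖_p`. -/
instance : Norm (Sobolev d p m) :=
  ⟨fun f => ∑ ρ ∈ multiIndices d m, ‖weakDeriv ρ (toLp f)‖⟩

theorem norm_def (f : Sobolev d p m) :
    ‖f‖ = ∑ ρ ∈ multiIndices d m, ‖weakDeriv ρ (toLp f)‖ := rfl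

theorem core : NormedSpace.Core ℂ (Sobolev d p m) where
  norm_nonneg f := Finset.sum_nonneg fun _ _ => norm_nonneg _
  norm_smul a f := by
    rw [norm_def, norm_def, Finset.mul_sum]
    refine Finset.sum_congr rfl fun ρ hρ => ?_
    rw [map_smul, ((isWeakDeriv f hρ).smul a).weakDeriv_eq, norm_smul]
  norm_triangle f g := by
    simp only [norm_def]
    rw [← Finset.sum_add_distrib]
    refine Finset.sum_le_sum fun ρ hρ => ?_
    rw [map_add, ((isWeakDeriv f hρ).add (isWeakDeriv g hρ)).weakDeriv_eq]
    exact norm_add_le _ _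
  norm_eq_zero_iff f := by
    constructor
    · intro h
      rw [norm_def, Finset.sum_eq_zero_iff_of_nonneg fun _ _ => norm_nonneg _] at h
      have h0 := h 0 (zero_mem_multiIndices d m)
      rw [(isWeakDeriv_zero_index (toLp f)).weakDeriv_eq, norm_eq_zero] at h0
      exact toLp_injective (h0.trans (map_zero _).symm)
    · rintro rfl
      rw [norm_def]
      refine Finset.sum_eq_zero fun ρ _ => ?_
      rw [map_zero, (isWeakDeriv_zero ρ).weakDeriv_eq, norm_zero]

instance : NormedAddCommGroup (Sobolev d p m) := NormedAddCommGroup.ofCore core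

instance : NormedSpace ℂ (Sobolev d p m) := NormedSpace.ofCore core

end Sobolev

end Sobolev

/-! ### The dilation-weighted discrete Sobolev space `ℓ^1(w^{m,p}, α)` -/

open Classical in
/-- The norm of a sequence `s` in `ℓ^p(ℤ^d)` (and `0` if `s` is not in `ℓ^p`). -/
def seqNorm {d : ℕ} (p : ℝ≥0∞) (s : (Fin d → ℤ) → ℂ) : ℝ :=
  if h : Memℓp s p then ‖(⟨s, h⟩ : lp (fun _ : Fin d → ℤ => ℂ) p)‖ else 0

theorem seqNorm_eq_norm {d : ℕ} {p : ℝ≥0∞} {s : (Fin d → ℤ) → ℂ} (h : Memℓp s p) :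
    seqNorm p s = ‖(⟨s, h⟩ : lp (fun _ : Fin d → ℤ => ℂ) p)‖ := dif_pos h

/-- For finite `p` the norm is `(∑_k |s_k|^p)^{1/p}`. -/
theorem seqNorm_eq_tsum {d : ℕ} {p : ℝ≥0∞} (hp : 0 < p.toReal) {s : (Fin d → ℤ) → ℂ}
    (h : Memℓp s p) : seqNorm p s = (∑' k, ‖s k‖ ^ p.toReal) ^ (1 / p.toReal) := by
  rw [seqNorm_eq_norm h, lp.norm_eq_tsum_rpow hp]

/-- `c ∈ ℓ^1(ℓ^p)`. -/
def MemMixed {d : ℕ} (p : ℝ≥0∞) (c : ℕ+ → (Fin d → ℤ) → ℂ) : Prop :=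
  (∀ j, Memℓp (c j) p) ∧ Summable fun j => seqNorm p (c j)

/-- `‖c‖_{ℓ^1(ℓ^p)} = ∑_{j > 0} ‖{c_{j,k}}_k‖_{ℓ^p}`. -/
def mixedNorm {d : ℕ} (p : ℝ≥0∞) (c : ℕ+ → (Fin d → ℤ) → ℂ) : ℝ :=
  ∑' j, seqNorm p (c j)

/-- The difference operator `(Δ_t s)_k = s_k - s_{k - e_t}`. -/
def diff {d : ℕ} (t : Fin d) : Module.End ℂ ((Fin d → ℤ) → ℂ) where
  toFun s := fun k => s k - s (k - Pi.single t 1)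
  map_add' s s' := by ext k; simp only [Pi.add_apply]; ring
  map_smul' a s := by ext k; simp only [Pi.smul_apply, smul_eq_mul, RingHom.id_apply]; ring

/-- The higher difference operator `Δ^ρ = Δ_1^{ρ_1} ⋯ Δ_d^{ρ_d}`. -/
def multiDiff {d : ℕ} (ρ : Fin d → ℕ) : Module.End ℂ ((Fin d → ℤ) → ℂ) :=
  ((List.finRange d).map fun t => diff t ^ ρ t).prod

/-- The sequence `α^{|ρ|} Δ^ρ c`, that is `(j, k) ↦ α_j^{|ρ|} (Δ^ρ c_j)_k`. -/
def weightedDiff {d : ℕ} (α : ℕ+ → ℝ) (ρ : Fin d → ℕ) :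
    (ℕ+ → (Fin d → ℤ) → ℂ) →ₗ[ℂ] (ℕ+ → (Fin d → ℤ) → ℂ) where
  toFun c := fun j => ((α j : ℂ) ^ ∑ i, ρ i) • multiDiff ρ (c j)
  map_add' c c' := by ext j k; simp [mul_add]
  map_smul' a c := by
    ext j k
    simp only [Pi.smul_apply, map_smul, smul_eq_mul, RingHom.id_apply]
    ring

theorem weightedDiff_zero_index {d : ℕ} (α : ℕ+ → ℝ) (c : ℕ+ → (Fin d → ℤ) → ℂ) :
    weightedDiff α 0 c = c := by
  have h : multiDiff (0 : Fin d → ℕ) = 1 := by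
    unfold multiDiff
    refine List.prod_eq_one fun x hx => ?_
    obtain ⟨t, -, rfl⟩ := List.mem_map.mp hx
    simp
  ext j k
  simp [weightedDiff, h]

section Weighted

variable {d : ℕ} {p : ℝ≥0∞}

theorem seqNorm_nonneg (s : (Fin d → ℤ) → ℂ) : 0 ≤ seqNorm p s := by
  unfold seqNorm
  split_ifs with h
  · exact lp.norm_nonneg' _
  · exact le_rfl

theorem seqNorm_zero : seqNorm p (0 : (Fin d → ℤ) → ℂ) = 0 := by
  rw [seqNorm_eq_norm (zero_memℓp)]
  exact lp.norm_zero

theorem mixedNorm_nonneg (c : ℕ+ → (Fin d → ℤ) → ℂ) : 0 ≤ mixedNorm p c :=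
  tsum_nonneg fun _ => seqNorm_nonneg _

theorem mixedNorm_zero : mixedNorm p (0 : ℕ+ → (Fin d → ℤ) → ℂ) = 0 := by
  simp [mixedNorm, seqNorm_zero]

theorem memMixed_zero : MemMixed p (0 : ℕ+ → (Fin d → ℤ) → ℂ) :=
  ⟨fun _ => zero_memℓp, by simp [seqNorm_zero]⟩

variable [Fact (1 ≤ p)]

theorem seqNorm_smul (a : ℂ) {s : (Fin d → ℤ) → ℂ} (h : Memℓp s p) :
    seqNorm p (a • s) = ‖a‖ * seqNorm p s := by
  rw [seqNorm_eq_norm h, seqNorm_eq_norm (h.const_smul a), ← norm_smul]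
  rfl

theorem seqNorm_add_le {s s' : (Fin d → ℤ) → ℂ} (h : Memℓp s p) (h' : Memℓp s' p) :
    seqNorm p (s + s') ≤ seqNorm p s + seqNorm p s' := by
  rw [seqNorm_eq_norm h, seqNorm_eq_norm h', seqNorm_eq_norm (h.add h')]
  exact norm_add_le (⟨s, h⟩ : lp (fun _ : Fin d → ℤ => ℂ) p) ⟨s', h'⟩

theorem eq_zero_of_seqNorm_eq_zero {s : (Fin d → ℤ) → ℂ} (h : Memℓp s p)
    (h0 : seqNorm p s = 0) : s = 0 := by
  rw [seqNorm_eq_norm h, norm_eq_zero] at h0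
  exact congrArg Subtype.val h0

theorem MemMixed.add {c c' : ℕ+ → (Fin d → ℤ) → ℂ} (h : MemMixed p c) (h' : MemMixed p c') :
    MemMixed p (c + c') :=
  ⟨fun j => (h.1 j).add (h'.1 j), Summable.of_nonneg_of_le (fun _ => seqNorm_nonneg _)
    (fun j => seqNorm_add_le (h.1 j) (h'.1 j)) (h.2.add h'.2)⟩

theorem MemMixed.smul {c : ℕ+ → (Fin d → ℤ) → ℂ} (a : ℂ) (h : MemMixed p c) :
    MemMixed p (a • c) :=
  ⟨fun j => (h.1 j).const_smul a, (h.2.mul_left ‖a‖).congr fun j =>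
    (seqNorm_smul a (h.1 j)).symm⟩

theorem mixedNorm_add_le {c c' : ℕ+ → (Fin d → ℤ) → ℂ} (h : MemMixed p c)
    (h' : MemMixed p c') : mixedNorm p (c + c') ≤ mixedNorm p c + mixedNorm p c' := by
  unfold mixedNorm
  rw [← h.2.tsum_add h'.2]
  exact (h.add h').2.tsum_le_tsum (fun j => seqNorm_add_le (h.1 j) (h'.1 j)) (h.2.add h'.2)

theorem mixedNorm_smul {c : ℕ+ → (Fin d → ℤ) → ℂ} (a : ℂ) (h : MemMixed p c) :
    mixedNorm p (a • c) = ‖a‖ * mixedNorm p c := by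
  unfold mixedNorm
  rw [← tsum_mul_left]
  exact tsum_congr fun j => seqNorm_smul a (h.1 j)

theorem eq_zero_of_mixedNorm_eq_zero {c : ℕ+ → (Fin d → ℤ) → ℂ} (h : MemMixed p c)
    (h0 : mixedNorm p c = 0) : c = 0 := by
  have h1 := (h.2.hasSum_iff.mpr h0)
  rw [hasSum_zero_iff_of_nonneg fun j => seqNorm_nonneg _] at h1
  funext j
  exact eq_zero_of_seqNorm_eq_zero (h.1 j) (congrFun h1 j)

variable (d p) in
/-- The sequences `c` with `α^{|ρ|} Δ^ρ c ∈ ℓ^1(ℓ^p)` for all `|ρ| ≤ m` (for `ρ = 0` this is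
`c ∈ ℓ^1(ℓ^p)`). -/
def weightedSubmodule (m : ℕ) (α : ℕ+ → ℝ) : Submodule ℂ (ℕ+ → (Fin d → ℤ) → ℂ) where
  carrier := {c | ∀ ρ ∈ multiIndices d m, MemMixed p (weightedDiff α ρ c)}
  add_mem' {c c'} h h' ρ hρ := by
    rw [map_add]
    exact (h ρ hρ).add (h' ρ hρ)
  zero_mem' ρ _ := by
    rw [map_zero]
    exact memMixed_zero
  smul_mem' a c h ρ hρ := by
    rw [map_smul]
    exact (h ρ hρ).smul a

variable (d p) in
/-- The space `ℓ^1(w^{m,p}, α)`, as a normed space. -/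
def WeightedSeq (m : ℕ) (α : ℕ+ → ℝ) : Type := ↥(weightedSubmodule d p m α)

namespace WeightedSeq

variable {m : ℕ} {α : ℕ+ → ℝ}

instance : AddCommGroup (WeightedSeq d p m α) :=
  inferInstanceAs (AddCommGroup ↥(weightedSubmodule d p m α))

instance : Module ℂ (WeightedSeq d p m α) :=
  inferInstanceAs (Module ℂ ↥(weightedSubmodule d p m α))

/-- The underlying sequence `(c_{j,k})`. -/
def toSeq : WeightedSeq d p m α →ₗ[ℂ] (ℕ+ → (Fin d → ℤ) → ℂ) :=
  (weightedSubmodule d p m α).subtype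

theorem toSeq_injective : Function.Injective (toSeq (d := d) (p := p) (m := m) (α := α)) :=
  Subtype.val_injective

theorem memMixed (c : WeightedSeq d p m α) {ρ : Fin d → ℕ} (hρ : ρ ∈ multiIndices d m) :
    MemMixed p (weightedDiff α ρ (toSeq c)) :=
  c.2 ρ hρ

/-- `‖c‖_{ℓ^1(w^{m,p}, α)} = ∑_{|ρ| ≤ m} ‖α^{|ρ|} Δ^ρ c‖_{ℓ^1(ℓ^p)}`. -/
instance : Norm (WeightedSeq d p m α) :=
  ⟨fun c => ∑ ρ ∈ multiIndices d m, mixedNorm p (weightedDiff α ρ (toSeq c))⟩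

theorem norm_def (c : WeightedSeq d p m α) :
    ‖c‖ = ∑ ρ ∈ multiIndices d m, mixedNorm p (weightedDiff α ρ (toSeq c)) := rfl

theorem core : NormedSpace.Core ℂ (WeightedSeq d p m α) where
  norm_nonneg c := Finset.sum_nonneg fun _ _ => mixedNorm_nonneg _
  norm_smul a c := by
    rw [norm_def, norm_def, Finset.mul_sum]
    refine Finset.sum_congr rfl fun ρ hρ => ?_
    rw [map_smul, map_smul, mixedNorm_smul a (memMixed c hρ)]
  norm_triangle c c' := by
    simp only [norm_def]
    rw [← Finset.sum_add_distrib]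
    refine Finset.sum_le_sum fun ρ hρ => ?_
    rw [map_add, map_add]
    exact mixedNorm_add_le (memMixed c hρ) (memMixed c' hρ)
  norm_eq_zero_iff c := by
    constructor
    · intro h
      rw [norm_def, Finset.sum_eq_zero_iff_of_nonneg fun _ _ => mixedNorm_nonneg _] at h
      have h0 := eq_zero_of_mixedNorm_eq_zero (memMixed c (zero_mem_multiIndices d m))
        (h 0 (zero_mem_multiIndices d m))
      rw [weightedDiff_zero_index] at h0
      exact toSeq_injective (h0.trans (map_zero _).symm)
    · rintro rfl
      rw [norm_def]
      refine Finset.sum_eq_zero fun ρ _ => ?_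
      rw [map_zero, map_zero, mixedNorm_zero]

instance : NormedAddCommGroup (WeightedSeq d p m α) := NormedAddCommGroup.ofCore core

instance : NormedSpace ℂ (WeightedSeq d p m α) := NormedSpace.ofCore core

end WeightedSeq

end Weighted

/-! ### Synthesizers and the synthesis operator -/

section Synthesis

variable {d : ℕ}

/-- The action `x ↦ A x` of a `d × d` matrix on `ℝ^d`. -/
abbrev act (A : Matrix (Fin d) (Fin d) ℝ) (x : Space d) : Space d := Matrix.toLpLin 2 2 A x

/-- The point `b k` of the lattice `b ℤ^d`. -/
def latticePoint (b : Matrix (Fin d) (Fin d) ℝ) (k : Fin d → ℤ) : Space d :=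
  act b (WithLp.toLp 2 fun i => (k i : ℝ))

/-- The periodization `P|f|(x) = |det b| ∑_{k ∈ ℤ^d} |f(x - bk)|`, with values in `[0, ∞]`. -/
def absPeriodization (b : Matrix (Fin d) (Fin d) ℝ) (f : Space d → ℂ) : Space d → ℝ≥0∞ :=
  fun x => ‖b.det‖ₑ * ∑' k : Fin d → ℤ, ‖f (x - latticePoint b k)‖ₑ

/-- `P|f| ∈ L^p_loc`: the periodization is `p`-integrable on every compact set. -/
def PeriodizationLocLp (p : ℝ≥0∞) (b : Matrix (Fin d) (Fin d) ℝ) (f : Space d → ℂ) : Prop :=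
  ∀ K : Set (Space d), IsCompact K →
    MemLp (absPeriodization b f) p (volume.restrict K)

/-- The period box `b 𝒞`, where `𝒞 = [0,1)^d`. -/
def periodBox (b : Matrix (Fin d) (Fin d) ℝ) : Set (Space d) :=
  act b '' {x | ∀ i, x i ∈ Set.Ico (0 : ℝ) 1}

/-- `β = |b𝒞|^{-1} 1_{b𝒞}`. -/
def boxIndicator (b : Matrix (Fin d) (Fin d) ℝ) : Space d → ℂ :=
  (periodBox b).indicator fun _ => ((volume.real (periodBox b) : ℂ))⁻¹

/-- `β * ⋯ * β * η` with `m` factors `β`; it is `η` for `m = 0`. -/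
def synthesizer (b : Matrix (Fin d) (Fin d) ℝ) (η : Space d → ℂ) : ℕ → Space d → ℂ
  | 0 => η
  | m + 1 => convolution (boxIndicator b) (synthesizer b η m) (ContinuousLinearMap.mul ℂ ℂ) volume

/-- The rescaling `x ↦ |det a|^{1/p} ψ(a x - b k)`. -/
def rescaled (p : ℝ≥0∞) (a b : Matrix (Fin d) (Fin d) ℝ) (ψ : Space d → ℂ) (k : Fin d → ℤ) :
    Space d → ℂ :=
  fun x => ((|a.det| ^ (1 / p.toReal) : ℝ) : ℂ) * ψ (act a x - latticePoint b k)

/-- The isotropic dilation matrix `a_j = α_j I`. -/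
def dilation (d : ℕ) (α : ℕ+ → ℝ) (j : ℕ+) : Matrix (Fin d) (Fin d) ℝ :=
  α j • (1 : Matrix (Fin d) (Fin d) ℝ)

/-- `F = ∑_{j > 0} ∑_{k ∈ ℤ^d} c_{j,k} ψ_{j,k}` with convergence in `W^{m,p}`: for every `j` the
sum over `k` converges pointwise absolutely a.e. to a function `g_j ∈ W^{m,p}`, and the sum of
the `g_j` converges absolutely in `W^{m,p}`, to `F`. -/
def IsSynthesis {p : ℝ≥0∞} [Fact (1 ≤ p)] {m : ℕ} (α : ℕ+ → ℝ) (b : Matrix (Fin d) (Fin d) ℝ)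
    (ψ : Space d → ℂ) (c : ℕ+ → (Fin d → ℤ) → ℂ) (F : Sobolev d p m) : Prop :=
  ∃ g : ℕ+ → Sobolev d p m,
    (∀ j, ∀ᵐ x : Space d,
      (Summable fun k => ‖c j k * rescaled p (dilation d α j) b ψ k x‖) ∧
      HasSum (fun k => c j k * rescaled p (dilation d α j) b ψ k x) (Sobolev.toLp (g j) x)) ∧
    (Summable fun j => ‖g j‖) ∧ HasSum g F

/-- The matrix rescaling operator `(M_b f)(x) = |det b| f(bx)`. -/
def matrixRescale (b : Matrix (Fin d) (Fin d) ℝ) (f : Space d → ℂ) : Space d → ℂ :=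
  fun x => ((|b.det| : ℝ) : ℂ) * f (act b x)

/-- The inverse rescaling `(M_b⁻¹ f)(x) = |det b|⁻¹ f(b⁻¹x)`. -/
def matrixRescaleInv (b : Matrix (Fin d) (Fin d) ℝ) (f : Space d → ℂ) : Space d → ℂ :=
  fun x => ((|b.det|⁻¹ : ℝ) : ℂ) * f (act b⁻¹ x)

theorem act_act (A B : Matrix (Fin d) (Fin d) ℝ) (x : Space d) :
    act A (act B x) = act (A * B) x := by
  simp only [act]
  rw [Matrix.toLpLin_mul 2 2 2]
  rfl

theorem matrixRescale_matrixRescaleInv {b : Matrix (Fin d) (Fin d) ℝ} (hb : b.det ≠ 0)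
    (f : Space d → ℂ) : matrixRescale b (matrixRescaleInv b f) = f := by
  funext x
  have h : ((|b.det| : ℝ) : ℂ) ≠ 0 := by exact_mod_cast abs_ne_zero.mpr hb
  rw [matrixRescale, matrixRescaleInv, act_act, Matrix.nonsing_inv_mul b (isUnit_iff_ne_zero.mpr hb),
    Complex.ofReal_inv, mul_inv_cancel_left₀ h]
  simp [act]

theorem matrixRescaleInv_matrixRescale {b : Matrix (Fin d) (Fin d) ℝ} (hb : b.det ≠ 0)
    (f : Space d → ℂ) : matrixRescaleInv b (matrixRescale b f) = f := by
  funext x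
  have h : ((|b.det| : ℝ) : ℂ) ≠ 0 := by exact_mod_cast abs_ne_zero.mpr hb
  rw [matrixRescaleInv, matrixRescale, act_act, Matrix.mul_nonsing_inv b (isUnit_iff_ne_zero.mpr hb),
    Complex.ofReal_inv, inv_mul_cancel_left₀ h]
  simp [act]

end Synthesis

end AffineSynthesis

end

noncomputable section

namespace AffineSynthesis

/-! Conjugation by `M_b` reduces everything to the lattice `ℤ^d`: `M_b` turns convolution with `β`
into the average `A` over translates by the unit cube (`matrixRescale_synthesizer`), and the full
operator is `M_b⁻¹ ∘ S₀`, where `S₀` is built from `M_b η`. This is why `M_b⁻¹ f`, and not `f`, is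
what gets represented with sharp norm.

Boundedness. Let `F s = ∑ s_k η(· - k)`. A weighted Hölder inequality makes `F : ℓ^p → L^p` bounded
by the `L^p` norm of the periodization over one cube. Since the cube is a face plus a segment, `∂_t
A` is a face average of `1 - τ_t`, where `τ_t` is the translation by `e_t`. Since `F` intertwines `1
- τ_t` with `Δ_t`, the derivative `D^ρ A^m F s` is an average of translates of `F (Δ^ρ s)` for `|ρ|
≤ m` (`exists_isWeakDeriv_latticeSum`). Dilation by `a_j` contributes the factor `a_j^{|ρ|}`, which
is the weight in the sequence norm.

Surjectivity. At scale `j` take as coefficients the cube averages of `f(a_j⁻¹ ·)`, suitably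
normalized. Their differences are samples of averaged derivatives, so this single-scale sequence has
norm at most `‖f‖`, with constant one (`scaleNorm_sample_le`). Its synthesis does not converge to
`f` in norm: for each `ρ` the error in the `ρ`-th derivative is close to `v(x) (g(a_j x) - M)`, with
`v` near `D^ρ f` and `g` a bounded function of mean `M` over every unit cube
(`exists_approx_dilated`). Such errors oscillate and tend weakly to zero in `L^2`
(`tendsto_integral_mul_dilated`). By Mazur's lemma some convex combination of scales makes all of
them small at once, and boundedness and compact support carry the smallness from `L^2` to `L^p`
(`exists_small_combination`). Convexity keeps the coefficient norm below `‖f‖`.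

Thus `f` is approximated with norm control (`exists_approx_synthesis`). Iterating on the residuals
yields an exact preimage (`exists_preimage_of_approx`), and openness follows from the open mapping
theorem, both spaces being complete. -/

/-- `L^p(ℝ^d)`, complex valued. -/
abbrev LpC (d : ℕ) (p : ℝ≥0∞) : Type := Lp ℂ p (volume : Measure (Space d))

/-! ### Translations, averages of translations and dilations on `L^p`. -/

section Operators

variable {d : ℕ} {p : ℝ≥0∞} [Fact (1 ≤ p)]

/-! ### Translations -/

/-- The translation `f ↦ f(· - y)` of `L^p`. -/
def translate (y : Space d) : LpC d p →L[ℂ] LpC d p :=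
  (Lp.compMeasurePreservingₗᵢ ℂ (fun x : Space d => x - y)
    (measurePreserving_sub_right volume y)).toContinuousLinearMap

theorem coeFn_translate (y : Space d) (f : LpC d p) :
    translate y f =ᵐ[volume] fun x => f (x - y) :=
  Lp.coeFn_compMeasurePreserving f (measurePreserving_sub_right volume y)

theorem norm_translate (y : Space d) (f : LpC d p) : ‖translate y f‖ = ‖f‖ :=
  Lp.norm_compMeasurePreserving f (measurePreserving_sub_right volume y)

theorem ae_sub {P : Space d → Prop} (h : ∀ᵐ x, P x) (y : Space d) : ∀ᵐ x, P (x - y) :=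
  (measurePreserving_sub_right volume y).quasiMeasurePreserving.ae h

theorem translate_toLp {f : Space d → ℂ} (hf : MemLp f p volume) (y : Space d) :
    translate y (hf.toLp f) =ᵐ[volume] fun x => f (x - y) := by
  filter_upwards [coeFn_translate y (hf.toLp f), ae_sub hf.coeFn_toLp y] with x h1 h2
  rw [h1, h2]

theorem translate_translate (y z : Space d) (f : LpC d p) :
    translate y (translate z f) = translate (y + z) f := by
  refine Lp.ext ?_
  filter_upwards [coeFn_translate y (translate z f), coeFn_translate (y + z) f,
    ae_sub (coeFn_translate z f) y] with x h1 h2 h3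
  rw [h1, h2, h3, sub_sub]

theorem translate_zero (f : LpC d p) : translate 0 f = f := by
  refine Lp.ext ?_
  filter_upwards [coeFn_translate 0 f] with x h1
  rw [h1, sub_zero]

theorem translate_comm (y z : Space d) (f : LpC d p) :
    translate y (translate z f) = translate z (translate y f) := by
  rw [translate_translate, translate_translate, add_comm]

/-- Strong continuity of translations, which requires `p < ∞`. It makes the Bochner integrals
defining averages meaningful and drives every limit in the scale. -/
theorem continuous_translate [hp : Fact (p ≠ ⊤)] (f : LpC d p) :
    Continuous fun y => translate y f := by
  let g : C(Space d × Space d, Space d) := ⟨fun a => a.2 - a.1, by fun_prop⟩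
  exact (continuous_const (y := f)).compMeasurePreservingLp g.curry.continuous
    (fun y => measurePreserving_sub_right volume y) hp.out

/-! ### Pairing with test functions -/

/-- The functional `f ↦ ∫ φ f` on `L^p` is continuous. -/
theorem exists_pairing {φ : Space d → ℝ} (hφ : Continuous φ) (hc : HasCompactSupport φ) :
    ∃ Φ : LpC d p →L[ℂ] ℂ, ∀ f, Φ f = ∫ x, φ x • f x := by
  -- The conjugate exponent is written `(1 - p⁻¹)⁻¹` in `ℝ≥0∞`, which also covers `p = 1`, where it
  -- is `⊤`.
  have := ENNReal.HolderConjugate.inv_one_sub_inv' (Fact.out : 1 ≤ p)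
  have : Fact (1 ≤ (1 - p⁻¹)⁻¹) := by simp [fact_iff]
  have hm : MemLp (fun x => (φ x : ℂ)) (1 - p⁻¹)⁻¹ (volume : Measure (Space d)) :=
    Continuous.memLp_of_hasCompactSupport (by fun_prop)
      (hc.comp_left (g := Complex.ofReal) (by simp))
  refine ⟨((ContinuousLinearMap.mul ℂ ℂ).lpPairing volume p (1 - p⁻¹)⁻¹).flip (hm.toLp _),
    fun f => ?_⟩
  rw [ContinuousLinearMap.flip_apply, ContinuousLinearMap.lpPairing_eq_integral]
  refine integral_congr_ae ?_
  filter_upwards [hm.coeFn_toLp] with x hx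
  simp [hx, mul_comm]

/-! ### Averages of translations -/

variable [hp : Fact (p ≠ ⊤)]

theorem integrable_translate (μ : Measure (Space d)) [IsFiniteMeasure μ] (f : LpC d p) :
    Integrable (fun y => translate y f) μ :=
  Integrable.mono' (integrable_const ‖f‖) (continuous_translate f).aestronglyMeasurable
    (Eventually.of_forall fun y => (norm_translate y f).le)

/-- The average `∫ f(· - y) dμ(y)` of the translations of `f ∈ L^p`. -/
def transAvg (μ : Measure (Space d)) [IsProbabilityMeasure μ] : LpC d p →L[ℂ] LpC d p :=
  LinearMap.mkContinuous
    { toFun := fun f => ∫ y, translate y f ∂μ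
      map_add' := fun f g => by
        simp only [map_add]
        exact integral_add (integrable_translate μ f) (integrable_translate μ g)
      map_smul' := fun a f => by
        simp only [map_smul, RingHom.id_apply]
        exact integral_smul a _ } 1 fun f => by
    refine (norm_integral_le_of_norm_le_const (C := ‖f‖)
      (Eventually.of_forall fun y => (norm_translate y f).le)).trans ?_
    simp

variable (μ ν : Measure (Space d)) [IsProbabilityMeasure μ] [IsProbabilityMeasure ν]

theorem transAvg_apply (f : LpC d p) : transAvg μ f = ∫ y, translate y f ∂μ := rfl

theorem norm_transAvg_le (f : LpC d p) : ‖transAvg μ f‖ ≤ ‖f‖ := by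
  refine (norm_integral_le_of_norm_le_const (C := ‖f‖)
      (Eventually.of_forall fun y => (norm_translate y f).le)).trans ?_
  simp

/-- A bounded operator passes through a Bochner integral. Identities for averages thereby reduce to
identities for single translations. -/
theorem map_transAvg {G : Type*} [NormedAddCommGroup G] [NormedSpace ℂ G] [CompleteSpace G]
    (Φ : LpC d p →L[ℂ] G) (f : LpC d p) :
    Φ (transAvg μ f) = ∫ y, Φ (translate y f) ∂μ :=
  (Φ.integral_comp_comm (integrable_translate μ f)).symm

theorem translate_transAvg (z : Space d) (f : LpC d p) :
    translate z (transAvg μ f) = transAvg μ (translate z f) := by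
  rw [map_transAvg, transAvg_apply]
  simp only [translate_comm z]
  rfl

theorem transAvg_transAvg (f : LpC d p) :
    transAvg μ (transAvg ν f) = transAvg (μ.conv ν) f := by
  rw [transAvg_apply, transAvg_apply (μ.conv ν), integral_conv (integrable_translate _ f)]
  congr 1
  ext1 y
  rw [map_transAvg]
  simp only [translate_translate]
  rfl

theorem transAvg_comm (f : LpC d p) :
    transAvg μ (transAvg ν f) = transAvg ν (transAvg μ f) := by
  rw [transAvg_transAvg, transAvg_transAvg]
  congr 2
  exact Measure.conv_comm μ ν

theorem transAvg_dirac_zero (f : LpC d p) : transAvg (Measure.dirac 0) f = f := by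
  rw [transAvg_apply, integral_dirac, translate_zero]

/-! ### Linear changes of variables -/

theorem map_volume_linearEquiv (A : Space d ≃L[ℝ] Space d) :
    Measure.map A volume
      = ENNReal.ofReal |(LinearMap.det (A : Space d →ₗ[ℝ] Space d))⁻¹| • volume :=
  Measure.map_linearMap_addHaar_eq_smul_addHaar volume A.toLinearEquiv.isUnit_det'.ne_zero

theorem ae_linearEquiv {P : Space d → Prop} (h : ∀ᵐ x, P x) (A : Space d ≃L[ℝ] Space d) :
    ∀ᵐ x, P (A x) := by
  have : Measure.QuasiMeasurePreserving A volume volume := by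
    refine ⟨A.continuous.measurable, ?_⟩
    rw [map_volume_linearEquiv]
    exact Measure.smul_absolutelyContinuous
  exact this.ae h

theorem eLpNorm_comp_linearEquiv (A : Space d ≃L[ℝ] Space d) (f : Space d → ℂ) :
    eLpNorm (fun x => f (A x)) p volume
      = ENNReal.ofReal |(LinearMap.det (A : Space d →ₗ[ℝ] Space d))⁻¹| ^ (1 / p.toReal)
        * eLpNorm f p volume := by
  have h := A.toHomeomorph.measurableEmbedding.eLpNorm_map_measure (g := f) (p := p)
    (μ := volume)
  have h2 : Measure.map A.toHomeomorph volume = Measure.map A volume := rfl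
  rw [h2, map_volume_linearEquiv, eLpNorm_smul_measure_of_ne_top hp.out] at h
  rw [smul_eq_mul] at h
  simpa [Function.comp_def] using h.symm

theorem memLp_comp_linearEquiv (A : Space d ≃L[ℝ] Space d) {f : Space d → ℂ}
    (hf : MemLp f p volume) : MemLp (fun x => f (A x)) p volume := by
  refine ⟨hf.1.comp_quasiMeasurePreserving ⟨A.continuous.measurable, ?_⟩, ?_⟩
  · rw [map_volume_linearEquiv]
    exact Measure.smul_absolutelyContinuous
  · rw [eLpNorm_comp_linearEquiv]
    exact ENNReal.mul_lt_top (ENNReal.rpow_lt_top_of_nonneg (by positivity) (by simp)) hf.2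

/-- The composition `f ↦ f ∘ A` of `L^p`, for an invertible linear map `A`. -/
def compLin (A : Space d ≃L[ℝ] Space d) : LpC d p →L[ℂ] LpC d p :=
  LinearMap.mkContinuous
    { toFun := fun f => (memLp_comp_linearEquiv A (Lp.memLp f)).toLp _
      map_add' := fun f g => by
        refine Lp.ext ?_
        filter_upwards [(memLp_comp_linearEquiv A (Lp.memLp (f + g))).coeFn_toLp,
          (memLp_comp_linearEquiv A (Lp.memLp f)).coeFn_toLp,
          (memLp_comp_linearEquiv A (Lp.memLp g)).coeFn_toLp,
          ae_linearEquiv (Lp.coeFn_add f g) A, Lp.coeFn_add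
            ((memLp_comp_linearEquiv A (Lp.memLp f)).toLp _)
            ((memLp_comp_linearEquiv A (Lp.memLp g)).toLp _)] with x h1 h2 h3 h4 h5
        rw [h5, h1, Pi.add_apply, h2, h3, h4, Pi.add_apply]
      map_smul' := fun a f => by
        refine Lp.ext ?_
        filter_upwards [(memLp_comp_linearEquiv A (Lp.memLp (a • f))).coeFn_toLp,
          (memLp_comp_linearEquiv A (Lp.memLp f)).coeFn_toLp,
          ae_linearEquiv (Lp.coeFn_smul a f) A, Lp.coeFn_smul a
            ((memLp_comp_linearEquiv A (Lp.memLp f)).toLp _)] with x h1 h2 h3 h4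
        rw [RingHom.id_apply, h4, h1, Pi.smul_apply, h2, h3, Pi.smul_apply] }
    (|(LinearMap.det (A : Space d →ₗ[ℝ] Space d))⁻¹| ^ (1 / p.toReal)) fun f => by
    change ‖(memLp_comp_linearEquiv A (Lp.memLp f)).toLp _‖ ≤ _
    rw [Lp.norm_toLp, eLpNorm_comp_linearEquiv, ENNReal.toReal_mul, ← ENNReal.toReal_rpow,
      ENNReal.toReal_ofReal (abs_nonneg _), Lp.norm_def]

theorem coeFn_compLin (A : Space d ≃L[ℝ] Space d) (f : LpC d p) :
    compLin A f =ᵐ[volume] fun x => f (A x) :=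
  (memLp_comp_linearEquiv A (Lp.memLp f)).coeFn_toLp

theorem norm_compLin (A : Space d ≃L[ℝ] Space d) (f : LpC d p) :
    ‖compLin A f‖ = |(LinearMap.det (A : Space d →ₗ[ℝ] Space d))⁻¹| ^ (1 / p.toReal) * ‖f‖ := by
  change ‖(memLp_comp_linearEquiv A (Lp.memLp f)).toLp _‖ = _
  rw [Lp.norm_toLp, eLpNorm_comp_linearEquiv, ENNReal.toReal_mul, ← ENNReal.toReal_rpow,
      ENNReal.toReal_ofReal (abs_nonneg _), Lp.norm_def]

/-- Multiplication by a nonzero real number, as an invertible linear map. -/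
def scaleEquiv (a : ℝˣ) : Space d ≃L[ℝ] Space d := ContinuousLinearEquiv.smulLeft a

theorem scaleEquiv_apply (a : ℝˣ) (x : Space d) : scaleEquiv a x = (a : ℝ) • x := rfl

theorem det_scaleEquiv (a : ℝˣ) :
    LinearMap.det ((scaleEquiv a : Space d ≃L[ℝ] Space d) : Space d →ₗ[ℝ] Space d)
      = (a : ℝ) ^ d := by
  have : ((scaleEquiv a : Space d ≃L[ℝ] Space d) : Space d →ₗ[ℝ] Space d)
      = (a : ℝ) • LinearMap.id := rfl
  rw [this, LinearMap.det_smul, LinearMap.det_id]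
  simp

/-- The normalizing factor `|a|^{d/p}`. -/
def dilFactor (d : ℕ) (p : ℝ≥0∞) (a : ℝˣ) : ℝ := (|(a : ℝ)| ^ d) ^ (1 / p.toReal)

theorem dilFactor_pos (a : ℝˣ) : 0 < dilFactor d p a :=
  Real.rpow_pos_of_pos (pow_pos (abs_pos.mpr a.ne_zero) _) _

/-- The isometric dilation `f ↦ |a|^{d/p} f(a ·)` of `L^p`. -/
def dilate (a : ℝˣ) : LpC d p →L[ℂ] LpC d p :=
  (dilFactor d p a : ℂ) • compLin (scaleEquiv a)

theorem coeFn_dilate (a : ℝˣ) (f : LpC d p) :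
    dilate a f =ᵐ[volume] fun x => (dilFactor d p a : ℂ) * f ((a : ℝ) • x) := by
  filter_upwards [coeFn_compLin (scaleEquiv a) f,
    Lp.coeFn_smul (dilFactor d p a : ℂ) (compLin (scaleEquiv a) f)] with x h1 h2
  change ((dilFactor d p a : ℂ) • compLin (scaleEquiv a) f) x = _
  rw [h2, Pi.smul_apply, h1, smul_eq_mul, scaleEquiv_apply]

theorem norm_dilate (a : ℝˣ) (f : LpC d p) : ‖dilate a f‖ = ‖f‖ := by
  change ‖(dilFactor d p a : ℂ) • compLin (scaleEquiv a) f‖ = _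
  rw [norm_smul, norm_compLin, det_scaleEquiv, Complex.norm_real, Real.norm_eq_abs,
    abs_of_pos (dilFactor_pos a), dilFactor, abs_inv, abs_pow,
    Real.inv_rpow (by positivity), ← mul_assoc, mul_inv_cancel₀, one_mul]
  exact (dilFactor_pos (p := p) (d := d) a).ne'

theorem dilFactor_inv (a : ℝˣ) : dilFactor d p a⁻¹ = (dilFactor d p a)⁻¹ := by
  simp only [dilFactor, Units.val_inv_eq_inv_val, abs_inv, inv_pow]
  rw [Real.inv_rpow (by positivity)]

/-- Conjugation by a dilation shrinks the translation vector by the factor `a⁻¹`, and the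
normalizing factors cancel. -/
theorem dilate_translate_dilate_inv (a : ℝˣ) (y : Space d) (f : LpC d p) :
    dilate a (translate y (dilate a⁻¹ f)) = translate ((a : ℝ)⁻¹ • y) f := by
  refine Lp.ext ?_
  filter_upwards [coeFn_dilate a (translate y (dilate a⁻¹ f)),
    ae_linearEquiv (coeFn_translate y (dilate a⁻¹ f)) (scaleEquiv a),
    ae_linearEquiv (ae_sub (coeFn_dilate a⁻¹ f) y) (scaleEquiv a),
    coeFn_translate ((a : ℝ)⁻¹ • y) f] with x h1 h2 h3 h4
  rw [scaleEquiv_apply] at h2 h3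
  rw [h1, h2, h3, h4, dilFactor_inv, Complex.ofReal_inv, mul_inv_cancel_left₀
    (by exact_mod_cast (dilFactor_pos a).ne'), smul_sub, Units.val_inv_eq_inv_val, smul_smul,
    inv_mul_cancel₀ a.ne_zero, one_smul]

theorem dilate_dilate_inv (a : ℝˣ) (f : LpC d p) : dilate a (dilate a⁻¹ f) = f := by
  have := dilate_translate_dilate_inv a 0 f
  rwa [translate_zero, smul_zero, translate_zero] at this

/-- Conjugated by large dilations, an average becomes an average over translations by `a_j⁻¹ y → 0`.
Dominated convergence applies because translations are isometries; it needs a countably generated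
filter. -/
theorem tendsto_dilate_transAvg {ι : Type*} {l : Filter ι} {a : ι → ℝˣ}
    [l.IsCountablyGenerated]
    (ha : Tendsto (fun j => |(a j : ℝ)|) l atTop) (f : LpC d p) :
    Tendsto (fun j => dilate (a j) (transAvg μ (dilate (a j)⁻¹ f))) l (𝓝 f) := by
  have h1 : ∀ j, dilate (a j) (transAvg μ (dilate (a j)⁻¹ f))
      = ∫ y, translate ((a j : ℝ)⁻¹ • y) f ∂μ := fun j => by
    rw [map_transAvg]
    simp only [dilate_translate_dilate_inv]
    rfl
  have h2 : f = ∫ _y : Space d, f ∂μ := by simp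
  simp only [h1]
  nth_rw 2 [h2]
  refine tendsto_integral_filter_of_dominated_convergence (fun _ => ‖f‖) ?_ ?_
    (integrable_const _) ?_
  · refine Eventually.of_forall fun j => ?_
    exact ((continuous_translate f).comp (by fun_prop)).aestronglyMeasurable
  · exact Eventually.of_forall fun j => Eventually.of_forall fun y => (norm_translate _ f).le
  · refine Eventually.of_forall fun y => ?_
    have h3 : Tendsto (fun j => (a j : ℝ)⁻¹ • y) l (𝓝 0) := by
      have : Tendsto (fun j => (a j : ℝ)⁻¹) l (𝓝 0) := by
        rw [tendsto_zero_iff_abs_tendsto_zero]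
        simpa [Function.comp_def, abs_inv, Pi.inv_def] using ha.inv_tendsto_atTop
      simpa using this.smul_const y
    have := ((continuous_translate f).tendsto 0).comp h3
    rwa [translate_zero] at this

end Operators

/-! ### Classical and weak derivatives: symmetry, composition, chain rule, averages. -/

section WeakDerivatives

variable {d : ℕ}

/-! ### Multi-indices and classical derivatives -/

/-- Induction on the order `|ρ|`, peeling off one unit vector. Statements about `D^ρ` and `Δ^ρ`
thereby reduce to a single derivative or difference. -/
theorem multiIndex_induction {P : (Fin d → ℕ) → Prop} (h0 : P 0)
    (hs : ∀ ρ t, P ρ → P (ρ + Pi.single t 1)) (ρ : Fin d → ℕ) : P ρ := by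
  generalize hn : ∑ i, ρ i = n
  induction n generalizing ρ with
  | zero =>
    have : ρ = 0 := by
      funext i
      exact (Finset.sum_eq_zero_iff.mp hn) i (Finset.mem_univ i)
    rwa [this]
  | succ n ih =>
    obtain ⟨t, -, ht⟩ : ∃ t ∈ Finset.univ, ρ t ≠ 0 := by
      by_contra! h
      rw [Finset.sum_eq_zero h] at hn
      omega
    have hle : Pi.single t 1 ≤ ρ := by
      intro i
      by_cases hi : i = t
      · subst hi
        simpa using Nat.one_le_iff_ne_zero.mpr ht
      · simp [hi]
    rw [← tsub_add_cancel_of_le hle] at hn ⊢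
    refine hs _ t (ih _ ?_)
    simp only [Pi.add_apply, Finset.sum_add_distrib, Finset.sum_pi_single', Finset.mem_univ,
      if_true] at hn
    simpa using hn

theorem sum_add_single (ρ : Fin d → ℕ) (t : Fin d) :
    ∑ i, (ρ + Pi.single t 1 : Fin d → ℕ) i = ∑ i, ρ i + 1 := by
  simp [Finset.sum_add_distrib]

theorem sum_single (t : Fin d) : ∑ i, (Pi.single t 1 : Fin d → ℕ) i = 1 := by
  simp

theorem contDiff_partialDeriv (t : Fin d) {φ : Space d → ℝ} (h : ContDiff ℝ ∞ φ) :
    ContDiff ℝ ∞ (partialDeriv t φ) :=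
  (h.fderiv_right (m := ∞) (by simp)).clm_apply contDiff_const

theorem partialDeriv_comm (s t : Fin d) {φ : Space d → ℝ} (h : ContDiff ℝ ∞ φ) :
    partialDeriv s (partialDeriv t φ) = partialDeriv t (partialDeriv s φ) := by
  have key : ∀ u v : Fin d, ∀ x, partialDeriv u (partialDeriv v φ) x
      = fderiv ℝ (fderiv ℝ φ) x (EuclideanSpace.single u 1) (EuclideanSpace.single v 1) := by
    intro u v x
    have hd : DifferentiableAt ℝ (fderiv ℝ φ) x :=
      ((h.fderiv_right (m := ∞) (by simp)).differentiable (by simp)) x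
    change fderiv ℝ (fun y => fderiv ℝ φ y (EuclideanSpace.single v 1)) x _ = _
    rw [fderiv_clm_apply hd (differentiableAt_const _)]
    simp
  funext x
  rw [key, key]
  exact ((contDiff_infty.mp h 2).contDiffAt.isSymmSndFDerivAt (by simp)).eq _ _

theorem contDiff_foldr (ρ : Fin d → ℕ) (l : List (Fin d)) {φ : Space d → ℝ}
    (h : ContDiff ℝ ∞ φ) :
    ContDiff ℝ ∞ (l.foldr (fun t g => (partialDeriv t)^[ρ t] g) φ) := by
  induction l with
  | nil => exact h
  | cons t l ih =>
    simp only [List.foldr_cons]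
    induction ρ t with
    | zero => exact ih
    | succ n ihn =>
      rw [Function.iterate_succ_apply']
      exact contDiff_partialDeriv t ihn

theorem contDiff_iterate (s : Fin d) (n : ℕ) {φ : Space d → ℝ} (h : ContDiff ℝ ∞ φ) :
    ContDiff ℝ ∞ ((partialDeriv s)^[n] φ) := by
  induction n with
  | zero => exact h
  | succ n ihn =>
    rw [Function.iterate_succ_apply']
    exact contDiff_partialDeriv s ihn

theorem partialDeriv_iterate_comm (s t : Fin d) (n : ℕ) {φ : Space d → ℝ}
    (h : ContDiff ℝ ∞ φ) :
    partialDeriv t ((partialDeriv s)^[n] φ) = (partialDeriv s)^[n] (partialDeriv t φ) := by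
  induction n with
  | zero => rfl
  | succ n ihn =>
    rw [Function.iterate_succ_apply', Function.iterate_succ_apply',
      partialDeriv_comm t s (contDiff_iterate s n h), ihn]

theorem partialDeriv_foldr_comm (ρ : Fin d → ℕ) (t : Fin d) (l : List (Fin d))
    {φ : Space d → ℝ} (h : ContDiff ℝ ∞ φ) :
    partialDeriv t (l.foldr (fun t g => (partialDeriv t)^[ρ t] g) φ)
      = l.foldr (fun t g => (partialDeriv t)^[ρ t] g) (partialDeriv t φ) := by
  induction l with
  | nil => rfl
  | cons s l ih =>
    simp only [List.foldr_cons]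
    rw [partialDeriv_iterate_comm s t _ (contDiff_foldr ρ l h), ih]

theorem partialDeriv_multiDeriv (ρ : Fin d → ℕ) (t : Fin d) {φ : Space d → ℝ}
    (h : ContDiff ℝ ∞ φ) :
    partialDeriv t (multiDeriv ρ φ) = multiDeriv ρ (partialDeriv t φ) :=
  partialDeriv_foldr_comm ρ t _ h

theorem foldr_add_single_of_notMem (ρ : Fin d → ℕ) (t : Fin d) (l : List (Fin d)) (ht : t ∉ l)
    (φ : Space d → ℝ) :
    l.foldr (fun s g => (partialDeriv s)^[(ρ + Pi.single t 1 : Fin d → ℕ) s] g) φ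
      = l.foldr (fun s g => (partialDeriv s)^[ρ s] g) φ := by
  induction l with
  | nil => rfl
  | cons s l ih =>
    simp only [List.mem_cons, not_or] at ht
    simp only [List.foldr_cons]
    rw [ih ht.2]
    simp [Ne.symm ht.1]

/-- The iterated derivative is composed in the order of the list, so the extra `∂_t` has to be
commuted to the front through the factors preceding index `t`. `Nodup` guarantees that the exponent
is raised at one place only. -/
theorem foldr_add_single (ρ : Fin d → ℕ) (t : Fin d) (l : List (Fin d)) (ht : t ∈ l)
    (hl : l.Nodup) {φ : Space d → ℝ} (h : ContDiff ℝ ∞ φ) :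
    l.foldr (fun s g => (partialDeriv s)^[(ρ + Pi.single t 1 : Fin d → ℕ) s] g) φ
      = partialDeriv t (l.foldr (fun s g => (partialDeriv s)^[ρ s] g) φ) := by
  induction l with
  | nil => simp at ht
  | cons s l ih =>
    rw [List.nodup_cons] at hl
    simp only [List.foldr_cons]
    by_cases hst : t = s
    · subst hst
      rw [foldr_add_single_of_notMem ρ t l hl.1]
      simp only [Pi.add_apply, Pi.single_eq_same]
      rw [Function.iterate_succ_apply']
    · have : (ρ + Pi.single t 1 : Fin d → ℕ) s = ρ s := by simp [Ne.symm hst]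
      rw [ih ((List.mem_cons.mp ht).resolve_left hst) hl.2, this,
        partialDeriv_iterate_comm _ _ _ (contDiff_foldr ρ l h)]

theorem multiDeriv_add_single (ρ : Fin d → ℕ) (t : Fin d) {φ : Space d → ℝ}
    (h : ContDiff ℝ ∞ φ) :
    multiDeriv (ρ + Pi.single t 1) φ = partialDeriv t (multiDeriv ρ φ) :=
  foldr_add_single ρ t _ (List.mem_finRange t) (List.nodup_finRange d) h

theorem multiDeriv_zero (φ : Space d → ℝ) : multiDeriv 0 φ = φ := by
  unfold multiDeriv
  induction List.finRange d with
  | nil => rfl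
  | cons t l ih => simp

theorem multiDeriv_single (t : Fin d) {φ : Space d → ℝ} (h : ContDiff ℝ ∞ φ) :
    multiDeriv (Pi.single t 1) φ = partialDeriv t φ := by
  have := multiDeriv_add_single 0 t h
  rwa [zero_add, multiDeriv_zero] at this

theorem partialDeriv_comp_add (t : Fin d) (y : Space d) (φ : Space d → ℝ) :
    partialDeriv t (fun x => φ (x + y)) = fun x => partialDeriv t φ (x + y) := by
  funext x
  simp only [partialDeriv]
  rw [fderiv_comp_add_right]

theorem multiDeriv_comp_add (ρ : Fin d → ℕ) (y : Space d) {φ : Space d → ℝ}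
    (h : ContDiff ℝ ∞ φ) :
    multiDeriv ρ (fun x => φ (x + y)) = fun x => multiDeriv ρ φ (x + y) := by
  have hy : ContDiff ℝ ∞ fun x => φ (x + y) := h.comp (contDiff_id.add contDiff_const)
  induction ρ using multiIndex_induction with
  | h0 => simp only [multiDeriv_zero]
  | hs ρ t ih =>
    rw [multiDeriv_add_single ρ t hy, ih, multiDeriv_add_single ρ t h, partialDeriv_comp_add]

theorem multiDeriv_comp_smul (ρ : Fin d → ℕ) (c : ℝ) {φ : Space d → ℝ}
    (h : ContDiff ℝ ∞ φ) :
    multiDeriv ρ (fun x => φ (c • x)) = fun x => c ^ (∑ i, ρ i) * multiDeriv ρ φ (c • x) := by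
  have hy : ContDiff ℝ ∞ fun x => φ (c • x) := h.comp (contDiff_const_smul c)
  induction ρ using multiIndex_induction with
  | h0 => simp [multiDeriv_zero]
  | hs ρ t ih =>
    have hd : Differentiable ℝ (multiDeriv ρ φ) := (contDiff_foldr ρ _ h).differentiable (by simp)
    rw [multiDeriv_add_single ρ t hy, ih, multiDeriv_add_single ρ t h, sum_add_single]
    funext x
    simp only [partialDeriv]
    rw [fderiv_const_mul (by fun_prop)]
    have := fderiv_comp_smul (𝕜 := ℝ) c (f := multiDeriv ρ φ) (x := x)
    rw [this]
    simp only [FunLike.coe_smul, Pi.smul_apply, smul_eq_mul]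
    ring

theorem contDiff_comp_add_test {φ : Space d → ℝ} (h : ContDiff ℝ ∞ φ ∧ HasCompactSupport φ)
    (y : Space d) :
    ContDiff ℝ ∞ (fun x => φ (x + y)) ∧ HasCompactSupport fun x => φ (x + y) :=
  ⟨h.1.comp (contDiff_id.add contDiff_const), h.2.comp_homeomorph (Homeomorph.addRight y)⟩

/-! ### Calculus of weak derivatives in `L^p` -/

variable {p : ℝ≥0∞} [Fact (1 ≤ p)]

/-- The derivative `∂_tφ` is again a test function, and `∂_t` commutes with the classical `D^ρ`. A
first derivative can therefore be split off on either side, and the `of_` variants undo the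
splitting by cancelling the common sign. -/
theorem IsWeakDeriv.comp {ρ : Fin d → ℕ} {t : Fin d} {f g h : Space d → ℂ}
    (h1 : IsWeakDeriv ρ f g) (h2 : IsWeakDeriv (Pi.single t 1) g h) :
    IsWeakDeriv (ρ + Pi.single t 1) f h := by
  intro φ hφ hc
  have e := h2 φ hφ hc
  have ht := partialDeriv_test t ⟨hφ, hc⟩
  rw [multiDeriv_single t hφ, sum_single] at e
  rw [multiDeriv_add_single ρ t hφ, partialDeriv_multiDeriv ρ t hφ, h1 _ ht.1 ht.2, e,
    sum_add_single]
  ring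

theorem IsWeakDeriv.comp_left {ρ : Fin d → ℕ} {t : Fin d} {f g h : Space d → ℂ}
    (h1 : IsWeakDeriv (Pi.single t 1) f g) (h2 : IsWeakDeriv ρ g h) :
    IsWeakDeriv (ρ + Pi.single t 1) f h := by
  intro φ hφ hc
  have ht := multiDeriv_test ρ ⟨hφ, hc⟩
  have e := h1 _ ht.1 ht.2
  rw [multiDeriv_single t ht.1, sum_single] at e
  rw [multiDeriv_add_single ρ t hφ, e, h2 φ hφ hc, sum_add_single]
  ring

theorem IsWeakDeriv.of_comp {ρ : Fin d → ℕ} {t : Fin d} {f g h : Space d → ℂ}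
    (h1 : IsWeakDeriv ρ f g) (h2 : IsWeakDeriv (ρ + Pi.single t 1) f h) :
    IsWeakDeriv (Pi.single t 1) g h := by
  intro φ hφ hc
  have ht := partialDeriv_test t ⟨hφ, hc⟩
  have e := h1 _ ht.1 ht.2
  have e2 := h2 φ hφ hc
  rw [multiDeriv_add_single ρ t hφ, partialDeriv_multiDeriv ρ t hφ, e, sum_add_single,
    pow_succ, mul_assoc] at e2
  rw [multiDeriv_single t hφ, sum_single, pow_one]
  exact mul_left_cancel₀ (pow_ne_zero _ (by norm_num)) e2

theorem IsWeakDeriv.of_comp_left {ρ : Fin d → ℕ} {t : Fin d} {f g h : Space d → ℂ}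
    (h1 : IsWeakDeriv (Pi.single t 1) f g) (h2 : IsWeakDeriv (ρ + Pi.single t 1) f h) :
    IsWeakDeriv ρ g h := by
  intro φ hφ hc
  have ht := multiDeriv_test ρ ⟨hφ, hc⟩
  have e := h1 _ ht.1 ht.2
  have e2 := h2 φ hφ hc
  rw [multiDeriv_single t ht.1, sum_single] at e
  rw [multiDeriv_add_single ρ t hφ, e, sum_add_single] at e2
  linear_combination (-1) * e2

/-- Weak differentiation is closed in `L^p`: both sides of the defining identity are continuous
functionals. Completeness of `W^{m,p}` rests on this. -/
theorem isWeakDeriv_of_tendsto {ι : Type*} {l : Filter ι} [l.NeBot] {ρ : Fin d → ℕ}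
    {u v : ι → LpC d p} {f g : LpC d p} (hu : Tendsto u l (𝓝 f)) (hv : Tendsto v l (𝓝 g))
    (h : ∀ i, IsWeakDeriv ρ (u i) (v i)) : IsWeakDeriv ρ f g := by
  intro φ hφ hc
  have ht := multiDeriv_test ρ ⟨hφ, hc⟩
  obtain ⟨Φ, hΦ⟩ := exists_pairing (p := p) hφ.continuous hc
  obtain ⟨Ψ, hΨ⟩ := exists_pairing (p := p) ht.1.continuous ht.2
  rw [← hΦ, ← hΨ]
  refine tendsto_nhds_unique ((Ψ.continuous.tendsto f).comp hu)
    ((((Φ.continuous.tendsto g).comp hv).const_mul ((-1) ^ ∑ i, ρ i)).congr fun i => ?_)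
  simp only [Function.comp_apply]
  rw [hΦ, hΨ, h i φ hφ hc]

theorem pairing_translate (φ : Space d → ℝ) (y : Space d) (f : LpC d p) :
    ∫ x, φ x • translate y f x = ∫ x, φ (x + y) • f x := by
  rw [← integral_sub_right_eq_self (fun x => φ (x + y) • f x) y]
  refine integral_congr_ae ?_
  filter_upwards [coeFn_translate y f] with x hx
  rw [hx, sub_add_cancel]

theorem IsWeakDeriv.translate {ρ : Fin d → ℕ} {f g : LpC d p} (h : IsWeakDeriv ρ f g)
    (y : Space d) : IsWeakDeriv ρ (translate y f) (AffineSynthesis.translate y g) := by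
  intro φ hφ hc
  have ht := contDiff_comp_add_test ⟨hφ, hc⟩ y
  rw [pairing_translate, pairing_translate, ← h _ ht.1 ht.2, multiDeriv_comp_add ρ y hφ]

theorem pairing_compLin [hp : Fact (p ≠ ⊤)] (A : Space d ≃L[ℝ] Space d) (φ : Space d → ℝ)
    (f : LpC d p) :
    ∫ x, φ x • compLin A f x
      = |(LinearMap.det (A : Space d →ₗ[ℝ] Space d))⁻¹| • ∫ y, φ (A.symm y) • f y := by
  have h1 : ∫ x, φ x • compLin A f x = ∫ x, (fun y => φ (A.symm y) • f y) (A x) := by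
    refine integral_congr_ae ?_
    filter_upwards [coeFn_compLin A f] with x hx
    rw [hx, A.symm_apply_apply]
  have h2 := A.toHomeomorph.measurableEmbedding.integral_map (μ := volume)
    (fun y => φ (A.symm y) • f y)
  have h3 : Measure.map A.toHomeomorph volume = Measure.map A volume := rfl
  rw [h3, map_volume_linearEquiv, integral_smul_measure] at h2
  rw [h1]
  refine h2.symm.trans ?_
  rw [ENNReal.toReal_ofReal (abs_nonneg _)]

theorem IsWeakDeriv.dilate [hp : Fact (p ≠ ⊤)] {ρ : Fin d → ℕ} {f g : LpC d p}
    (h : IsWeakDeriv ρ f g) (a : ℝˣ) :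
    IsWeakDeriv ρ (dilate a f)
      (((a : ℝ) : ℂ) ^ (∑ i, ρ i) • AffineSynthesis.dilate a g : LpC d p) := by
  suffices H : IsWeakDeriv ρ (compLin (scaleEquiv a) f)
      (((a : ℝ) : ℂ) ^ (∑ i, ρ i) • compLin (scaleEquiv a) g : LpC d p) by
    have := H.smul (dilFactor d p a : ℂ)
    rw [smul_comm] at this
    exact this
  intro φ hφ hc
  have hs : ∀ x, (scaleEquiv a : Space d ≃L[ℝ] Space d).symm x = (a : ℝ)⁻¹ • x := fun x => by
    rw [ContinuousLinearEquiv.symm_apply_eq, scaleEquiv_apply, smul_smul,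
      mul_inv_cancel₀ a.ne_zero, one_smul]
  have hφ' : ContDiff ℝ ∞ fun x => φ ((a : ℝ)⁻¹ • x) := hφ.comp (contDiff_const_smul _)
  have hc' : HasCompactSupport fun x => φ ((a : ℝ)⁻¹ • x) :=
    hc.comp_homeomorph (Homeomorph.smulOfNeZero _ (inv_ne_zero a.ne_zero))
  have e := h _ hφ' hc'
  have e1 : ∫ x, φ x • (((a : ℝ) : ℂ) ^ (∑ i, ρ i) • compLin (scaleEquiv a) g : LpC d p) x
      = ((a : ℝ) : ℂ) ^ (∑ i, ρ i) * ∫ x, φ x • compLin (scaleEquiv a) g x := by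
    rw [← integral_const_mul]
    refine integral_congr_ae ?_
    filter_upwards [Lp.coeFn_smul (((a : ℝ) : ℂ) ^ (∑ i, ρ i)) (compLin (scaleEquiv a) g)]
      with x hx
    rw [hx, Pi.smul_apply, smul_eq_mul, mul_smul_comm]
  have e2 : ∀ x, multiDeriv ρ φ ((a : ℝ)⁻¹ • x)
      = (a : ℝ) ^ (∑ i, ρ i) * multiDeriv ρ (fun x => φ ((a : ℝ)⁻¹ • x)) x := fun x => by
    rw [multiDeriv_comp_smul ρ _ hφ, ← mul_assoc, ← mul_pow, mul_inv_cancel₀ a.ne_zero, one_pow,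
      one_mul]
  rw [e1, pairing_compLin, pairing_compLin]
  simp only [hs, e2, mul_smul, integral_smul]
  rw [e]
  simp only [Complex.real_smul]
  push_cast
  ring

/-- Write `e_t = A⁻¹ (A e_t)` and expand `A e_t` in the standard basis. -/
theorem partialDeriv_comp_linear (t : Fin d) (A : Space d ≃L[ℝ] Space d) {φ : Space d → ℝ}
    (h : ContDiff ℝ ∞ φ) (y : Space d) :
    partialDeriv t φ (A.symm y) = ∑ s, (A (EuclideanSpace.single t 1)) s *
      partialDeriv s (fun x => φ (A.symm x)) y := by
  have hd : DifferentiableAt ℝ φ (A.symm y) := h.differentiable (by simp) _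
  have h1 : ∀ v, fderiv ℝ (fun x => φ (A.symm x)) y v = fderiv ℝ φ (A.symm y) (A.symm v) := by
    intro v
    have := fderiv_comp y (g := φ) (f := A.symm) hd A.symm.differentiableAt
    rw [ContinuousLinearEquiv.fderiv] at this
    change fderiv ℝ (φ ∘ A.symm) y v = _
    rw [this]
    rfl
  simp only [partialDeriv, h1]
  have h2 : ∑ s, (A (EuclideanSpace.single t 1)) s • EuclideanSpace.single s (1 : ℝ)
      = A (EuclideanSpace.single t 1) := by
    simpa using (EuclideanSpace.basisFun (Fin d) ℝ).sum_repr (A (EuclideanSpace.single t 1))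
  calc fderiv ℝ φ (A.symm y) (EuclideanSpace.single t 1)
      = fderiv ℝ φ (A.symm y) (A.symm (A (EuclideanSpace.single t 1))) := by
        rw [A.symm_apply_apply]
    _ = _ := by
      rw [← h2]
      simp only [map_sum, map_smul, smul_eq_mul]
      refine Finset.sum_congr rfl fun s _ => ?_
      rw [h2]

/-- The chain rule for first order weak derivatives. -/
theorem isWeakDeriv_compLin [hp : Fact (p ≠ ⊤)] (A : Space d ≃L[ℝ] Space d) {f : LpC d p}
    {g : Fin d → LpC d p} (h : ∀ s, IsWeakDeriv (Pi.single s 1) f (g s)) (t : Fin d) :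
    IsWeakDeriv (Pi.single t 1) (compLin A f)
      (∑ s, ((A (EuclideanSpace.single t 1)) s : ℂ) • compLin A (g s) : LpC d p) := by
  intro φ hφ hc
  have hφ' : ContDiff ℝ ∞ fun x => φ (A.symm x) := hφ.comp A.symm.contDiff
  have hc' : HasCompactSupport fun x => φ (A.symm x) :=
    hc.comp_homeomorph A.symm.toHomeomorph
  obtain ⟨Φ, hΦ⟩ := exists_pairing (p := p) hφ.continuous hc
  have e : ∀ s, ∫ y, partialDeriv s (fun x => φ (A.symm x)) y • f y
      = - ∫ y, φ (A.symm y) • g s y := fun s => by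
    have := h s _ hφ' hc'
    rw [multiDeriv_single s hφ', sum_single] at this
    rw [this]
    ring
  rw [multiDeriv_single t hφ, sum_single, pairing_compLin, ← hΦ, map_sum]
  simp only [partialDeriv_comp_linear t A hφ, Finset.sum_smul]
  rw [integral_finsetSum _ fun s _ => ?_]
  · simp only [map_smul]
    simp only [mul_smul, integral_smul, e, hΦ, pairing_compLin]
    rw [Finset.smul_sum, Finset.mul_sum]
    refine Finset.sum_congr rfl fun s _ => ?_
    simp only [Complex.real_smul, smul_eq_mul]
    ring
  · simp only [mul_smul]
    exact (integrable_test_smul (partialDeriv_test s ⟨hφ', hc'⟩) f).smul _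

/-! ### Averages of translations and weak derivatives -/

variable [hp : Fact (p ≠ ⊤)]

theorem pairing_transAvg {φ : Space d → ℝ} (hφ : Continuous φ) (hc : HasCompactSupport φ)
    (μ : Measure (Space d)) [IsProbabilityMeasure μ] (f : LpC d p) :
    ∫ x, φ x • transAvg μ f x = ∫ y, ∫ x, φ x • translate y f x ∂volume ∂μ := by
  obtain ⟨Φ, hΦ⟩ := exists_pairing (p := p) hφ hc
  rw [← hΦ, map_transAvg]
  simp only [hΦ]

theorem IsWeakDeriv.transAvg {ρ : Fin d → ℕ} {f g : LpC d p} (h : IsWeakDeriv ρ f g)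
    (μ : Measure (Space d)) [IsProbabilityMeasure μ] :
    IsWeakDeriv ρ (transAvg μ f) (AffineSynthesis.transAvg μ g) := by
  intro φ hφ hc
  have ht := multiDeriv_test ρ ⟨hφ, hc⟩
  rw [pairing_transAvg ht.1.continuous ht.2, pairing_transAvg hφ.continuous hc,
    ← integral_const_mul]
  congr 1
  ext1 y
  exact h.translate y φ hφ hc

/-- The uniform probability measure on the segment from `0` to `e_t`. -/
def segMeasure (t : Fin d) : Measure (Space d) :=
  Measure.map (fun u : ℝ => u • EuclideanSpace.single t (1 : ℝ)) (volume.restrict (Set.Ico 0 1))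

instance (t : Fin d) : IsProbabilityMeasure (segMeasure t) := by
  have : IsProbabilityMeasure ((volume : Measure ℝ).restrict (Set.Ico 0 1)) :=
    ⟨by simp⟩
  exact Measure.isProbabilityMeasure_map (by fun_prop)

/-- Justifies Fubini in the segment average. The translates of the support of `ψ` along the segment
sweep out a compact set, on which `f` is integrable. -/
theorem integrable_prod_partialDeriv {ψ : Space d → ℝ} (hψ : Continuous ψ)
    (hc : HasCompactSupport ψ) (e : Space d) (f : LpC d p) :
    Integrable (fun z : ℝ × Space d => ψ (z.2 + z.1 • e) • f z.2)
      ((volume.restrict (Set.Ico 0 1)).prod volume) := by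
  obtain ⟨M, hM⟩ := hψ.bounded_above_of_compact_support hc
  set K : Set (Space d) := (fun z : ℝ × Space d => z.2 - z.1 • e) ''
    (Set.Icc (0 : ℝ) 1 ×ˢ tsupport ψ) with hK
  have hKc : IsCompact K := (isCompact_Icc.prod hc.isCompact).image (by fun_prop)
  have hint : Integrable (fun x => M * ‖K.indicator f x‖) volume := by
    have h0 := ((Lp.memLp f).locallyIntegrable Fact.out).integrableOn_isCompact hKc
    exact (h0.integrable_indicator hKc.measurableSet).norm.const_mul M
  have h2 := hint.comp_snd (volume.restrict (Set.Ico (0 : ℝ) 1))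
  refine h2.mono' ?_ ?_
  · have hcont : Continuous fun z : ℝ × Space d => ψ (z.2 + z.1 • e) := hψ.comp (by fun_prop)
    exact hcont.aestronglyMeasurable.smul (Lp.aestronglyMeasurable f).comp_snd
  · have h3 : ∀ᵐ z ∂((volume.restrict (Set.Ico (0 : ℝ) 1)).prod (volume : Measure (Space d))),
        z.1 ∈ Set.Ico (0 : ℝ) 1 :=
      Measure.quasiMeasurePreserving_fst.ae (ae_restrict_mem measurableSet_Ico)
    filter_upwards [h3] with z hz
    rw [norm_smul]
    by_cases hzK : z.2 ∈ K
    · rw [Set.indicator_of_mem hzK]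
      exact mul_le_mul_of_nonneg_right (hM _) (norm_nonneg _)
    · have : ψ (z.2 + z.1 • e) = 0 := by
        by_contra hne
        refine hzK ⟨(z.1, z.2 + z.1 • e), ⟨⟨hz.1, hz.2.le⟩, subset_tsupport _ hne⟩, ?_⟩
        simp
      rw [this, norm_zero, zero_mul]
      exact mul_nonneg ((norm_nonneg _).trans (hM 0)) (norm_nonneg _)

/-- Differentiation of the average over a segment gives a difference. -/
theorem isWeakDeriv_segMeasure (t : Fin d) (f : LpC d p) :
    IsWeakDeriv (Pi.single t 1) (transAvg (segMeasure t) f)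
      (f - translate (EuclideanSpace.single t 1) f : LpC d p) := by
  intro φ hφ hc
  have ht := partialDeriv_test t ⟨hφ, hc⟩
  obtain ⟨Φ, hΦ⟩ := exists_pairing (p := p) hφ.continuous hc
  obtain ⟨Ψ, hΨ⟩ := exists_pairing (p := p) ht.1.continuous ht.2
  rw [multiDeriv_single t hφ, sum_single, pow_one, pairing_transAvg ht.1.continuous ht.2, ← hΦ,
    map_sub, hΦ, hΦ, pairing_translate, segMeasure]
  rw [integral_map (by fun_prop)
    (by simp only [← hΨ]; exact (Ψ.continuous.comp (continuous_translate f)).aestronglyMeasurable)]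
  -- Translation is moved to the test function and the integrals are exchanged. What remains for
  -- each `x` is an integral of `∂_tφ` along a segment, given by the fundamental theorem of
  -- calculus.
  simp only [pairing_translate]
  rw [integral_integral_swap (integrable_prod_partialDeriv ht.1.continuous ht.2 _ f),
    ← integral_sub (integrable_test_smul ⟨hφ, hc⟩ f)
      (integrable_test_smul (contDiff_comp_add_test ⟨hφ, hc⟩ _) f), ← integral_const_mul]
  congr 1
  ext1 x
  rw [integral_smul_const]
  have hI : ∫ u in Set.Ico (0 : ℝ) 1,
      partialDeriv t φ (x + u • EuclideanSpace.single t (1 : ℝ))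
        = φ (x + EuclideanSpace.single t 1) - φ x := by
    rw [integral_Ico_eq_integral_Ioc, ← intervalIntegral.integral_of_le zero_le_one,
      intervalIntegral.integral_eq_sub_of_hasDerivAt
        (f := fun u : ℝ => φ (x + u • EuclideanSpace.single t (1 : ℝ)))]
    · simp
    · intro u _
      have h1 : HasFDerivAt φ (fderiv ℝ φ (x + u • EuclideanSpace.single t (1 : ℝ)))
          (x + u • EuclideanSpace.single t (1 : ℝ)) :=
        (hφ.differentiable (by simp) _).hasFDerivAt
      have h2 : HasDerivAt (fun u : ℝ => x + u • EuclideanSpace.single t (1 : ℝ))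
          (EuclideanSpace.single t (1 : ℝ)) u := by
        simpa using ((hasDerivAt_id u).smul_const (EuclideanSpace.single t (1 : ℝ))).const_add x
      exact h1.comp_hasDerivAt u h2
    · exact (ht.1.continuous.comp (by fun_prop)).intervalIntegrable _ _
  rw [hI]
  simp only [Complex.real_smul]
  push_cast
  ring

/-- The difference of a weakly differentiable function is an average of its derivative. -/
theorem sub_translate_eq_transAvg {t : Fin d} {f g : LpC d p}
    (h : IsWeakDeriv (Pi.single t 1) f g) :
    f - translate (EuclideanSpace.single t 1) f = transAvg (segMeasure t) g :=
  (isWeakDeriv_segMeasure t f).unique (h.transAvg (segMeasure t))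

end WeakDerivatives

/-! ### The unit cube as a probability space and as a tile of the lattice. -/

section Cube

variable {d : ℕ}

/-! ### The unit cube and the integer lattice -/

/-- The unit cube `[0,1)^d`. -/
def unitCube (d : ℕ) : Set (Space d) := {x | ∀ i, x i ∈ Set.Ico (0 : ℝ) 1}

/-- The points of the integer lattice in `ℝ^d`. -/
def intPoint (k : Fin d → ℤ) : Space d := WithLp.toLp 2 fun i => (k i : ℝ)

@[simp]
theorem intPoint_apply (k : Fin d → ℤ) (i : Fin d) : intPoint k i = (k i : ℝ) := rfl

theorem intPoint_add (k l : Fin d → ℤ) : intPoint (k + l) = intPoint k + intPoint l := by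
  ext i
  simp

theorem intPoint_neg (k : Fin d → ℤ) : intPoint (-k) = -intPoint k := by
  ext i
  simp

theorem intPoint_sub (k l : Fin d → ℤ) : intPoint (k - l) = intPoint k - intPoint l := by
  ext i
  simp

theorem intPoint_single (t : Fin d) :
    intPoint (Pi.single t 1 : Fin d → ℤ) = EuclideanSpace.single t 1 := by
  ext i
  by_cases h : i = t
  · subst h
    simp
  · simp [h]

theorem measurableSet_unitCube : MeasurableSet (unitCube d) := by
  have : unitCube d = ⋂ i, (fun x : Space d => x i) ⁻¹' Set.Ico (0 : ℝ) 1 := by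
    ext x
    simp [unitCube]
  rw [this]
  exact MeasurableSet.iInter fun i => measurableSet_Ico.preimage (by fun_prop)

/-- Lebesgue measure on the unit cube. -/
def cubeMeasure (d : ℕ) : Measure (Space d) := volume.restrict (unitCube d)

theorem cubeMeasure_eq_map :
    cubeMeasure d = Measure.map (WithLp.toLp 2)
      (Measure.pi fun _ : Fin d => (volume : Measure ℝ).restrict (Set.Ico 0 1)) := by
  have h := (PiLp.volume_preserving_toLp (Fin d)).restrict_preimage
    (measurableSet_unitCube (d := d))
  have h2 : (WithLp.toLp 2 ⁻¹' unitCube d : Set (Fin d → ℝ))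
      = Set.univ.pi fun _ => Set.Ico (0 : ℝ) 1 := by
    ext x
    simp [unitCube]
  rw [cubeMeasure, ← h.map_eq, h2, volume_pi, Measure.restrict_pi_pi]

instance instProbIco : IsProbabilityMeasure ((volume : Measure ℝ).restrict (Set.Ico 0 1)) :=
  ⟨by simp⟩

instance instProbCube : IsProbabilityMeasure (cubeMeasure d) := by
  rw [cubeMeasure_eq_map]
  exact Measure.isProbabilityMeasure_map (by fun_prop)

/-- Replacing one coordinate by an independent copy does not change a product law; the discarded
coordinate contributes the factor `1`, the total mass of `ν`. -/
theorem map_update_pi (ν : Measure ℝ) [IsProbabilityMeasure ν] (t : Fin d) :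
    Measure.map (fun z : (Fin d → ℝ) × ℝ => Function.update z.1 t z.2)
      ((Measure.pi fun _ : Fin d => ν).prod ν) = Measure.pi fun _ : Fin d => ν := by
  have hm : Measurable fun z : (Fin d → ℝ) × ℝ => Function.update z.1 t z.2 := by
    refine measurable_pi_lambda _ fun i => ?_
    by_cases h : i = t
    · subst h
      simpa using measurable_snd
    · simp only [Function.update_of_ne h]
      fun_prop
  refine (Measure.pi_eq fun s hs => ?_).symm
  rw [Measure.map_apply hm (MeasurableSet.univ_pi hs)]
  have : (fun z : (Fin d → ℝ) × ℝ => Function.update z.1 t z.2) ⁻¹' Set.univ.pi s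
      = (Set.univ.pi (Function.update s t Set.univ)) ×ˢ s t := by
    ext z
    simp only [Set.mem_preimage, Set.mem_pi, Set.mem_univ, true_imp_iff, Set.mem_prod]
    constructor
    · intro h
      refine ⟨fun i => ?_, by simpa using h t⟩
      by_cases hi : i = t
      · subst hi
        simp
      · simpa [Function.update_of_ne hi] using h i
    · rintro ⟨h1, h2⟩ i
      by_cases hi : i = t
      · subst hi
        simpa using h2
      · simpa [Function.update_of_ne hi] using h1 i
  rw [this, Measure.prod_prod, Measure.pi_pi, ← Finset.mul_prod_erase _ _ (Finset.mem_univ t),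
    ← Finset.mul_prod_erase _ (fun i => ν (s i)) (Finset.mem_univ t)]
  simp only [Function.update_self, measure_univ, one_mul]
  rw [mul_comm]
  congr 1
  refine Finset.prod_congr rfl fun i hi => ?_
  rw [Function.update_of_ne (Finset.ne_of_mem_erase hi)]

/-- The uniform probability measure on the face `y_t = 0` of the unit cube. -/
def faceMeasure (t : Fin d) : Measure (Space d) :=
  Measure.map (fun y => y - y t • EuclideanSpace.single t (1 : ℝ)) (cubeMeasure d)

instance instProbFace (t : Fin d) : IsProbabilityMeasure (faceMeasure t) :=
  Measure.isProbabilityMeasure_map (by fun_prop)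

/-- A uniform point of the face plus an independent uniform multiple of `e_t` is a uniform point of
the cube whose coordinate `t` has been resampled. This isolates the one direction in which a cube
average is differentiated. -/
theorem faceMeasure_conv_segMeasure (t : Fin d) :
    (faceMeasure t).conv (segMeasure t) = cubeMeasure d := by
  rw [Measure.conv, faceMeasure, segMeasure, Measure.map_prod_map _ _ (by fun_prop) (by fun_prop),
    Measure.map_map (by fun_prop) (by fun_prop), cubeMeasure_eq_map]
  conv_lhs =>
    rw [show (volume : Measure ℝ).restrict (Set.Ico 0 1)
      = Measure.map id ((volume : Measure ℝ).restrict (Set.Ico 0 1)) from Measure.map_id.symm]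
  rw [Measure.map_prod_map _ _ (by fun_prop) (by fun_prop),
    Measure.map_map (by fun_prop) (by fun_prop)]
  simp only [Measure.map_id]
  conv_rhs => rw [← map_update_pi _ t]
  have hm : Measurable fun z : (Fin d → ℝ) × ℝ => Function.update z.1 t z.2 := by
    refine measurable_pi_lambda _ fun i => ?_
    by_cases h : i = t
    · subst h
      simpa using measurable_snd
    · simp only [Function.update_of_ne h]
      fun_prop
  rw [Measure.map_map (by fun_prop) hm]
  congr 1
  funext z
  ext i
  by_cases h : i = t
  · subst h
    simp
  · simp [h]

/-- Every function integrates over `ℝ^d` as the sum of its integrals over the integer translates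
of the unit cube. -/
theorem lintegral_eq_tsum_unitCube (h : Space d → ℝ≥0∞) :
    ∫⁻ x, h x = ∑' k : Fin d → ℤ, ∫⁻ y, h (y + intPoint k) ∂(cubeMeasure d) := by
  -- The tile containing `x` is the one indexed by the integer parts of its coordinates, which gives
  -- both covering and disjointness.
  have hfl : ∀ (x : Space d) (k : Fin d → ℤ),
      x ∈ (fun y => y - intPoint k) ⁻¹' unitCube d ↔ ∀ i, ⌊x i⌋ = k i := by
    intro x k
    simp only [Set.mem_preimage, unitCube, Set.mem_ofPred_eq]
    refine forall_congr' fun i => ?_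
    rw [Int.floor_eq_iff]
    simp only [PiLp.sub_apply, intPoint_apply, Set.mem_Ico]
    constructor
    · rintro ⟨h1, h2⟩
      constructor <;> linarith
    · rintro ⟨h1, h2⟩
      constructor <;> linarith
  have hU : (⋃ k : Fin d → ℤ, (fun y => y - intPoint k) ⁻¹' unitCube d) = Set.univ := by
    refine Set.eq_univ_of_forall fun x => Set.mem_iUnion.mpr ⟨fun i => ⌊x i⌋, ?_⟩
    rw [hfl]
    exact fun i => rfl
  rw [← setLIntegral_univ, ← hU, lintegral_iUnion]
  · refine tsum_congr fun k => ?_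
    have := (measurePreserving_sub_right volume (intPoint k)).setLIntegral_comp_preimage_emb
      (MeasurableEquiv.subRight (intPoint k)).measurableEmbedding
      (fun y => h (y + intPoint k)) (unitCube d)
    simpa [cubeMeasure] using this
  · exact fun k => measurableSet_unitCube.preimage (by fun_prop)
  · intro k l hkl
    refine Set.disjoint_left.mpr fun x hx hy => hkl ?_
    rw [hfl] at hx hy
    funext i
    rw [← hx i, hy i]

end Cube

/-! ### Lattice sums as bounded operators from `ℓ^p` to `L^p`. -/

section LatticeSums

variable {d : ℕ}

/-! ### Periodizations and lattice sums -/

/-- The periodization `∑_k |η(x - k)|`. -/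
def perSum (η : Space d → ℂ) (x : Space d) : ℝ≥0∞ := ∑' k : Fin d → ℤ, ‖η (x - intPoint k)‖ₑ

theorem perSum_sub_intPoint (η : Space d → ℂ) (x : Space d) (n : Fin d → ℤ) :
    perSum η (x - intPoint n) = perSum η x := by
  unfold perSum
  rw [← (Equiv.addLeft n).tsum_eq (fun k => ‖η (x - intPoint k)‖ₑ)]
  refine tsum_congr fun k => ?_
  rw [Equiv.coe_addLeft, intPoint_add, sub_sub]

theorem perSum_add_intPoint (η : Space d → ℂ) (x : Space d) (n : Fin d → ℤ) :
    perSum η (x + intPoint n) = perSum η x := by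
  have := perSum_sub_intPoint η x (-n)
  rwa [intPoint_neg, sub_neg_eq_add] at this

theorem perSum_eq_tsum_add (η : Space d → ℂ) (x : Space d) :
    perSum η x = ∑' k : Fin d → ℤ, ‖η (x + intPoint k)‖ₑ := by
  unfold perSum
  rw [← (Equiv.neg (Fin d → ℤ)).tsum_eq]
  simp [intPoint_neg]

theorem aestronglyMeasurable_sub {η : Space d → ℂ} (hη : AEStronglyMeasurable η volume)
    (y : Space d) : AEStronglyMeasurable (fun x => η (x - y)) volume :=
  hη.comp_quasiMeasurePreserving (measurePreserving_sub_right volume y).quasiMeasurePreserving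

theorem aemeasurable_perSum {η : Space d → ℂ} (hη : AEStronglyMeasurable η volume) :
    AEMeasurable (perSum η) volume :=
  AEMeasurable.tsum fun _ => (aestronglyMeasurable_sub hη _).enorm

/-- Unfolding: cut `ℝ^d` into integer translates of the cube and pull the periodic factor out of the
sum. -/
theorem lintegral_mul_eq_cube {P : Space d → ℝ≥0∞} (hP : ∀ x k, P (x + intPoint k) = P x)
    (hPm : AEMeasurable P volume)
    {η : Space d → ℂ} (hη : AEStronglyMeasurable η volume) :
    ∫⁻ x, P x * ‖η x‖ₑ = ∫⁻ x, P x * perSum η x ∂(cubeMeasure d) := by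
  rw [lintegral_eq_tsum_unitCube]
  simp only [hP, perSum_eq_tsum_add, ← ENNReal.tsum_mul_left]
  rw [lintegral_tsum]
  intro k
  have h := aestronglyMeasurable_sub hη (-intPoint k)
  simp only [sub_neg_eq_add] at h
  exact (hPm.mul h.enorm).restrict

theorem lintegral_enorm_eq_cube {η : Space d → ℂ} (hη : AEStronglyMeasurable η volume) :
    ∫⁻ x, ‖η x‖ₑ = ∫⁻ x, perSum η x ∂(cubeMeasure d) := by
  have := lintegral_mul_eq_cube (P := fun _ => 1) (fun _ _ => rfl) (by fun_prop) hη
  simpa using this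

/-- Hölder's inequality for the weights `w`, first on finite sums. In `ℝ≥0∞` no summability is
needed. -/
theorem tsum_mul_rpow_le {ι : Type*} {q : ℝ} (hq : 1 ≤ q) (w a : ι → ℝ≥0∞) :
    (∑' i, a i * w i) ^ q ≤ (∑' i, w i) ^ (q - 1) * ∑' i, w i * a i ^ q := by
  have hq0 : 0 < q := by linarith
  have h1 : ∑' i, a i * w i ≤ (∑' i, w i) ^ (1 - q⁻¹) * (∑' i, w i * a i ^ q) ^ q⁻¹ := by
    rw [ENNReal.tsum_eq_iSup_sum (f := fun i => a i * w i)]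
    refine iSup_le fun s => ?_
    simp only [mul_comm (a _)]
    refine (ENNReal.inner_le_weight_mul_Lp_of_nonneg s hq w a).trans ?_
    gcongr
    · rw [sub_nonneg]
      exact inv_le_one_of_one_le₀ hq
    · exact ENNReal.sum_le_tsum s
    · exact ENNReal.sum_le_tsum s
  refine (ENNReal.rpow_le_rpow h1 hq0.le).trans ?_
  rw [ENNReal.mul_rpow_of_nonneg _ _ hq0.le, ← ENNReal.rpow_mul, ← ENNReal.rpow_mul,
    inv_mul_cancel₀ hq0.ne', ENNReal.rpow_one, sub_mul, inv_mul_cancel₀ hq0.ne', one_mul]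

/-- Take `|η(x - k)|` as Hölder weights. Their sum is the periodization, hence invariant under
integer shifts, so after translating by `k` every term carries the same integral of `perSum η ^ (q -
1) * |η|`, which unfolds to that of `perSum η ^ q` over one cube. -/
theorem lintegral_latticeSum_rpow_le {q : ℝ} (hq : 1 ≤ q) {η : Space d → ℂ}
    (hη : AEStronglyMeasurable η volume) (a : (Fin d → ℤ) → ℝ≥0∞) :
    ∫⁻ x, (∑' k, a k * ‖η (x - intPoint k)‖ₑ) ^ q
      ≤ (∑' k, a k ^ q) * ∫⁻ x, perSum η x ^ q ∂(cubeMeasure d) := by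
  have hm := (aemeasurable_perSum hη).pow_const (q - 1)
  calc ∫⁻ x, (∑' k, a k * ‖η (x - intPoint k)‖ₑ) ^ q
      ≤ ∫⁻ x, ∑' k, perSum η x ^ (q - 1) * (‖η (x - intPoint k)‖ₑ * a k ^ q) := by
        refine lintegral_mono fun x => ?_
        rw [ENNReal.tsum_mul_left]
        exact tsum_mul_rpow_le hq (fun k => ‖η (x - intPoint k)‖ₑ) a
    _ = ∑' k, ∫⁻ x, perSum η x ^ (q - 1) * (‖η (x - intPoint k)‖ₑ * a k ^ q) :=
        lintegral_tsum fun k => hm.mul ((aestronglyMeasurable_sub hη _).enorm.mul_const _)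
    _ = ∑' k, (a k ^ q * ∫⁻ x, perSum η x ^ q ∂(cubeMeasure d)) := by
        refine tsum_congr fun k => ?_
        have h1 : ∀ x, perSum η x ^ (q - 1) * (‖η (x - intPoint k)‖ₑ * a k ^ q)
            = a k ^ q * (fun z => perSum η z ^ (q - 1) * ‖η z‖ₑ) (x - intPoint k) := fun x => by
          simp only [perSum_sub_intPoint]
          ring
        simp only [h1]
        rw [lintegral_const_mul'', lintegral_sub_right_eq_self
          (fun z => perSum η z ^ (q - 1) * ‖η z‖ₑ) (intPoint k),
          lintegral_mul_eq_cube (fun x k => by rw [perSum_add_intPoint]) hm hη]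
        · congr 2
          ext1 x
          nth_rw 2 [← ENNReal.rpow_one (perSum η x)]
          rw [← ENNReal.rpow_add_of_nonneg _ _ (by linarith) zero_le_one]
          congr 1
          ring
        · exact (hm.mul hη.enorm).comp_quasiMeasurePreserving
            (measurePreserving_sub_right volume _).quasiMeasurePreserving
    _ = _ := ENNReal.tsum_mul_right

variable {p : ℝ≥0∞}

/-- The norm `‖∑_k |η(· - k)|‖_{L^p([0,1)^d)}`. -/
def perNorm (p : ℝ≥0∞) (η : Space d → ℂ) : ℝ≥0∞ := eLpNorm (perSum η) p (cubeMeasure d)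

variable [Fact (1 ≤ p)] [hp : Fact (p ≠ ⊤)]

theorem one_le_toReal : 1 ≤ p.toReal :=
  (ENNReal.dichotomy p).resolve_left hp.out

theorem ne_zero_of_one_le : p ≠ 0 := (zero_lt_one.trans_le (Fact.out : 1 ≤ p)).ne'

theorem toReal_pos : 0 < p.toReal := zero_lt_one.trans_le one_le_toReal

theorem enorm_rpow_eq_tsum (s : lp (fun _ : Fin d → ℤ => ℂ) p) :
    ‖s‖ₑ = (∑' k, ‖s k‖ₑ ^ p.toReal) ^ (1 / p.toReal) := by
  have hq : 0 < p.toReal := toReal_pos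
  have h1 := lp.hasSum_norm hq s
  have h2 : ∑' k, ‖s k‖ₑ ^ p.toReal = ENNReal.ofReal (‖s‖ ^ p.toReal) := by
    rw [← h1.tsum_eq, ENNReal.ofReal_tsum_of_nonneg (fun k => by positivity) h1.summable]
    refine tsum_congr fun k => ?_
    rw [← ENNReal.ofReal_rpow_of_nonneg (norm_nonneg _) hq.le, ofReal_norm]
  rw [h2, ← ENNReal.ofReal_rpow_of_nonneg (norm_nonneg _) hq.le, ← ENNReal.rpow_mul,
    mul_one_div_cancel hq.ne', ENNReal.rpow_one, ofReal_norm]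

theorem eLpNorm_latticeSum_le {η : Space d → ℂ} (hη : AEStronglyMeasurable η volume)
    (s : lp (fun _ : Fin d → ℤ => ℂ) p) :
    eLpNorm (fun x => ∑' k, ‖s k * η (x - intPoint k)‖ₑ) p volume ≤ ‖s‖ₑ * perNorm p η := by
  have hq : 0 < p.toReal := toReal_pos
  rw [perNorm, eLpNorm_eq_lintegral_rpow_enorm_toReal ne_zero_of_one_le hp.out,
    eLpNorm_eq_lintegral_rpow_enorm_toReal ne_zero_of_one_le hp.out, enorm_rpow_eq_tsum,
    ← ENNReal.mul_rpow_of_nonneg _ _ (by positivity)]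
  refine ENNReal.rpow_le_rpow ?_ (by positivity)
  simp only [enorm_mul, enorm_eq_self]
  exact lintegral_latticeSum_rpow_le one_le_toReal hη _

/-- `F s = ∑_k s_k η(· - k)`, with pointwise absolute convergence almost everywhere. -/
def IsLatticeSum (η : Space d → ℂ) (F : lp (fun _ : Fin d → ℤ => ℂ) p →L[ℂ] LpC d p) : Prop :=
  ∀ s, ∀ᵐ x, (Summable fun k => ‖s k * η (x - intPoint k)‖) ∧
    HasSum (fun k => s k * η (x - intPoint k)) (F s x)

theorem summable_norm_of_tsum_enorm_lt_top {ι : Type*} {f : ι → ℂ} (h : ∑' i, ‖f i‖ₑ < ⊤) :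
    Summable fun i => ‖f i‖ := by
  have := ENNReal.summable_toReal h.ne
  simpa using this

theorem ae_summable_latticeSum {η : Space d → ℂ} (hη : AEStronglyMeasurable η volume)
    (hN : perNorm p η < ⊤) (s : lp (fun _ : Fin d → ℤ => ℂ) p) :
    ∀ᵐ x, Summable fun k => ‖s k * η (x - intPoint k)‖ := by
  have h1 := (eLpNorm_latticeSum_le hη s).trans_lt (ENNReal.mul_lt_top enorm_lt_top hN)
  have hm : AEMeasurable (fun x => ∑' k, ‖s k * η (x - intPoint k)‖ₑ) volume :=
    AEMeasurable.tsum fun _ => ((aestronglyMeasurable_sub hη _).const_mul _).enorm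
  rw [eLpNorm_eq_lintegral_rpow_enorm_toReal ne_zero_of_one_le hp.out,
    ENNReal.rpow_lt_top_iff_of_pos (by have : 0 < p.toReal := toReal_pos; positivity)] at h1
  filter_upwards [ae_lt_top' (hm.enorm.pow_const _) h1.ne] with x hx
  rw [ENNReal.rpow_lt_top_iff_of_pos toReal_pos, enorm_eq_self] at hx
  exact summable_norm_of_tsum_enorm_lt_top hx

theorem memLp_latticeSum {η : Space d → ℂ} (hη : AEStronglyMeasurable η volume)
    (hN : perNorm p η < ⊤) (s : lp (fun _ : Fin d → ℤ => ℂ) p) :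
    AEStronglyMeasurable (fun x => ∑' k, s k * η (x - intPoint k)) volume ∧
    eLpNorm (fun x => ∑' k, s k * η (x - intPoint k)) p volume ≤ ‖s‖ₑ * perNorm p η := by
  have hs := ae_summable_latticeSum hη hN s
  constructor
  · refine aestronglyMeasurable_of_tendsto_ae atTop
      (f := fun (S : Finset (Fin d → ℤ)) x => ∑ k ∈ S, s k * η (x - intPoint k)) ?_ ?_
    · intro S
      exact Finset.aestronglyMeasurable_fun_sum S fun k _ =>
        (aestronglyMeasurable_sub hη _).const_mul _
    · filter_upwards [hs] with x hx
      exact hx.of_norm.hasSum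
  · refine le_trans ?_ (eLpNorm_latticeSum_le hη s)
    refine eLpNorm_mono_enorm_ae ?_
    filter_upwards [hs] with x hx
    rw [enorm_eq_self]
    exact enorm_tsum_le_tsum_enorm

theorem exists_isLatticeSum {η : Space d → ℂ} (hη : AEStronglyMeasurable η volume)
    (hN : perNorm p η < ⊤) :
    ∃ F : lp (fun _ : Fin d → ℤ => ℂ) p →L[ℂ] LpC d p, IsLatticeSum η F := by
  have hmem : ∀ s : lp (fun _ : Fin d → ℤ => ℂ) p,
      MemLp (fun x => ∑' k, s k * η (x - intPoint k)) p volume := fun s =>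
    ⟨(memLp_latticeSum hη hN s).1,
      (memLp_latticeSum hη hN s).2.trans_lt (ENNReal.mul_lt_top enorm_lt_top hN)⟩
  let F₀ : lp (fun _ : Fin d → ℤ => ℂ) p →ₗ[ℂ] LpC d p :=
    { toFun := fun s => (hmem s).toLp _
      map_add' := fun s s' => by
        refine Lp.ext ?_
        filter_upwards [(hmem (s + s')).coeFn_toLp, (hmem s).coeFn_toLp, (hmem s').coeFn_toLp,
          Lp.coeFn_add ((hmem s).toLp _) ((hmem s').toLp _), ae_summable_latticeSum hη hN s,
          ae_summable_latticeSum hη hN s'] with x h1 h2 h3 h4 h5 h6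
        rw [h1, h4, Pi.add_apply, h2, h3, ← h5.of_norm.tsum_add h6.of_norm]
        refine tsum_congr fun k => ?_
        rw [lp.coeFn_add, Pi.add_apply, add_mul]
      map_smul' := fun a s => by
        refine Lp.ext ?_
        filter_upwards [(hmem (a • s)).coeFn_toLp, (hmem s).coeFn_toLp,
          Lp.coeFn_smul a ((hmem s).toLp _)] with x h1 h2 h3
        rw [RingHom.id_apply, h1, h3, Pi.smul_apply, h2, smul_eq_mul, ← tsum_mul_left]
        refine tsum_congr fun k => ?_
        rw [lp.coeFn_smul, Pi.smul_apply, smul_eq_mul, mul_assoc] }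
  refine ⟨F₀.mkContinuous (perNorm p η).toReal fun s => ?_, fun s => ?_⟩
  · change ‖(hmem s).toLp _‖ ≤ _
    rw [Lp.norm_toLp, mul_comm, ← toReal_enorm s, ← ENNReal.toReal_mul]
    exact ENNReal.toReal_mono (ENNReal.mul_lt_top enorm_lt_top hN).ne (memLp_latticeSum hη hN s).2
  · filter_upwards [(hmem s).coeFn_toLp, ae_summable_latticeSum hη hN s] with x h1 h2
    refine ⟨h2, ?_⟩
    change HasSum _ ((hmem s).toLp _ x)
    rw [h1]
    exact h2.of_norm.hasSum

namespace IsLatticeSum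

variable {η η' : Space d → ℂ} {F F' : lp (fun _ : Fin d → ℤ => ℂ) p →L[ℂ] LpC d p}

theorem enorm_le (h : IsLatticeSum η F) (hη : AEStronglyMeasurable η volume)
    (s : lp (fun _ : Fin d → ℤ => ℂ) p) : ‖F s‖ₑ ≤ ‖s‖ₑ * perNorm p η := by
  rw [Lp.enorm_def]
  refine le_trans ?_ (eLpNorm_latticeSum_le hη s)
  refine eLpNorm_mono_enorm_ae ?_
  filter_upwards [h s] with x hx
  rw [enorm_eq_self, ← hx.2.tsum_eq]
  exact enorm_tsum_le_tsum_enorm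

theorem sub (h : IsLatticeSum η F) (h' : IsLatticeSum η' F') :
    IsLatticeSum (fun x => η x - η' x) (F - F') := by
  intro s
  filter_upwards [h s, h' s, Lp.coeFn_sub (F s) (F' s)] with x h1 h2 h3
  constructor
  · refine Summable.of_nonneg_of_le (fun _ => norm_nonneg _) (fun k => ?_) (h1.1.add h2.1)
    rw [mul_sub]
    exact norm_sub_le _ _
  · have e : (F - F') s x = F s x - F' s x := h3
    rw [e]
    simpa only [mul_sub] using h1.2.sub h2.2

theorem apply_single (h : IsLatticeSum η F) (hη : MemLp η p volume) (k : Fin d → ℤ) (a : ℂ) :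
    F (lp.single p k a) = a • translate (intPoint k) (hη.toLp η) := by
  refine Lp.ext ?_
  filter_upwards [h (lp.single p k a), translate_toLp hη (intPoint k),
    Lp.coeFn_smul a (translate (intPoint k) (hη.toLp η))] with x h1 h2 h3
  rw [h3, Pi.smul_apply, h2, smul_eq_mul]
  refine h1.2.unique ?_
  have h4 := hasSum_single (f := fun l => (lp.single p k a : (Fin d → ℤ) → ℂ) l
    * η (x - intPoint l)) k (fun l hl => by simp [hl])
  simpa using h4

/-- Shifting the function by `e_t` reindexes the sum by `k ↦ k - e_t`. Differences of coefficients
thus become differences of functions. -/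
theorem diff (h : IsLatticeSum η F) (t : Fin d) {s s' : lp (fun _ : Fin d → ℤ => ℂ) p}
    (hs : (s' : (Fin d → ℤ) → ℂ) = diff t s) :
    F s' = F s - translate (EuclideanSpace.single t 1) (F s) := by
  refine Lp.ext ?_
  filter_upwards [h s, h s', ae_sub (h s) (EuclideanSpace.single t 1),
    Lp.coeFn_sub (F s) (translate (EuclideanSpace.single t 1) (F s)),
    coeFn_translate (EuclideanSpace.single t 1) (F s)] with x h1 h2 h3 h4 h5
  rw [h4, Pi.sub_apply, h5]
  refine h2.2.unique ?_
  have h6 := (Equiv.subRight (Pi.single t 1 : Fin d → ℤ)).hasSum_iff.mpr h3.2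
  have e : (fun k => s' k * η (x - intPoint k)) = fun k => s k * η (x - intPoint k)
      - ((fun k => s k * η (x - EuclideanSpace.single t 1 - intPoint k)) ∘
        (Equiv.subRight (Pi.single t 1))) k := by
    funext k
    simp only [Function.comp_apply, Equiv.subRight_apply, intPoint_sub, intPoint_single]
    rw [hs]
    simp only [AffineSynthesis.diff, LinearMap.coe_mk, AddHom.coe_mk]
    rw [sub_sub, add_sub_cancel]
    ring
  rw [e]
  exact h1.2.sub h6

end IsLatticeSum

/-- Finitely supported sequences are dense in `ℓ^p` because `p < ∞`. -/
theorem lp_ext {G : Type*} [NormedAddCommGroup G] [NormedSpace ℂ G]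
    {F F' : lp (fun _ : Fin d → ℤ => ℂ) p →L[ℂ] G}
    (h : ∀ k a, F (lp.single p k a) = F' (lp.single p k a)) : F = F' := by
  ext s
  have := lp.hasSum_single hp.out s
  refine (this.mapL F).unique ?_
  simp only [h]
  exact this.mapL F'

/-- Averages commute with translations, so the two bounded operators agree on sequences with a
single entry. Averaging a lattice sum therefore amounts to averaging its generator. -/
theorem IsLatticeSum.transAvg {η κ : Space d → ℂ}
    {F G : lp (fun _ : Fin d → ℤ => ℂ) p →L[ℂ] LpC d p} (h : IsLatticeSum η F)
    (h' : IsLatticeSum κ G) (hη : MemLp η p volume) (hκ : MemLp κ p volume)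
    (μ : Measure (Space d)) [IsProbabilityMeasure μ]
    (e : transAvg μ (hη.toLp η) = hκ.toLp κ) (s : lp (fun _ : Fin d → ℤ => ℂ) p) :
    AffineSynthesis.transAvg μ (F s) = G s := by
  have : (AffineSynthesis.transAvg μ).comp F = G := by
    refine lp_ext fun k a => ?_
    rw [ContinuousLinearMap.comp_apply, h.apply_single hη, h'.apply_single hκ, map_smul,
      ← translate_transAvg, e]
  rw [← this]
  rfl

end LatticeSums

/-! ### Sampling by cube averages, higher differences, and derivatives of iterated averages. -/

section Sampling

variable {d : ℕ} {p : ℝ≥0∞} [Fact (1 ≤ p)]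

/-! ### Local averages at the lattice points -/

theorem memLp_add {f : Space d → ℂ} (hf : MemLp f p volume) (y : Space d) :
    MemLp (fun x => f (x + y)) p volume :=
  hf.comp_measurePreserving (measurePreserving_add_right volume y)

theorem integrable_cube {f : Space d → ℂ} (hf : MemLp f p volume) (y : Space d) :
    Integrable (fun x => f (x + y)) (cubeMeasure d) :=
  MemLp.integrable (μ := cubeMeasure d) Fact.out ((memLp_add hf y).restrict (unitCube d))

/-- The averages of a function over the integer translates of the unit cube. -/
def sampleFun (f : Space d → ℂ) (k : Fin d → ℤ) : ℂ := ∫ y, f (y + intPoint k) ∂(cubeMeasure d)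

theorem ae_cube_add {P : Space d → Prop} (h : ∀ᵐ x, P x) (y : Space d) :
    ∀ᵐ x ∂(cubeMeasure d), P (x + y) :=
  ae_restrict_of_ae ((measurePreserving_add_right volume y).quasiMeasurePreserving.ae h)

theorem sampleFun_congr_ae {f g : Space d → ℂ} (h : f =ᵐ[volume] g) :
    sampleFun f = sampleFun g := by
  funext k
  exact integral_congr_ae (ae_cube_add h _)

variable [hp : Fact (p ≠ ⊤)]

/-- On each cube, of mass one, the modulus of the average is at most the `L^p` norm; the `p`-th
powers then add up over the tiles. The constant is exactly one, which matters for the final norm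
estimate. -/
theorem tsum_enorm_sampleFun_le {f : Space d → ℂ} (hf : MemLp f p volume) :
    (∑' k, ‖sampleFun f k‖ₑ ^ p.toReal) ^ (1 / p.toReal) ≤ eLpNorm f p volume := by
  have hq : 0 < p.toReal := toReal_pos
  rw [eLpNorm_eq_lintegral_rpow_enorm_toReal ne_zero_of_one_le hp.out,
    lintegral_eq_tsum_unitCube]
  refine ENNReal.rpow_le_rpow (ENNReal.tsum_le_tsum fun k => ?_) (by positivity)
  have hm := (memLp_add hf (intPoint k)).restrict (unitCube d)
  have h1 : ‖sampleFun f k‖ₑ ≤ eLpNorm (fun y => f (y + intPoint k)) p (cubeMeasure d) := by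
    refine le_trans ?_ (eLpNorm_le_eLpNorm_of_exponent_le (p := 1) Fact.out hm.1)
    rw [eLpNorm_one_eq_lintegral_enorm]
    exact enorm_integral_le_lintegral_enorm _
  refine (ENNReal.rpow_le_rpow h1 hq.le).trans ?_
  rw [eLpNorm_eq_lintegral_rpow_enorm_toReal ne_zero_of_one_le hp.out, ← ENNReal.rpow_mul,
    one_div_mul_cancel hq.ne', ENNReal.rpow_one]

theorem memℓp_sampleFun {f : Space d → ℂ} (hf : MemLp f p volume) :
    Memℓp (sampleFun f) p := by
  have hq : 0 < p.toReal := toReal_pos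
  have h1 := (tsum_enorm_sampleFun_le hf).trans_lt hf.2
  rw [ENNReal.rpow_lt_top_iff_of_pos (by positivity)] at h1
  refine memℓp_gen ?_
  have := ENNReal.summable_toReal h1.ne
  refine this.congr fun k => ?_
  rw [← ENNReal.toReal_rpow, toReal_enorm]

/-- The sampling operator `L^p(ℝ^d) → ℓ^p(ℤ^d)` by averages over the integer translates of the
unit cube. -/
def sample : LpC d p →L[ℂ] lp (fun _ : Fin d → ℤ => ℂ) p :=
  LinearMap.mkContinuous
    { toFun := fun f => ⟨sampleFun f, memℓp_sampleFun (Lp.memLp f)⟩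
      map_add' := fun f g => by
        ext k
        change sampleFun (f + g : LpC d p) k = sampleFun f k + sampleFun g k
        rw [sampleFun_congr_ae (Lp.coeFn_add f g)]
        exact integral_add (integrable_cube (Lp.memLp f) _) (integrable_cube (Lp.memLp g) _)
      map_smul' := fun a f => by
        ext k
        change sampleFun (a • f : LpC d p) k = a * sampleFun f k
        rw [sampleFun_congr_ae (Lp.coeFn_smul a f)]
        exact integral_const_mul _ _ } 1 fun f => by
    rw [one_mul, ← toReal_enorm, enorm_rpow_eq_tsum, Lp.norm_def]
    exact ENNReal.toReal_mono (Lp.memLp f).2.ne (tsum_enorm_sampleFun_le (Lp.memLp f))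

theorem coe_sample (f : LpC d p) : (sample f : (Fin d → ℤ) → ℂ) = sampleFun f := rfl

theorem norm_sample_le (f : LpC d p) : ‖sample f‖ ≤ ‖f‖ := by
  rw [← toReal_enorm, enorm_rpow_eq_tsum, Lp.norm_def]
  exact ENNReal.toReal_mono (Lp.memLp f).2.ne (tsum_enorm_sampleFun_le (Lp.memLp f))

/-- The shift by `e_t` maps the tile of `k - e_t` onto that of `k`, so sampling commutes with it. -/
theorem diff_sample (t : Fin d) (f : LpC d p) :
    diff t (sample f) = sample (f - translate (EuclideanSpace.single t 1) f) := by
  rw [map_sub]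
  ext k
  rw [lp.coeFn_sub, Pi.sub_apply]
  simp only [diff, LinearMap.coe_mk, AddHom.coe_mk]
  congr 1
  rw [coe_sample, coe_sample, sampleFun_congr_ae (coeFn_translate _ f)]
  simp only [sampleFun, intPoint_sub, intPoint_single, add_sub_assoc]

/-! ### Higher differences -/

theorem diff_comm (s t : Fin d) : Commute (diff s) (diff t) := by
  ext x k
  simp only [diff, Module.End.mul_apply, LinearMap.coe_mk, AddHom.coe_mk, sub_right_comm]
  ring

theorem multiDiff_add_single (ρ : Fin d → ℕ) (t : Fin d) :
    multiDiff (ρ + Pi.single t 1) = diff t * multiDiff ρ := by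
  have h0 : ∀ l : List (Fin d), t ∉ l →
      (l.map fun s => diff s ^ (ρ + Pi.single t 1 : Fin d → ℕ) s).prod
        = (l.map fun s => diff s ^ ρ s).prod := by
    intro l hl
    refine congrArg List.prod (List.map_congr_left fun s hs => ?_)
    have : s ≠ t := fun h => hl (h ▸ hs)
    simp [this]
  have h1 : ∀ l : List (Fin d), t ∈ l → l.Nodup →
      (l.map fun s => diff s ^ (ρ + Pi.single t 1 : Fin d → ℕ) s).prod
        = diff t * (l.map fun s => diff s ^ ρ s).prod := by
    intro l
    induction l with
    | nil => simp
    | cons s l ih =>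
      intro ht hl
      rw [List.nodup_cons] at hl
      rw [List.map_cons, List.prod_cons, List.map_cons, List.prod_cons]
      by_cases hst : t = s
      · subst hst
        rw [h0 l hl.1, ← mul_assoc, Pi.add_apply, Pi.single_eq_same, pow_succ']
      · rw [ih ((List.mem_cons.mp ht).resolve_left hst) hl.2, ← mul_assoc, ← mul_assoc]
        have : (ρ + Pi.single t 1 : Fin d → ℕ) s = ρ s := by simp [Ne.symm hst]
        rw [this, ((diff_comm t s).pow_right (ρ s)).eq]
  exact h1 _ (List.mem_finRange t) (List.nodup_finRange d)

theorem multiDiff_zero : multiDiff (0 : Fin d → ℕ) = 1 := by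
  refine List.prod_eq_one fun x hx => ?_
  obtain ⟨t, -, rfl⟩ := List.mem_map.mp hx
  simp

theorem memℓp_shift {s : (Fin d → ℤ) → ℂ} (h : Memℓp s p) (n : Fin d → ℤ) :
    Memℓp (fun k => s (k - n)) p := by
  have hq : 0 < p.toReal := toReal_pos
  refine memℓp_gen ?_
  exact (Equiv.subRight n).summable_iff.mpr (h.summable hq)

theorem memℓp_multiDiff {s : (Fin d → ℤ) → ℂ} (h : Memℓp s p) (ρ : Fin d → ℕ) :
    Memℓp (multiDiff ρ s) p := by
  induction ρ using multiIndex_induction with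
  | h0 => rwa [multiDiff_zero]
  | hs ρ t ih =>
    rw [multiDiff_add_single]
    exact ih.sub (memℓp_shift ih _)

/-- Differences of the samples of `u 0` are averaged samples of the derivatives `u ρ`. -/
theorem exists_multiDiff_sample (ρ : Fin d → ℕ) :
    ∃ (ν : Measure (Space d)) (_ : IsProbabilityMeasure ν), ∀ u : (Fin d → ℕ) → LpC d p,
      (∀ σ t, ∑ i, σ i + 1 ≤ ∑ i, ρ i →
        IsWeakDeriv (Pi.single t 1) (u σ) (u (σ + Pi.single t 1))) →
      multiDiff ρ (sample (u 0)) = sample (transAvg ν (u ρ)) := by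
  induction ρ using multiIndex_induction with
  | h0 =>
    refine ⟨Measure.dirac 0, inferInstance, fun u _ => ?_⟩
    rw [transAvg_dirac_zero, multiDiff_zero]
    rfl
  | hs ρ t ih =>
    obtain ⟨ν, hν, h⟩ := ih
    -- The new difference becomes a segment average of one further derivative. The derivative
    -- relation is required only up to order `|ρ|`, so a function in `W^{m,p}` provides it for `|ρ|
    -- ≤ m`.
    refine ⟨ν.conv (segMeasure t), inferInstance, fun u hu => ?_⟩
    rw [sum_add_single] at hu
    rw [multiDiff_add_single, Module.End.mul_apply, h u fun σ s hσ => hu σ s (by omega),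
      diff_sample, translate_transAvg, ← map_sub,
      sub_translate_eq_transAvg (hu ρ t le_rfl), transAvg_transAvg]

/-! ### Measures of bounded support -/

/-- The measure `μ` is carried by a ball. -/
def BddSupp (μ : Measure (Space d)) : Prop := ∃ R : ℝ, ∀ᵐ y ∂μ, ‖y‖ ≤ R

theorem BddSupp.conv {μ ν : Measure (Space d)} [IsProbabilityMeasure μ] [IsProbabilityMeasure ν]
    (h : BddSupp μ) (h' : BddSupp ν) : BddSupp (μ.conv ν) := by
  obtain ⟨R, hR⟩ := h
  obtain ⟨R', hR'⟩ := h'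
  refine ⟨R + R', ?_⟩
  rw [Measure.conv, ae_map_iff (by fun_prop) (measurableSet_le (by fun_prop) (by fun_prop))]
  filter_upwards [Measure.quasiMeasurePreserving_fst.ae hR,
    Measure.quasiMeasurePreserving_snd.ae hR'] with z h1 h2
  exact (norm_add_le _ _).trans (add_le_add h1 h2)

theorem norm_le_of_mem_unitCube {y : Space d} (hy : y ∈ unitCube d) : ‖y‖ ≤ √d := by
  rw [EuclideanSpace.norm_eq]
  refine Real.sqrt_le_sqrt ?_
  refine (Finset.sum_le_card_nsmul _ _ 1 fun i _ => ?_).trans (by simp)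
  have := hy i
  rw [Real.norm_eq_abs, sq_abs]
  nlinarith [this.1, this.2]

theorem bddSupp_cubeMeasure : BddSupp (cubeMeasure d) :=
  ⟨√d, (ae_restrict_mem measurableSet_unitCube).mono fun _ h => norm_le_of_mem_unitCube h⟩

theorem bddSupp_faceMeasure (t : Fin d) : BddSupp (faceMeasure t) := by
  refine ⟨√d + 1, ?_⟩
  rw [faceMeasure, ae_map_iff (by fun_prop) (measurableSet_le (by fun_prop) (by fun_prop))]
  filter_upwards [ae_restrict_mem measurableSet_unitCube] with y hy
  refine (norm_sub_le _ _).trans (add_le_add (norm_le_of_mem_unitCube hy) ?_)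
  rw [norm_smul, PiLp.norm_single, norm_one, mul_one, Real.norm_eq_abs,
    abs_of_nonneg (hy t).1]
  exact (hy t).2.le

theorem bddSupp_dirac_zero : BddSupp (Measure.dirac (0 : Space d)) := by
  refine ⟨0, ?_⟩
  rw [ae_dirac_iff (measurableSet_le (by fun_prop) (by fun_prop))]
  simp

/-! ### Derivatives of iterated averages over the cube -/

/-- The cube average factors into a face average and a segment average, and `∂_t` of the latter is a
difference. -/
theorem isWeakDeriv_cubeMeasure (t : Fin d) (f : LpC d p) :
    IsWeakDeriv (Pi.single t 1) (transAvg (cubeMeasure d) f)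
      (transAvg (faceMeasure t) (f - translate (EuclideanSpace.single t 1) f)) := by
  have h := (isWeakDeriv_segMeasure t f).transAvg (faceMeasure t)
  rw [transAvg_transAvg] at h
  convert h using 5
  exact (faceMeasure_conv_segMeasure t).symm

theorem exists_iterate_transAvg (μ : Measure (Space d)) [IsProbabilityMeasure μ]
    (hμ : BddSupp μ) (n : ℕ) :
    ∃ (ν : Measure (Space d)) (_ : IsProbabilityMeasure ν), BddSupp ν ∧
      ∀ f : LpC d p, (transAvg μ)^[n] f = transAvg ν f := by
  induction n with
  | zero =>
    refine ⟨Measure.dirac 0, inferInstance, bddSupp_dirac_zero, fun f => ?_⟩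
    rw [transAvg_dirac_zero]
    rfl
  | succ n ih =>
    obtain ⟨ν, hν, hb, h⟩ := ih
    refine ⟨μ.conv ν, inferInstance, hμ.conv hb, fun f => ?_⟩
    rw [Function.iterate_succ_apply', h, transAvg_transAvg]

/-- The derivatives of `A^{n + |ρ|} f`, where `A` is the average over the unit cube, in terms of
averages of differences of `f`. -/
theorem exists_isWeakDeriv_iterate (ρ : Fin d → ℕ) :
    ∃ (μ : Measure (Space d)) (_ : IsProbabilityMeasure μ), BddSupp μ ∧
      ∀ (u : (Fin d → ℕ) → LpC d p),
      (∀ σ t, u (σ + Pi.single t 1) = u σ - translate (EuclideanSpace.single t 1) (u σ)) →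
      ∀ n : ℕ, IsWeakDeriv ρ ((transAvg (cubeMeasure d))^[n + ∑ i, ρ i] (u 0))
        (transAvg μ ((transAvg (cubeMeasure d))^[n] (u ρ))) := by
  induction ρ using multiIndex_induction with
  | h0 =>
    refine ⟨Measure.dirac 0, inferInstance, bddSupp_dirac_zero, fun u _ n => ?_⟩
    rw [transAvg_dirac_zero]
    simpa using isWeakDeriv_zero_index _
  | hs ρ t ih =>
    obtain ⟨μ, hμ, hb, h⟩ := ih
    refine ⟨μ.conv (faceMeasure t), inferInstance, hb.conv (bddSupp_faceMeasure t),
      fun u hu n => ?_⟩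
    -- One of the `n + 1` averages left over after `D^ρ` is spent on the additional `∂_t`, which
    -- leaves `n` of them.
    have h1 := h u hu (n + 1)
    obtain ⟨ν, hν, -, h2⟩ := exists_iterate_transAvg (p := p) (cubeMeasure d) bddSupp_cubeMeasure n
    rw [sum_add_single, ← add_assoc, add_right_comm]
    refine h1.comp ?_
    rw [Function.iterate_succ_apply, h2, h2, hu, ← transAvg_transAvg,
      transAvg_comm (faceMeasure t)]
    exact ((isWeakDeriv_cubeMeasure t (u ρ)).transAvg ν).transAvg μ

/-- With `m` averages and only `|ρ| ≤ m` derivatives, the `m - |ρ|` unused averages are absorbed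
into the measure `μ`. -/
theorem exists_isWeakDeriv_iterate_of_le {m : ℕ} {ρ : Fin d → ℕ} (hρ : ∑ i, ρ i ≤ m) :
    ∃ (μ : Measure (Space d)) (_ : IsProbabilityMeasure μ), BddSupp μ ∧
      ∀ (u : (Fin d → ℕ) → LpC d p),
      (∀ σ t, u (σ + Pi.single t 1) = u σ - translate (EuclideanSpace.single t 1) (u σ)) →
      IsWeakDeriv ρ ((transAvg (cubeMeasure d))^[m] (u 0)) (transAvg μ (u ρ)) := by
  obtain ⟨μ, hμ, hb, h⟩ := exists_isWeakDeriv_iterate (p := p) ρ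
  obtain ⟨ν, hν, hb', h'⟩ := exists_iterate_transAvg (p := p) (cubeMeasure d) bddSupp_cubeMeasure
    (m - ∑ i, ρ i)
  refine ⟨μ.conv ν, inferInstance, hb.conv hb', fun u hu => ?_⟩
  have := h u hu (m - ∑ i, ρ i)
  rwa [Nat.sub_add_cancel hρ, h', transAvg_transAvg] at this

end Sampling

/-! ### Completeness of `W^{m,p}`, linear substitutions, synthesis at one scale. -/

section SobolevSpace

variable {d : ℕ} {p : ℝ≥0∞} [Fact (1 ≤ p)] {m : ℕ}

/-! ### The Sobolev space: derivatives, completeness, linear changes of variables -/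

theorem isWeakDeriv_sum {ι : Type*} (I : Finset ι) {ρ : Fin d → ℕ} {f g : ι → LpC d p}
    (h : ∀ i ∈ I, IsWeakDeriv ρ (f i) (g i)) :
    IsWeakDeriv ρ (∑ i ∈ I, f i : LpC d p) (∑ i ∈ I, g i : LpC d p) := by
  classical
  induction I using Finset.induction_on with
  | empty => exact isWeakDeriv_zero ρ
  | insert i I hi ih =>
    rw [Finset.sum_insert hi, Finset.sum_insert hi]
    exact (h i (Finset.mem_insert_self i I)).add
      (ih fun j hj => h j (Finset.mem_insert_of_mem hj))

theorem exists_eq_add_single {ρ : Fin d → ℕ} (h : ρ ≠ 0) :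
    ∃ (σ : Fin d → ℕ) (t : Fin d), ρ = σ + Pi.single t 1 := by
  induction ρ using multiIndex_induction with
  | h0 => exact absurd rfl h
  | hs ρ t _ => exact ⟨ρ, t, rfl⟩

namespace Sobolev

/-- The element of `W^{m,p}` given by a function in `L^p` with weak derivatives in `L^p`. -/
def mk (f : LpC d p) (h : ∀ ρ ∈ multiIndices d m, ∃ g : LpC d p, IsWeakDeriv ρ f g) :
    Sobolev d p m := ⟨f, h⟩

theorem toLp_mk (f : LpC d p)
    (h : ∀ ρ ∈ multiIndices d m, ∃ g : LpC d p, IsWeakDeriv ρ f g) : toLp (mk f h) = f := rfl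

theorem norm_weakDeriv_le (f : Sobolev d p m) {ρ : Fin d → ℕ} (hρ : ρ ∈ multiIndices d m) :
    ‖weakDeriv ρ (toLp f)‖ ≤ ‖f‖ := by
  rw [norm_def]
  exact Finset.single_le_sum (f := fun ρ => ‖weakDeriv ρ (toLp f)‖)
    (fun _ _ => norm_nonneg _) hρ

/-- The weak derivative `D^ρ : W^{m,p} → L^p` for `|ρ| ≤ m`. -/
def derivL (ρ : Fin d → ℕ) (hρ : ρ ∈ multiIndices d m) : Sobolev d p m →L[ℂ] LpC d p :=
  LinearMap.mkContinuous
    { toFun := fun f => weakDeriv ρ (toLp f)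
      map_add' := fun f g => by
        rw [map_add]
        exact ((isWeakDeriv f hρ).add (isWeakDeriv g hρ)).weakDeriv_eq
      map_smul' := fun a f => by
        rw [map_smul]
        exact ((isWeakDeriv f hρ).smul a).weakDeriv_eq } 1 fun f => by
    rw [one_mul]
    exact norm_weakDeriv_le f hρ

theorem derivL_apply (ρ : Fin d → ℕ) (hρ : ρ ∈ multiIndices d m) (f : Sobolev d p m) :
    derivL ρ hρ f = weakDeriv ρ (toLp f) := rfl

/-- The derivatives of a Cauchy sequence converge in `L^p`, and by closedness their limits are the
derivatives of the limit function. -/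
instance : CompleteSpace (Sobolev d p m) := by
  refine Metric.complete_of_cauchySeq_tendsto fun u hu => ?_
  have hc : ∀ ρ, ∃ g : LpC d p, ρ ∈ multiIndices d m →
      Tendsto (fun n => weakDeriv ρ (toLp (u n))) atTop (𝓝 g) := by
    intro ρ
    by_cases hρ : ρ ∈ multiIndices d m
    · obtain ⟨g, hg⟩ := cauchySeq_tendsto_of_complete
        ((derivL (p := p) ρ hρ).uniformContinuous.comp_cauchySeq hu)
      exact ⟨g, fun _ => hg⟩
    -- A default outside the relevant orders, so that `choose` yields a family over all
    -- multi-indices.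
    · exact ⟨0, fun h => absurd h hρ⟩
  choose g hg using hc
  have h0 := hg 0 (zero_mem_multiIndices d m)
  have h0' : Tendsto (fun n => toLp (u n)) atTop (𝓝 (g 0)) := by
    refine h0.congr fun n => ?_
    exact (isWeakDeriv_zero_index (toLp (u n))).weakDeriv_eq
  have hd : ∀ ρ ∈ multiIndices d m, IsWeakDeriv ρ (g 0) (g ρ) := fun ρ hρ =>
    isWeakDeriv_of_tendsto h0' (hg ρ hρ) fun n => isWeakDeriv (u n) hρ
  refine ⟨mk (g 0) fun ρ hρ => ⟨g ρ, hd ρ hρ⟩, ?_⟩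
  rw [tendsto_iff_norm_sub_tendsto_zero]
  have h1 : ∀ n, ‖u n - mk (g 0) fun ρ hρ => ⟨g ρ, hd ρ hρ⟩‖
      = ∑ ρ ∈ multiIndices d m, ‖weakDeriv ρ (toLp (u n)) - g ρ‖ := by
    intro n
    rw [norm_def]
    refine Finset.sum_congr rfl fun ρ hρ => ?_
    rw [← derivL_apply ρ hρ, map_sub, derivL_apply, derivL_apply, toLp_mk, (hd ρ hρ).weakDeriv_eq]
  simp only [h1]
  rw [← Finset.sum_const_zero (s := multiIndices d m)]
  exact tendsto_finsetSum _ fun ρ hρ => tendsto_iff_norm_sub_tendsto_zero.mp (hg ρ hρ)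

variable [hp : Fact (p ≠ ⊤)]

/-- Induction on the order: with `ρ = σ + e_t`, the chain rule gives `D^ρ (f ∘ A) = ∑_s (A e_t)_s
D^σ ((∂_s f) ∘ A)`. A common bound `M` for all derivatives is inherited by each `∂_s f` at order one
less, so `K` does not depend on `f`. -/
theorem exists_isWeakDeriv_compLin (A : Space d ≃L[ℝ] Space d) (m : ℕ) :
    ∃ K : ℝ, 0 ≤ K ∧ ∀ (f : LpC d p) (M : ℝ),
      (∀ ρ : Fin d → ℕ, ∑ i, ρ i ≤ m → ∃ g : LpC d p, IsWeakDeriv ρ f g ∧ ‖g‖ ≤ M) →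
      ∀ ρ : Fin d → ℕ, ∑ i, ρ i ≤ m →
        ∃ g : LpC d p, IsWeakDeriv ρ (compLin A f) g ∧ ‖g‖ ≤ K * M := by
  set c : ℝ := |(LinearMap.det (A : Space d →ₗ[ℝ] Space d))⁻¹| ^ (1 / p.toReal) with hc
  have hc0 : 0 ≤ c := by positivity
  have hzero : ∀ (f : LpC d p) (M : ℝ), (∃ g : LpC d p, IsWeakDeriv 0 f g ∧ ‖g‖ ≤ M) →
      ‖compLin A f‖ ≤ c * M := by
    rintro f M ⟨g, hg, hgM⟩
    rw [hg.unique (isWeakDeriv_zero_index f)] at hgM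
    rw [norm_compLin]
    exact mul_le_mul_of_nonneg_left hgM hc0
  induction m with
  | zero =>
    refine ⟨c, hc0, fun f M h ρ hρ => ?_⟩
    have hρ0 : ρ = 0 := by
      funext i
      exact (Finset.sum_eq_zero_iff.mp (Nat.le_zero.mp hρ)) i (Finset.mem_univ i)
    subst hρ0
    exact ⟨compLin A f, isWeakDeriv_zero_index _, hzero f M (h 0 hρ)⟩
  | succ m ih =>
    obtain ⟨K, hK, hind⟩ := ih
    set B : ℝ := ∑ t, ∑ s, |(A (EuclideanSpace.single t 1)) s| with hB
    have hB0 : 0 ≤ B := by positivity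
    -- Here `c` covers `ρ = 0`, and `B * K` covers the orders reached through the chain rule.
    refine ⟨c + B * K, by positivity, fun f M h ρ hρ => ?_⟩
    have hM : 0 ≤ M := by
      obtain ⟨g, -, hgM⟩ := h 0 (by simp)
      exact (norm_nonneg g).trans hgM
    by_cases hρ0 : ρ = 0
    · subst hρ0
      refine ⟨compLin A f, isWeakDeriv_zero_index _, (hzero f M (h 0 hρ)).trans ?_⟩
      exact mul_le_mul_of_nonneg_right (le_add_of_nonneg_right (by positivity)) hM
    · obtain ⟨σ, t, rfl⟩ := exists_eq_add_single hρ0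
      rw [sum_add_single] at hρ
      choose g hg _ using fun s : Fin d => h (Pi.single s 1) (by rw [sum_single]; omega)
      have hrec : ∀ s, ∃ e : LpC d p, IsWeakDeriv σ (compLin A (g s)) e ∧ ‖e‖ ≤ K * M := by
        intro s
        refine hind (g s) M (fun τ hτ => ?_) σ (by omega)
        obtain ⟨e, he, heM⟩ := h (τ + Pi.single s 1) (by rw [sum_add_single]; omega)
        exact ⟨e, (hg s).of_comp_left he, heM⟩
      choose e he heM using hrec
      refine ⟨∑ s, ((A (EuclideanSpace.single t 1)) s : ℂ) • e s,
        (isWeakDeriv_compLin A hg t).comp_left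
          (isWeakDeriv_sum _ fun s _ => (he s).smul _), ?_⟩
      calc ‖∑ s, ((A (EuclideanSpace.single t 1)) s : ℂ) • e s‖
          ≤ ∑ s, |(A (EuclideanSpace.single t 1)) s| * (K * M) := by
            refine norm_sum_le_of_le _ fun s _ => ?_
            rw [norm_smul, Complex.norm_real, Real.norm_eq_abs]
            exact mul_le_mul_of_nonneg_left (heM s) (abs_nonneg _)
        _ ≤ B * (K * M) := by
            rw [← Finset.sum_mul]
            refine mul_le_mul_of_nonneg_right ?_ (by positivity)
            exact Finset.single_le_sum
              (f := fun t => ∑ s, |(A (EuclideanSpace.single t 1)) s|)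
              (fun _ _ => by positivity) (Finset.mem_univ t)
        _ ≤ (c + B * K) * M := by nlinarith [mul_nonneg hc0 hM]

/-- The composition `f ↦ f ∘ A` of `W^{m,p}`, for an invertible linear map `A`. -/
theorem exists_compLin (A : Space d ≃L[ℝ] Space d) :
    ∃ V : Sobolev d p m →L[ℂ] Sobolev d p m, ∀ f, toLp (V f) = compLin A (toLp f) := by
  obtain ⟨K, hK, h⟩ := exists_isWeakDeriv_compLin (p := p) A m
  have key : ∀ (f : Sobolev d p m) (ρ : Fin d → ℕ), ρ ∈ multiIndices d m →
      ∃ g : LpC d p, IsWeakDeriv ρ (compLin A (toLp f)) g ∧ ‖g‖ ≤ K * ‖f‖ := fun f ρ hρ =>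
    h (toLp f) ‖f‖ (fun σ hσ => ⟨weakDeriv σ (toLp f), isWeakDeriv f (mem_multiIndices.mpr hσ),
      norm_weakDeriv_le f (mem_multiIndices.mpr hσ)⟩) ρ (mem_multiIndices.mp hρ)
  let V₀ : Sobolev d p m →ₗ[ℂ] Sobolev d p m :=
    { toFun := fun f => mk (compLin A (toLp f)) fun ρ hρ => (key f ρ hρ).imp fun _ hg => hg.1
      map_add' := fun f g => toLp_injective (by simp only [toLp_mk, map_add])
      map_smul' := fun a f => toLp_injective (by
        simp only [toLp_mk, map_smul, RingHom.id_apply]) }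
  refine ⟨V₀.mkContinuous ((multiIndices d m).card * K) fun f => ?_, fun f => rfl⟩
  rw [norm_def, mul_assoc, ← nsmul_eq_mul]
  refine Finset.sum_le_card_nsmul _ _ _ fun ρ hρ => ?_
  obtain ⟨g, hg, hgM⟩ := key f ρ hρ
  have : toLp (V₀ f) = compLin A (toLp f) := rfl
  rwa [this, hg.weakDeriv_eq]

end Sobolev

/-! ### Synthesis at a single scale -/

variable [hp : Fact (p ≠ ⊤)]

/-- The differences `Δ^ρ s` of a sequence `s ∈ ℓ^p`. -/
def multiDiffLp (ρ : Fin d → ℕ) :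
    lp (fun _ : Fin d → ℤ => ℂ) p →ₗ[ℂ] lp (fun _ : Fin d → ℤ => ℂ) p where
  toFun s := ⟨multiDiff ρ s, memℓp_multiDiff (lp.memℓp s) ρ⟩
  map_add' s s' := by
    ext1
    exact map_add _ _ _
  map_smul' a s := by
    ext1
    exact map_smul _ _ _

theorem coe_multiDiffLp (ρ : Fin d → ℕ) (s : lp (fun _ : Fin d → ℤ => ℂ) p) :
    (multiDiffLp ρ s : (Fin d → ℤ) → ℂ) = multiDiff ρ s := rfl

theorem multiDiffLp_zero (s : lp (fun _ : Fin d → ℤ => ℂ) p) : multiDiffLp 0 s = s := by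
  ext1
  rw [coe_multiDiffLp, multiDiff_zero]
  rfl

theorem exists_isWeakDeriv_latticeSum {ρ : Fin d → ℕ} (hρ : ρ ∈ multiIndices d m) :
    ∃ (μ : Measure (Space d)) (_ : IsProbabilityMeasure μ), BddSupp μ ∧
      ∀ (η : Space d → ℂ) (F : lp (fun _ : Fin d → ℤ => ℂ) p →L[ℂ] LpC d p)
        (_ : IsLatticeSum η F) (a : ℝˣ) (s : lp (fun _ : Fin d → ℤ => ℂ) p),
        IsWeakDeriv ρ (dilate a ((transAvg (cubeMeasure d))^[m] (F s)))
          (((a : ℝ) : ℂ) ^ (∑ i, ρ i) • dilate a (transAvg μ (F (multiDiffLp ρ s))) :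
            LpC d p) := by
  obtain ⟨μ, hμ, hb, h⟩ := exists_isWeakDeriv_iterate_of_le (p := p) (mem_multiIndices.mp hρ)
  refine ⟨μ, hμ, hb, fun η F hF a s => ?_⟩
  have h1 := h (fun σ => F (multiDiffLp σ s)) fun σ t => by
    refine hF.diff t ?_
    rw [coe_multiDiffLp, multiDiff_add_single]
    rfl
  rw [multiDiffLp_zero] at h1
  exact h1.dilate a

/-- The synthesis operator `s ↦ |a|^{d/p} (A^m F s)(a ·)` at a single scale, where `A` is the
average over the unit cube. -/
theorem exists_levelMap {η : Space d → ℂ} (hη : AEStronglyMeasurable η volume)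
    {F : lp (fun _ : Fin d → ℤ => ℂ) p →L[ℂ] LpC d p} (hF : IsLatticeSum η F)
    (hN : perNorm p η < ⊤) (m : ℕ) (a : ℝˣ) :
    ∃ G : lp (fun _ : Fin d → ℤ => ℂ) p →ₗ[ℂ] Sobolev d p m,
      (∀ s, Sobolev.toLp (G s) = dilate a ((transAvg (cubeMeasure d))^[m] (F s))) ∧
      ∀ s, ‖G s‖ ≤ (perNorm p η).toReal *
        ∑ ρ ∈ multiIndices d m, |(a : ℝ)| ^ (∑ i, ρ i) * ‖multiDiffLp ρ s‖ := by
  have hnorm : ∀ s, ‖F s‖ ≤ (perNorm p η).toReal * ‖s‖ := fun s => by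
    rw [mul_comm, ← toReal_enorm, ← toReal_enorm, ← ENNReal.toReal_mul]
    exact ENNReal.toReal_mono (ENNReal.mul_lt_top enorm_lt_top hN).ne (hF.enorm_le hη s)
  obtain ⟨ν, hν, -, hit⟩ := exists_iterate_transAvg (p := p) (cubeMeasure d) bddSupp_cubeMeasure m
  let G : lp (fun _ : Fin d → ℤ => ℂ) p →ₗ[ℂ] Sobolev d p m :=
    { toFun := fun s => Sobolev.mk (dilate a ((transAvg (cubeMeasure d))^[m] (F s))) fun ρ hρ => by
        obtain ⟨μ, hμ, -, h⟩ := exists_isWeakDeriv_latticeSum (p := p) hρ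
        exact ⟨_, h η F hF a s⟩
      map_add' := fun s s' => Sobolev.toLp_injective (by
        simp only [Sobolev.toLp_mk, map_add, iterate_map_add])
      map_smul' := fun b s => Sobolev.toLp_injective (by
        simp only [Sobolev.toLp_mk, hit, map_smul, RingHom.id_apply]) }
  refine ⟨G, fun s => rfl, fun s => ?_⟩
  rw [Sobolev.norm_def, Finset.mul_sum]
  refine Finset.sum_le_sum fun ρ hρ => ?_
  obtain ⟨μ, hμ, -, h⟩ := exists_isWeakDeriv_latticeSum (p := p) hρ
  have h1 : Sobolev.toLp (G s) = dilate a ((transAvg (cubeMeasure d))^[m] (F s)) := rfl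
  rw [h1, (h η F hF a s).weakDeriv_eq, norm_smul, norm_dilate, norm_pow, Complex.norm_real,
    Real.norm_eq_abs, mul_left_comm]
  exact mul_le_mul_of_nonneg_left ((norm_transAvg_le μ _).trans (hnorm _)) (by positivity)

end SobolevSpace

/-- If every `h` is approximated by images of vectors of norm almost at most `‖h‖`, then every `h`
is the image of a vector of norm almost at most `‖h‖`. -/
theorem exists_preimage_of_approx {G H : Type*} [NormedAddCommGroup G] [NormedSpace ℂ G]
    [CompleteSpace G] [NormedAddCommGroup H] [NormedSpace ℂ H] (T : G →L[ℂ] H)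
    (happ : ∀ (h : H) (δ : ℝ), 0 < δ → ∃ g, ‖h - T g‖ ≤ δ ∧ ‖g‖ ≤ ‖h‖ + δ)
    (h : H) {ε : ℝ} (hε : 0 < ε) : ∃ g, T g = h ∧ ‖g‖ ≤ ‖h‖ + ε := by
  choose! g hg hgn using happ
  -- The first correction costs at most `‖h‖ + ε/8`. A later one is bounded by its residual plus its
  -- own tolerance, hence by `2 δ n`, and these sum to `ε/2`. The total stays below `‖h‖ + ε`.
  set δ : ℕ → ℝ := fun n => ε / 8 * (1 / 2) ^ n with hδ
  have hδ0 : ∀ n, 0 < δ n := fun n => by positivity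
  let r : ℕ → H := fun n => Nat.rec h (fun n x => x - T (g x (δ n))) n
  have hr : ∀ n, r (n + 1) = r n - T (g (r n) (δ n)) := fun n => rfl
  have hr0 : r 0 = h := rfl
  have hrn : ∀ n, ‖r (n + 1)‖ ≤ δ n := fun n => hg (r n) (δ n) (hδ0 n)
  set u : ℕ → G := fun n => g (r n) (δ n) with hu
  have hun : ∀ n, ‖u n‖ ≤ ‖r n‖ + δ n := fun n => hgn (r n) (δ n) (hδ0 n)
  have hgeo : HasSum δ (ε / 8 * 2) := hasSum_geometric_two.mul_left (ε / 8)
  have hu1 : ∀ n, ‖u (n + 1)‖ ≤ 2 * δ n := fun n => by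
    have h1 := hun (n + 1)
    have h2 := hrn n
    have h3 : δ (n + 1) ≤ δ n := by
      simp only [hδ, pow_succ]
      have : (0 : ℝ) ≤ ε / 8 * (1 / 2) ^ n := by positivity
      linarith
    linarith
  have hs1 : Summable fun n => ‖u (n + 1)‖ :=
    Summable.of_nonneg_of_le (fun _ => norm_nonneg _) hu1 (hgeo.summable.mul_left 2)
  have hs : Summable fun n => ‖u n‖ := (summable_nat_add_iff 1).mp hs1
  refine ⟨∑' n, u n, ?_, ?_⟩
  · have h1 : Tendsto (fun N => T (∑ n ∈ Finset.range N, u n)) atTop (𝓝 (T (∑' n, u n))) :=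
      (T.continuous.tendsto _).comp hs.of_norm.hasSum.tendsto_sum_nat
    have h2 : ∀ N, T (∑ n ∈ Finset.range N, u n) = h - r N := by
      intro N
      induction N with
      | zero => simp [hr0]
      | succ N ih =>
        rw [Finset.sum_range_succ, map_add, ih, hr]
        abel
    have h3 : Tendsto r atTop (𝓝 0) := by
      rw [← tendsto_add_atTop_iff_nat 1]
      exact squeeze_zero_norm hrn hgeo.summable.tendsto_atTop_zero
    simp only [h2] at h1
    have h4 := h3.const_sub h
    rw [sub_zero] at h4
    exact tendsto_nhds_unique h1 h4
  · have h1 : ‖∑' n, u n‖ ≤ ∑' n, ‖u n‖ := norm_tsum_le_tsum_norm hs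
    have h2 : ∑' n, ‖u (n + 1)‖ ≤ 2 * (ε / 8 * 2) := by
      rw [← (hgeo.mul_left 2).tsum_eq]
      exact hs1.tsum_le_tsum hu1 (hgeo.summable.mul_left 2)
    rw [hs.tsum_eq_zero_add] at h1
    have h3 := hun 0
    have h4 : δ 0 = ε / 8 := by simp [hδ]
    rw [hr0, h4] at h3
    linarith

/-! ### The sequence space as an `ℓ^1` sum of its scales, and its completeness. -/

section WeightedSequences

variable {d : ℕ} {p : ℝ≥0∞} [Fact (1 ≤ p)] [hp : Fact (p ≠ ⊤)] {m : ℕ}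

/-! ### The weighted discrete Sobolev space, scale by scale -/

theorem norm_shift_lp {s s' : lp (fun _ : Fin d → ℤ => ℂ) p} (n : Fin d → ℤ)
    (h : ∀ k, s' k = s (k - n)) : ‖s'‖ = ‖s‖ := by
  rw [lp.norm_eq_tsum_rpow toReal_pos, lp.norm_eq_tsum_rpow toReal_pos]
  congr 1
  simp only [h]
  exact (Equiv.subRight n).tsum_eq fun k => ‖s k‖ ^ p.toReal

theorem norm_le_of_eq_diff (t : Fin d) (s s' : lp (fun _ : Fin d → ℤ => ℂ) p)
    (h : (s' : (Fin d → ℤ) → ℂ) = diff t s) : ‖s'‖ ≤ 2 * ‖s‖ := by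
  obtain ⟨y, hy⟩ : ∃ y : lp (fun _ : Fin d → ℤ => ℂ) p, ∀ k, y k = s (k - Pi.single t 1) :=
    ⟨⟨_, memℓp_shift (lp.memℓp s) (Pi.single t 1)⟩, fun _ => rfl⟩
  have e : s' = s - y := by
    ext k
    rw [h, lp.coeFn_sub, Pi.sub_apply, hy]
    rfl
  have h1 := norm_sub_le s y
  rw [norm_shift_lp _ hy] at h1
  rw [e, two_mul]
  exact h1

theorem norm_multiDiffLp_le (ρ : Fin d → ℕ) (s : lp (fun _ : Fin d → ℤ => ℂ) p) :
    ‖multiDiffLp ρ s‖ ≤ 2 ^ (∑ i, ρ i) * ‖s‖ := by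
  induction ρ using multiIndex_induction with
  | h0 =>
    rw [multiDiffLp_zero]
    simp
  | hs ρ t ih =>
    have h1 := norm_le_of_eq_diff t (multiDiffLp ρ s) (multiDiffLp (ρ + Pi.single t 1) s) (by
      rw [coe_multiDiffLp, multiDiff_add_single]
      rfl)
    rw [sum_add_single, pow_succ]
    linarith

theorem continuous_multiDiffLp (ρ : Fin d → ℕ) :
    Continuous fun s : lp (fun _ : Fin d → ℤ => ℂ) p => multiDiffLp ρ s := by
  have := (LinearMap.mkContinuous (multiDiffLp (p := p) ρ) (2 ^ (∑ i, ρ i))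
    (norm_multiDiffLp_le (p := p) ρ)).continuous
  exact this

/-- The norm `∑_{|ρ| ≤ m} |a|^{|ρ|} ‖Δ^ρ s‖_p` of a single scale. -/
def scaleNorm (m : ℕ) (a : ℝ) (s : lp (fun _ : Fin d → ℤ => ℂ) p) : ℝ :=
  ∑ ρ ∈ multiIndices d m, |a| ^ (∑ i, ρ i) * ‖multiDiffLp ρ s‖

theorem scaleNorm_nonneg (a : ℝ) (s : lp (fun _ : Fin d → ℤ => ℂ) p) : 0 ≤ scaleNorm m a s :=
  Finset.sum_nonneg fun _ _ => by positivity

theorem norm_le_scaleNorm (a : ℝ) (s : lp (fun _ : Fin d → ℤ => ℂ) p) :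
    ‖s‖ ≤ scaleNorm m a s := by
  have := Finset.single_le_sum
    (f := fun ρ : Fin d → ℕ => |a| ^ (∑ i, ρ i) * ‖multiDiffLp ρ s‖)
    (fun _ _ => by positivity) (zero_mem_multiIndices d m)
  simpa [multiDiffLp_zero, scaleNorm] using this

theorem continuous_scaleNorm (a : ℝ) :
    Continuous fun s : lp (fun _ : Fin d → ℤ => ℂ) p => scaleNorm m a s :=
  continuous_finsetSum _ fun ρ _ => ((continuous_multiDiffLp ρ).norm).const_mul _

namespace WeightedSeq

variable {α : ℕ+ → ℝ}

theorem memℓp_toSeq (c : WeightedSeq d p m α) (j : ℕ+) : Memℓp (toSeq c j) p := by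
  have := (memMixed c (zero_mem_multiIndices d m)).1 j
  rwa [weightedDiff_zero_index] at this

/-- The sequence `(c_{j,k})_k` at the scale `j`. -/
def level (j : ℕ+) : WeightedSeq d p m α →ₗ[ℂ] lp (fun _ : Fin d → ℤ => ℂ) p where
  toFun c := ⟨toSeq c j, memℓp_toSeq c j⟩
  map_add' c c' := by
    ext1
    change toSeq (c + c') j = toSeq c j + toSeq c' j
    rw [map_add]
    rfl
  map_smul' a c := by
    ext1
    change toSeq (a • c) j = a • toSeq c j
    rw [map_smul]
    rfl

theorem memℓp_weightedDiff {c : ℕ+ → (Fin d → ℤ) → ℂ} (hc : ∀ j, Memℓp (c j) p)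
    (ρ : Fin d → ℕ) (j : ℕ+) : Memℓp (weightedDiff α ρ c j) p :=
  (memℓp_multiDiff (hc j) ρ).const_smul _

theorem seqNorm_weightedDiff {c : ℕ+ → (Fin d → ℤ) → ℂ}
    (s : ℕ+ → lp (fun _ : Fin d → ℤ => ℂ) p) (hs : ∀ j, (s j : (Fin d → ℤ) → ℂ) = c j)
    (ρ : Fin d → ℕ) (j : ℕ+) :
    seqNorm p (weightedDiff α ρ c j) = |α j| ^ (∑ i, ρ i) * ‖multiDiffLp ρ (s j)‖ := by
  have hc : Memℓp (c j) p := hs j ▸ lp.memℓp (s j)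
  have h1 : weightedDiff α ρ c j = ((α j : ℂ) ^ ∑ i, ρ i) • multiDiff ρ (c j) := rfl
  rw [h1, seqNorm_smul _ (memℓp_multiDiff hc ρ), norm_pow, Complex.norm_real, Real.norm_eq_abs,
    seqNorm_eq_norm (memℓp_multiDiff hc ρ)]
  congr 2
  ext1
  rw [coe_multiDiffLp, hs]

/-- The norm is the sum of the norms of the scales. -/
theorem hasSum_scaleNorm (c : WeightedSeq d p m α) :
    HasSum (fun j => scaleNorm m (α j) (level j c)) ‖c‖ := by
  rw [norm_def]
  refine hasSum_sum fun ρ hρ => ?_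
  have h := (memMixed c hρ).2.hasSum
  have e : (fun j => seqNorm p (weightedDiff α ρ (toSeq c) j))
      = fun j => |α j| ^ (∑ i, ρ i) * ‖multiDiffLp ρ (level j c)‖ :=
    funext fun j => seqNorm_weightedDiff (fun j => level j c) (fun _ => rfl) ρ j
  rw [mixedNorm]
  rw [e] at h ⊢
  exact h

/-- The element of the space with given scales. -/
theorem exists_of_levels (s : ℕ+ → lp (fun _ : Fin d → ℤ => ℂ) p)
    (hs : Summable fun j => scaleNorm m (α j) (s j)) :
    ∃ c : WeightedSeq d p m α, ∀ j, level j c = s j := by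
  refine ⟨⟨fun j => s j, fun ρ hρ => ⟨fun j => memℓp_weightedDiff (fun i => lp.memℓp (s i)) ρ j,
    ?_⟩⟩, fun j => rfl⟩
  simp only [seqNorm_weightedDiff s fun _ => rfl]
  refine Summable.of_nonneg_of_le (fun j => by positivity) (fun j => ?_) hs
  exact Finset.single_le_sum
    (f := fun ρ : Fin d → ℕ => |α j| ^ (∑ i, ρ i) * ‖multiDiffLp ρ (s j)‖)
    (fun _ _ => by positivity) hρ

theorem sum_scaleNorm_le (c : WeightedSeq d p m α) (J : Finset ℕ+) :
    ∑ j ∈ J, scaleNorm m (α j) (level j c) ≤ ‖c‖ :=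
  sum_le_hasSum J (fun _ _ => scaleNorm_nonneg _ _) (hasSum_scaleNorm c)

theorem norm_level_le (c : WeightedSeq d p m α) (j : ℕ+) : ‖level j c‖ ≤ ‖c‖ := by
  have := sum_scaleNorm_le c {j}
  rw [Finset.sum_singleton] at this
  exact (norm_le_scaleNorm _ _).trans this

/-- Limits exist scale by scale. The Cauchy estimate passes to the limit on finite sets of scales
and then to the whole sum. -/
instance : CompleteSpace (WeightedSeq d p m α) := by
  refine Metric.complete_of_cauchySeq_tendsto fun u hu => ?_
  have hlev : ∀ j, CauchySeq fun n => level j (u n) := fun j => by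
    have h1 := ((level (d := d) (p := p) (m := m) (α := α) j).mkContinuous 1 fun c => by
      rw [one_mul]; exact norm_level_le c j).uniformContinuous
    exact h1.comp_cauchySeq hu
  choose s hs using fun j => cauchySeq_tendsto_of_complete (hlev j)
  have key : ∀ (ε : ℝ) (N : ℕ), (∀ n ≥ N, ‖u N - u n‖ ≤ ε) → ∀ J : Finset ℕ+,
      ∑ j ∈ J, scaleNorm m (α j) (level j (u N) - s j) ≤ ε := by
    intro ε N hN J
    have hlim : Tendsto (fun n => ∑ j ∈ J, scaleNorm m (α j) (level j (u N) - level j (u n)))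
        atTop (𝓝 (∑ j ∈ J, scaleNorm m (α j) (level j (u N) - s j))) :=
      tendsto_finsetSum _ fun j _ =>
        ((continuous_scaleNorm (α j)).tendsto _).comp ((hs j).const_sub _)
    refine le_of_tendsto hlim ?_
    filter_upwards [eventually_ge_atTop N] with n hn
    refine le_trans ?_ (hN n hn)
    simpa only [map_sub] using sum_scaleNorm_le (u N - u n) J
  have key2 : ∀ (ε : ℝ) (N : ℕ), (∀ n ≥ N, ‖u N - u n‖ ≤ ε) →
      Summable fun j => scaleNorm m (α j) (level j (u N) - s j) := fun ε N hN =>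
    summable_of_sum_le (fun j => scaleNorm_nonneg _ _) (key ε N hN)
  have hcau : ∀ ε > 0, ∃ N, ∀ k ≥ N, ∀ n ≥ k, ‖u k - u n‖ ≤ ε := by
    intro ε hε
    obtain ⟨N, hN⟩ := Metric.cauchySeq_iff.mp hu ε hε
    refine ⟨N, fun k hk n hn => ?_⟩
    rw [← dist_eq_norm]
    exact (hN k hk n (hk.trans hn)).le
  obtain ⟨N, hN⟩ := hcau 1 one_pos
  -- The limit family `s` is not yet known to lie in the space, but its difference from one `u N`
  -- does by `key2`; the limit is then `u N - e`.
  obtain ⟨e, he⟩ := exists_of_levels (α := α) _ (key2 1 N (hN N le_rfl))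
  have hlim : ∀ j, level j (u N - e) = s j := fun j => by
    rw [map_sub, he, sub_sub_cancel]
  refine ⟨u N - e, Metric.tendsto_atTop.mpr fun ε hε => ?_⟩
  obtain ⟨K, hK⟩ := hcau (ε / 2) (by positivity)
  refine ⟨K, fun n hn => ?_⟩
  rw [dist_eq_norm]
  refine lt_of_le_of_lt ?_ (half_lt_self hε)
  have h1 := hasSum_scaleNorm (u n - (u N - e))
  refine hasSum_le_of_sum_le h1 fun J => ?_
  simp only [map_sub, he, sub_sub_cancel] at *
  exact key (ε / 2) n (hK n hn) J

/-- Summation over the scales of operators that are bounded scale by scale. -/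
theorem exists_sum_levels {H : Type*} [NormedAddCommGroup H] [NormedSpace ℂ H] [CompleteSpace H]
    {N : ℝ} (G : ℕ+ → lp (fun _ : Fin d → ℤ => ℂ) p →ₗ[ℂ] H)
    (hG : ∀ j s, ‖G j s‖ ≤ N * scaleNorm m (α j) s) :
    ∃ S : WeightedSeq d p m α →L[ℂ] H, ∀ c,
      (Summable fun j => ‖G j (level j c)‖) ∧ HasSum (fun j => G j (level j c)) (S c) := by
  have hs : ∀ c : WeightedSeq d p m α, Summable fun j => ‖G j (level j c)‖ := fun c =>
    Summable.of_nonneg_of_le (fun _ => norm_nonneg _) (fun j => hG j _)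
      ((hasSum_scaleNorm c).summable.mul_left N)
  let S₀ : WeightedSeq d p m α →ₗ[ℂ] H :=
    { toFun := fun c => ∑' j, G j (level j c)
      map_add' := fun c c' => by
        simp only [map_add]
        exact (hs c).of_norm.tsum_add (hs c').of_norm
      map_smul' := fun a c => by
        simp only [map_smul, RingHom.id_apply]
        exact (hs c).of_norm.tsum_const_smul a }
  refine ⟨S₀.mkContinuous N fun c => ?_, fun c => ⟨hs c, (hs c).of_norm.hasSum⟩⟩
  refine (norm_tsum_le_tsum_norm (hs c)).trans ?_
  rw [← ((hasSum_scaleNorm c).mul_left N).tsum_eq]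
  exact (hs c).tsum_le_tsum (fun j => hG j _) ((hasSum_scaleNorm c).summable.mul_left N)

end WeightedSeq

end WeightedSequences

/-! ### Pointwise form of the averages, and reduction to the integer lattice. -/

section Averages

variable {d : ℕ} {p : ℝ≥0∞} [Fact (1 ≤ p)]

/-! ### Averages of translations as pointwise integrals -/

/-- By Hölder the integral of `|f(· - y)|` over `K` is at most `‖f‖_p |K|^{1 - 1/p}`, uniformly in
`y`, and `μ` has mass one. -/
theorem integrable_prod_sub {f : Space d → ℂ} (hf : MemLp f p volume)
    (μ : Measure (Space d)) [IsProbabilityMeasure μ] {K : Set (Space d)} (hK : IsCompact K) :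
    Integrable (fun z : Space d × Space d => f (z.1 - z.2)) ((volume.restrict K).prod μ) := by
  have hm : AEStronglyMeasurable (fun z : Space d × Space d => f (z.1 - z.2))
      ((volume : Measure (Space d)).prod μ) :=
    hf.1.comp_quasiMeasurePreserving (quasiMeasurePreserving_sub_of_right_invariant volume μ)
  have hm' : AEStronglyMeasurable (fun z : Space d × Space d => f (z.1 - z.2))
      ((volume.restrict K).prod μ) :=
    hm.mono_ac (Measure.AbsolutelyContinuous.prod Measure.restrict_le_self.absolutelyContinuous
      Measure.AbsolutelyContinuous.rfl)
  refine ⟨hm', ?_⟩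
  have hfin : volume K ≠ ⊤ := hK.measure_lt_top.ne
  set C : ℝ≥0∞ := eLpNorm f p volume * (volume K) ^ (1 / (1 : ℝ≥0∞).toReal - 1 / p.toReal) with hC
  have hCt : C < ⊤ := by
    refine ENNReal.mul_lt_top hf.2 (ENNReal.rpow_lt_top_of_nonneg ?_ hfin)
    rw [ENNReal.toReal_one, div_one, sub_nonneg]
    by_cases hp : p = ⊤
    · simp [hp]
    · have h1 : 1 ≤ p.toReal := (ENNReal.dichotomy p).resolve_left hp
      rw [div_le_one (by linarith)]
      exact h1
  have hb : ∀ y, ∫⁻ x in K, ‖f (x - y)‖ₑ ≤ C := by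
    intro y
    have h1 := eLpNorm_le_eLpNorm_mul_rpow_measure_univ (p := 1) (q := p) Fact.out
      (aestronglyMeasurable_sub hf.1 y).restrict (μ := volume.restrict K)
    rw [eLpNorm_one_eq_lintegral_enorm, Measure.restrict_apply_univ] at h1
    refine h1.trans (mul_le_mul_left ?_ _)
    refine (eLpNorm_mono_measure _ Measure.restrict_le_self).trans ?_
    exact (eLpNorm_comp_measurePreserving hf.1 (measurePreserving_sub_right volume y)).le
  rw [hasFiniteIntegral_iff_enorm, lintegral_prod_symm _ hm'.enorm]
  refine (lintegral_mono hb).trans_lt ?_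
  simpa using hCt

variable [hp : Fact (p ≠ ⊤)]

/-- The `L^p`-valued integral and the pointwise integral have the same pairings with test functions
by Fubini, hence agree almost everywhere. -/
theorem ae_eq_transAvg {f : Space d → ℂ} (hf : MemLp f p volume)
    (μ : Measure (Space d)) [IsProbabilityMeasure μ] :
    (fun x => ∫ y, f (x - y) ∂μ) =ᵐ[volume] transAvg μ (hf.toLp f) := by
  refine ae_eq_of_integral_contDiff_smul_eq ?_
    ((Lp.memLp _).locallyIntegrable Fact.out) fun φ hφ hc => ?_
  · rw [locallyIntegrable_iff]
    intro K hK
    exact (integrable_prod_sub hf μ hK).integral_prod_left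
  · have h0 : ∀ x ∉ tsupport φ, φ x • ∫ y, f (x - y) ∂μ = 0 := fun x hx => by
      rw [image_eq_zero_of_notMem_tsupport hx, zero_smul]
    obtain ⟨M, hM⟩ := hφ.continuous.bounded_above_of_compact_support hc
    have hcont : Continuous fun z : Space d × Space d => φ z.1 :=
      hφ.continuous.comp continuous_fst
    have hint : Integrable (fun z : Space d × Space d => φ z.1 • f (z.1 - z.2))
        ((volume.restrict (tsupport φ)).prod μ) :=
      (integrable_prod_sub hf μ hc.isCompact).bdd_smul M hcont.aestronglyMeasurable
        (Eventually.of_forall fun z : Space d × Space d => hM z.1)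
    rw [pairing_transAvg hφ.continuous hc,
      ← setIntegral_eq_integral_of_forall_compl_eq_zero h0]
    simp only [← integral_smul]
    rw [integral_integral_swap hint]
    congr 1
    ext1 y
    rw [setIntegral_eq_integral_of_forall_compl_eq_zero fun x hx => by
      rw [image_eq_zero_of_notMem_tsupport hx, zero_smul]]
    refine integral_congr_ae ?_
    filter_upwards [translate_toLp hf y] with x hx
    rw [hx]

/-- The average of a function over the translates of the unit cube. -/
def cubeAvg (f : Space d → ℂ) (x : Space d) : ℂ := ∫ y, f (x - y) ∂(cubeMeasure d)

theorem memLp_cubeAvg {f : Space d → ℂ} (hf : MemLp f p volume) :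
    ∃ h : MemLp (cubeAvg f) p volume,
      h.toLp (cubeAvg f) = transAvg (cubeMeasure d) (hf.toLp f) := by
  have h := ae_eq_transAvg hf (cubeMeasure d)
  refine ⟨(memLp_congr_ae h).mpr (Lp.memLp _), Lp.ext ?_⟩
  exact (MemLp.coeFn_toLp _).trans h

theorem lintegral_enorm_le_perNorm {f : Space d → ℂ} (hf : AEStronglyMeasurable f volume) :
    ∫⁻ x, ‖f x‖ₑ ≤ perNorm p f := by
  rw [lintegral_enorm_eq_cube hf, perNorm]
  refine le_trans ?_ (eLpNorm_le_eLpNorm_of_exponent_le (p := 1) Fact.out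
    (aemeasurable_perSum hf).restrict.aestronglyMeasurable)
  rw [eLpNorm_one_eq_lintegral_enorm]
  simp only [enorm_eq_self]
  exact le_rfl

/-- The cubes over which the different terms average tile `ℝ^d`, so together they see at most the
full integral of `|f|`. One cube average thus makes the periodization bounded. -/
theorem perSum_cubeAvg_le (f : Space d → ℂ) (x : Space d) :
    perSum (cubeAvg f) x ≤ ∫⁻ y, ‖f y‖ₑ := by
  have h1 : ∫⁻ y, ‖f y‖ₑ = ∫⁻ z, ‖f (x - z)‖ₑ :=
    (lintegral_sub_left_eq_self (fun y => ‖f y‖ₑ) x).symm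
  rw [h1, lintegral_eq_tsum_unitCube]
  refine ENNReal.tsum_le_tsum fun k => ?_
  refine (enorm_integral_le_lintegral_enorm _).trans (lintegral_mono fun y => ?_)
  rw [sub_sub, add_comm]

theorem perNorm_cubeAvg_le {f : Space d → ℂ} (hf : AEStronglyMeasurable f volume) :
    perNorm p (cubeAvg f) ≤ perNorm p f := by
  refine le_trans ?_ (lintegral_enorm_le_perNorm hf)
  rw [perNorm]
  refine (eLpNorm_mono_enorm (g := fun _ => ∫⁻ y, ‖f y‖ₑ) fun x => ?_).trans ?_
  · simp only [enorm_eq_self]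
    exact perSum_cubeAvg_le f x
  · rw [eLpNorm_const' _ ne_zero_of_one_le hp.out]
    simp

theorem iterate_cubeAvg {f : Space d → ℂ} (hf : MemLp f p volume) (m : ℕ) :
    ∃ h : MemLp (cubeAvg^[m] f) p volume, perNorm p (cubeAvg^[m] f) ≤ perNorm p f ∧
      h.toLp (cubeAvg^[m] f) = (transAvg (cubeMeasure d))^[m] (hf.toLp f) := by
  induction m with
  | zero => exact ⟨hf, le_rfl, rfl⟩
  | succ m ih =>
    obtain ⟨h, hle, e⟩ := ih
    obtain ⟨h', e'⟩ := memLp_cubeAvg h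
    simp only [Function.iterate_succ_apply']
    exact ⟨h', (perNorm_cubeAvg_le h.1).trans hle, by rw [e', e]⟩

/-- The iterated averages of a lattice sum are a lattice sum. -/
theorem IsLatticeSum.iterate_cubeAvg {η : Space d → ℂ} (hη : MemLp η p volume)
    (hN : perNorm p η < ⊤) {F : lp (fun _ : Fin d → ℤ => ℂ) p →L[ℂ] LpC d p}
    (hF : IsLatticeSum η F) (m : ℕ) (s : lp (fun _ : Fin d → ℤ => ℂ) p) :
    ∀ᵐ x, (Summable fun k => ‖s k * cubeAvg^[m] η (x - intPoint k)‖) ∧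
      HasSum (fun k => s k * cubeAvg^[m] η (x - intPoint k))
        ((AffineSynthesis.transAvg (cubeMeasure d))^[m] (F s) x) := by
  obtain ⟨h, hle, e⟩ := AffineSynthesis.iterate_cubeAvg hη m
  obtain ⟨G, hG⟩ := exists_isLatticeSum h.1 (hle.trans_lt hN)
  obtain ⟨ν, hν, -, hit⟩ := exists_iterate_transAvg (p := p) (cubeMeasure d) bddSupp_cubeMeasure m
  rw [hit] at e ⊢
  rw [hF.transAvg hG hη h ν e.symm s]
  exact hG s

/-! ### Reduction to the lattice `ℤ^d` -/

variable {b : Matrix (Fin d) (Fin d) ℝ}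

/-- The invertible linear map `x ↦ b x`. -/
def actEquiv (hb : b.det ≠ 0) : Space d ≃L[ℝ] Space d :=
  (LinearMap.equivOfDetNeZero (Matrix.toLpLin 2 2 b)
    (by rwa [LinearMap.det_toLpLin])).toContinuousLinearEquiv

theorem actEquiv_apply (hb : b.det ≠ 0) (x : Space d) : actEquiv hb x = act b x := rfl

theorem act_intPoint (b : Matrix (Fin d) (Fin d) ℝ) (k : Fin d → ℤ) :
    act b (intPoint k) = latticePoint b k := rfl

theorem act_sub (b : Matrix (Fin d) (Fin d) ℝ) (x y : Space d) :
    act b (x - y) = act b x - act b y := map_sub _ _ _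

theorem map_act_volume (hb : b.det ≠ 0) :
    Measure.map (act b) (volume : Measure (Space d)) = ENNReal.ofReal |b.det⁻¹| • volume := by
  rw [← LinearMap.det_toLpLin 2 b]
  exact Measure.map_linearMap_addHaar_eq_smul_addHaar volume (by rwa [LinearMap.det_toLpLin])

theorem measurableEmbedding_act (hb : b.det ≠ 0) : MeasurableEmbedding (act b) :=
  (actEquiv hb).toHomeomorph.measurableEmbedding

theorem memLp_matrixRescale (hb : b.det ≠ 0) {f : Space d → ℂ} (hf : MemLp f p volume) :
    MemLp (matrixRescale b f) p volume :=
  (memLp_comp_linearEquiv (actEquiv hb) hf).const_mul _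

theorem integral_comp_act (hb : b.det ≠ 0) {G : Type*} [NormedAddCommGroup G] [NormedSpace ℝ G]
    (f : Space d → G) :
    |b.det| • ∫ x, f (act b x) = ∫ x, f x := by
  rw [← (measurableEmbedding_act hb).integral_map f, map_act_volume hb, integral_smul_measure,
    ENNReal.toReal_ofReal (abs_nonneg _), abs_inv, smul_inv_smul₀ (abs_ne_zero.mpr hb)]

theorem integral_matrixRescale (hb : b.det ≠ 0) (f : Space d → ℂ) :
    ∫ x, matrixRescale b f x = ∫ x, f x := by
  rw [← integral_comp_act hb f]
  simp only [matrixRescale]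
  rw [integral_const_mul, Complex.real_smul]

theorem perSum_matrixRescale (η : Space d → ℂ) (y : Space d) :
    perSum (matrixRescale b η) y = absPeriodization b η (act b y) := by
  simp only [perSum, matrixRescale, absPeriodization, enorm_mul, ENNReal.tsum_mul_left, act_sub,
    act_intPoint]
  congr 1
  simp [enorm_eq_nnnorm]

/-- The periodization of `M_b η` at `y` is `P|η|` at `b y`. The local hypothesis is needed only on
one compact set containing `b` times the unit cube. -/
theorem perNorm_matrixRescale_lt_top (hb : b.det ≠ 0) {η : Space d → ℂ}
    (hη : PeriodizationLocLp p b η) : perNorm p (matrixRescale b η) < ⊤ := by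
  have hK : IsCompact (act b '' Metric.closedBall (0 : Space d) √d) :=
    (isCompact_closedBall _ _).image (actEquiv hb).continuous
  set K := act b '' Metric.closedBall (0 : Space d) √d with hKd
  have e : perSum (matrixRescale b η) = absPeriodization b η ∘ act b :=
    funext (perSum_matrixRescale η)
  have hsub : unitCube d ⊆ act b ⁻¹' K := fun y hy =>
    ⟨y, mem_closedBall_zero_iff.mpr (norm_le_of_mem_unitCube hy), rfl⟩
  rw [perNorm, e]
  refine (eLpNorm_mono_measure _ (Measure.restrict_mono hsub le_rfl)).trans_lt ?_
  rw [← (measurableEmbedding_act hb).eLpNorm_map_measure,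
    ← (measurableEmbedding_act hb).restrict_map, map_act_volume hb, Measure.restrict_smul,
    eLpNorm_smul_measure_of_ne_top Fact.out]
  exact ENNReal.mul_lt_top (ENNReal.rpow_lt_top_of_nonneg (by positivity) (by simp)) (hη K hK).2

theorem volume_real_periodBox (b : Matrix (Fin d) (Fin d) ℝ) :
    volume.real (periodBox b) = |b.det| := by
  have h1 : (volume : Measure (Space d)) (unitCube d) = 1 := by
    have := measure_univ (μ := cubeMeasure d)
    rwa [cubeMeasure, Measure.restrict_apply_univ] at this
  have h := Measure.addHaar_image_linearMap volume (Matrix.toLpLin 2 2 b) (unitCube d)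
  rw [h1, mul_one, LinearMap.det_toLpLin] at h
  rw [Measure.real]
  change (volume (act b '' unitCube d)).toReal = _
  rw [h, ENNReal.toReal_ofReal (abs_nonneg _)]

/-- Substitute `y ↦ b y` in the convolution: the Jacobian cancels the normalization `|b𝒞|⁻¹ = |det
b|⁻¹`, and a uniform average over the unit cube remains. -/
theorem matrixRescale_synthesizer (hb : b.det ≠ 0) (η : Space d → ℂ) (m : ℕ) :
    matrixRescale b (synthesizer b η m) = cubeAvg^[m] (matrixRescale b η) := by
  induction m with
  | zero => rfl
  | succ m ih =>
    rw [Function.iterate_succ_apply', ← ih]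
    funext x
    have hne : ((|b.det| : ℝ) : ℂ) ≠ 0 := by exact_mod_cast abs_ne_zero.mpr hb
    simp only [matrixRescale, cubeAvg, cubeMeasure]
    rw [synthesizer, convolution, ← integral_comp_act hb, Complex.real_smul,
      ← integral_indicator measurableSet_unitCube, ← integral_const_mul, ← integral_const_mul]
    congr 1
    ext1 y
    have hmem : act b y ∈ periodBox b ↔ y ∈ unitCube d :=
      (actEquiv hb).injective.mem_set_image
    by_cases hy : y ∈ unitCube d
    · simp only [ContinuousLinearMap.mul_apply', boxIndicator]
      rw [Set.indicator_of_mem (hmem.mpr hy), Set.indicator_of_mem hy, volume_real_periodBox,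
        act_sub]
      field_simp
    · simp only [ContinuousLinearMap.mul_apply', boxIndicator]
      rw [Set.indicator_of_notMem (mt hmem.mp hy), Set.indicator_of_notMem hy]
      simp

end Averages

/-! ### Mazur's lemma and the weak limits of dilated oscillating functions. -/

section WeakConvergence

/-! ### Convex combinations of weakly null sequences -/

/-- Mazur's lemma in the finite product `ι → E`, so that one choice of weights serves all indices.
If `0` were outside the closed convex hull of the values on `S`, a functional would separate it
strictly; but such a functional is a sum of coordinate functionals and tends to zero along `l`. -/
theorem exists_convex_combination {ι : Type*} [Fintype ι] {J : Type*} {E : Type*}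
    [NormedAddCommGroup E] [NormedSpace ℂ E] {l : Filter J} [l.NeBot] (w : J → ι → E)
    (hw : ∀ i (Φ : E →L[ℂ] ℂ), Tendsto (fun j => Φ (w j i)) l (𝓝 0))
    {S : Set J} (hS : S ∈ l) {ε : ℝ} (hε : 0 < ε) :
    ∃ (K : Type) (t : Finset K) (c : K → ℝ) (z : K → J), (∀ k ∈ t, 0 ≤ c k) ∧ ∑ k ∈ t, c k = 1 ∧
      (∀ k ∈ t, z k ∈ S) ∧ ∀ i, ‖∑ k ∈ t, c k • w (z k) i‖ ≤ ε := by
  classical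
  have h0 : (0 : ι → E) ∈ closure (convexHull ℝ (w '' S)) := by
    by_contra h0
    obtain ⟨Φ, u, h1, h2⟩ := RCLike.geometric_hahn_banach_point_closed (𝕜 := ℂ)
      (convex_convexHull ℝ (w '' S)).closure isClosed_closure h0
    rw [map_zero, map_zero] at h1
    have hlim : Tendsto (fun j => RCLike.re (Φ (w j))) l (𝓝 0) := by
      have e : ∀ x : ι → E, Φ x = ∑ i, Φ.comp (ContinuousLinearMap.single ℂ (fun _ : ι => E) i)
          (x i) := fun x => by
        conv_lhs => rw [← Finset.univ_sum_single x, map_sum]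
        rfl
      have : Tendsto (fun j => Φ (w j)) l (𝓝 0) := by
        simp only [e]
        rw [← Finset.sum_const_zero (s := (Finset.univ : Finset ι))]
        exact tendsto_finsetSum _ fun i _ => hw i _
      simpa [Function.comp_def] using (RCLike.continuous_re.tendsto (0 : ℂ)).comp this
    obtain ⟨j, hj1, hj2⟩ := ((hlim.eventually (gt_mem_nhds h1)).and hS).exists
    exact lt_asymm hj1 (h2 _ (subset_closure (subset_convexHull ℝ _ ⟨j, hj2, rfl⟩)))
  obtain ⟨x, hx, hd⟩ := Metric.mem_closure_iff.mp h0 ε hε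
  rw [convexHull_eq] at hx
  obtain ⟨K, t, c, y, hc, hsum, hy, rfl⟩ := hx
  have : Nonempty J := (l.nonempty_of_mem hS).to_type.elim fun j => ⟨j⟩
  choose! z hz hzy using hy
  refine ⟨K, t, c, z, hc, hsum, hz, fun i => ?_⟩
  rw [Finset.centerMass_eq_of_sum_1 _ _ hsum, dist_zero_left] at hd
  refine le_trans ?_ hd.le
  refine le_trans (le_of_eq ?_) (norm_le_pi_norm _ i)
  rw [Finset.sum_apply]
  exact congrArg _ (Finset.sum_congr rfl fun k hk => by rw [Pi.smul_apply, hzy k hk])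

variable {d : ℕ} {p : ℝ≥0∞} [Fact (1 ≤ p)]

instance factOneNeTop : Fact ((1 : ℝ≥0∞) ≠ ⊤) := ⟨ENNReal.one_ne_top⟩

/-! ### Weak convergence of dilated periodic functions -/

theorem norm_integral_mul_le (f : LpC d 1) {g : Space d → ℂ}
    {G : ℝ} (hG : ∀ x, ‖g x‖ ≤ G) : ‖∫ x, f x * g x‖ ≤ G * ‖f‖ := by
  rw [L1.norm_eq_integral_norm, ← integral_const_mul]
  refine (norm_integral_le_integral_norm _).trans ?_
  refine integral_mono_of_nonneg (Eventually.of_forall fun _ => norm_nonneg _)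
    ((L1.integrable_coeFn f).norm.const_mul G) (Eventually.of_forall fun x => ?_)
  simp only [norm_mul]
  rw [mul_comm]
  exact mul_le_mul_of_nonneg_right (hG x) (norm_nonneg _)

theorem integrable_mul_bdd {f : Space d → ℂ} (hf : Integrable f) {g : Space d → ℂ}
    (hg : AEStronglyMeasurable g volume) {G : ℝ} (hG : ∀ x, ‖g x‖ ≤ G) :
    Integrable (fun x => f x * g x) :=
  hf.mul_bdd hg (Eventually.of_forall hG)

theorem exists_pairing_bdd {g : Space d → ℂ} (hg : AEStronglyMeasurable g volume) {G : ℝ}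
    (hG : ∀ x, ‖g x‖ ≤ G) : ∃ Φ : LpC d 1 →L[ℂ] ℂ, ∀ f, Φ f = ∫ x, f x * g x := by
  refine ⟨LinearMap.mkContinuous
    { toFun := fun f => ∫ x, f x * g x
      map_add' := fun f f' => ?_
      map_smul' := fun a f => ?_ } G fun f => norm_integral_mul_le f hG, fun f => rfl⟩
  · rw [← integral_add (integrable_mul_bdd (L1.integrable_coeFn f) hg hG)
      (integrable_mul_bdd (L1.integrable_coeFn f') hg hG)]
    refine integral_congr_ae ?_
    filter_upwards [Lp.coeFn_add f f'] with x hx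
    rw [hx, Pi.add_apply, add_mul]
  · rw [RingHom.id_apply, smul_eq_mul, ← integral_const_mul]
    refine integral_congr_ae ?_
    filter_upwards [Lp.coeFn_smul a f] with x hx
    rw [hx, Pi.smul_apply, smul_eq_mul, mul_assoc]

/-- For `p = 1` the normalizing factor is exactly the Jacobian `|a|^d`. -/
theorem integral_dilate_mul (a : ℝˣ) (f : LpC d 1) (g : Space d → ℂ) :
    ∫ x, dilate a f x * g ((a : ℝ) • x) = ∫ x, f x * g x := by
  have h : (fun x => dilate a f x * g ((a : ℝ) • x))
      =ᵐ[volume] fun x => ((|(a : ℝ)| ^ d : ℝ) : ℂ) * (f ((a : ℝ) • x) * g ((a : ℝ) • x)) := by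
    filter_upwards [coeFn_dilate a f] with x hx
    rw [hx, dilFactor]
    simp [mul_assoc]
  have hne : (((|(a : ℝ)| ^ d : ℝ)) : ℂ) ≠ 0 := by
    exact_mod_cast pow_ne_zero _ (abs_ne_zero.mpr a.ne_zero)
  rw [integral_congr_ae h, integral_const_mul,
    Measure.integral_comp_smul volume (fun x => f x * g x), Complex.real_smul,
    finrank_euclideanSpace_fin, abs_inv, abs_pow, Complex.ofReal_inv, mul_inv_cancel_left₀ hne]

/-- By duality the average moves to `g`, where it produces the constant `M`. -/
theorem integral_transAvg_mul (μ : Measure (Space d)) [IsProbabilityMeasure μ] (f : LpC d 1)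
    {g : Space d → ℂ} (hg : AEStronglyMeasurable g volume) {G : ℝ} (hG : ∀ x, ‖g x‖ ≤ G) {M : ℂ}
    (hM : ∀ x, ∫ y, g (x + y) ∂μ = M) : ∫ x, transAvg μ f x * g x = M * ∫ x, f x := by
  obtain ⟨Φ, hΦ⟩ := exists_pairing_bdd hg hG
  have h1 : ∀ y, Φ (translate y f) = ∫ x, f x * g (x + y) := fun y => by
    rw [hΦ, ← integral_add_right_eq_self (fun x => translate y f x * g x) y]
    refine integral_congr_ae ?_
    have := (measurePreserving_add_right volume y).quasiMeasurePreserving.ae (coeFn_translate y f)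
    filter_upwards [this] with x hx
    rw [hx, add_sub_cancel_right]
  have hgm : AEStronglyMeasurable (fun z : Space d × Space d => g (z.1 + z.2))
      ((volume : Measure (Space d)).prod μ) := by
    have h := hg.comp_quasiMeasurePreserving (quasiMeasurePreserving_add_swap volume μ)
    simpa only [Function.comp_def, add_comm] using h
  have hint : Integrable (fun z : Space d × Space d => f z.1 * g (z.1 + z.2))
      ((volume : Measure (Space d)).prod μ) :=
    ((L1.integrable_coeFn f).comp_fst μ).mul_bdd hgm (Eventually.of_forall fun z => hG _)
  rw [← hΦ, map_transAvg]
  simp only [h1]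
  rw [← integral_integral_swap hint]
  simp only [integral_const_mul, hM]
  rw [integral_mul_const, mul_comm]

theorem aestronglyMeasurable_comp_smul {g : Space d → ℂ} (hg : AEStronglyMeasurable g volume)
    (a : ℝˣ) : AEStronglyMeasurable (fun x => g ((a : ℝ) • x)) volume := by
  have h : Measure.QuasiMeasurePreserving (scaleEquiv (d := d) a) volume volume := by
    refine ⟨(scaleEquiv a).continuous.measurable, ?_⟩
    rw [map_volume_linearEquiv]
    exact Measure.smul_absolutelyContinuous
  exact hg.comp_quasiMeasurePreserving h

/-- A Riemann–Lebesgue lemma. Replacing `u` by its average over cubes shrunk by `a_j⁻¹` makes the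
pairing with `g(a_j ·)` exactly `M ∫ u`, and that replacement tends to `u` in `L^1`. -/
theorem tendsto_integral_mul_dilated {ι : Type*} {l : Filter ι} [l.IsCountablyGenerated]
    {a : ι → ℝˣ} (ha : Tendsto (fun j => |(a j : ℝ)|) l atTop) {u : Space d → ℂ}
    (hu : Integrable u) {g : Space d → ℂ} (hg : AEStronglyMeasurable g volume) {G : ℝ}
    (hG : ∀ x, ‖g x‖ ≤ G) {M : ℂ} (hM : ∀ x, ∫ y, g (x + y) ∂(cubeMeasure d) = M) :
    Tendsto (fun j => ∫ x, u x * (g ((a j : ℝ) • x) - M)) l (𝓝 0) := by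
  have hu1 : MemLp u 1 volume := memLp_one_iff_integrable.mpr hu
  set U : LpC d 1 := hu1.toLp u with hU
  have hUu : U =ᵐ[volume] u := hu1.coeFn_toLp
  have key : ∀ j, ‖∫ x, u x * (g ((a j : ℝ) • x) - M)‖
      ≤ G * ‖U - dilate (a j) (transAvg (cubeMeasure d) (dilate (a j)⁻¹ U))‖ := by
    intro j
    set f := dilate (a j)⁻¹ U with hf
    set A := transAvg (cubeMeasure d) f
    have hUf : U = dilate (a j) f := (dilate_dilate_inv _ _).symm
    have hgj := aestronglyMeasurable_comp_smul hg (a j)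
    obtain ⟨Φ, hΦ⟩ := exists_pairing_bdd hgj (fun x => hG _)
    have e1 : ∫ x, U x * g ((a j : ℝ) • x) = ∫ x, f x * g x := by
      rw [hUf, integral_dilate_mul]
    have e2 : ∫ x, dilate (a j) A x * g ((a j : ℝ) • x) = M * ∫ x, U x := by
      rw [integral_dilate_mul, integral_transAvg_mul _ f hg hG hM, hUf]
      have := integral_dilate_mul (a j) f fun _ => 1
      simp only [mul_one] at this
      rw [this]
    have e3 : ∫ x, u x * (g ((a j : ℝ) • x) - M) = Φ (U - dilate (a j) A) := by
      rw [map_sub, hΦ, hΦ, e2, ← integral_const_mul, ← integral_sub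
        (integrable_mul_bdd (L1.integrable_coeFn U) hgj fun x => hG _)
        ((L1.integrable_coeFn U).const_mul M)]
      refine integral_congr_ae ?_
      filter_upwards [hUu] with x hx
      rw [hx]
      ring
    rw [e3, hΦ]
    exact norm_integral_mul_le _ fun x => hG _
  refine squeeze_zero_norm key ?_
  have h := tendsto_dilate_transAvg (p := 1) (cubeMeasure d) ha U
  have h2 := ((tendsto_const_nhds (x := U)).sub h).norm.const_mul G
  simpa using h2

/-! ### Small averages in `L^p` -/

theorem memLp_mul_dilated {v : Space d → ℂ} (hv : MemLp v p volume) {g : Space d → ℂ}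
    (hg : AEStronglyMeasurable g volume) {G : ℝ} (hG : ∀ x, ‖g x‖ ≤ G) (M : ℂ) (a : ℝˣ) :
    MemLp (fun x => v x * (g ((a : ℝ) • x) - M)) p volume :=
  hv.of_le_mul (c := G + ‖M‖)
    (hv.1.mul ((aestronglyMeasurable_comp_smul hg a).sub aestronglyMeasurable_const))
    (Eventually.of_forall fun x => by
      rw [norm_mul, mul_comm]
      exact mul_le_mul_of_nonneg_right ((norm_sub_le _ _).trans (by gcongr; exact hG _))
        (norm_nonneg _))

theorem eLpNorm_sum_smul {K : Type*} (t : Finset K) (c : K → ℝ) {f : K → Space d → ℂ}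
    (hf : ∀ k, MemLp (f k) p volume) :
    eLpNorm (fun x => ∑ k ∈ t, c k • f k x) p volume
      = ‖(∑ k ∈ t, c k • (hf k).toLp (f k) : LpC d p)‖ₑ := by
  have h3 : ∀ᵐ x, ∀ k ∈ t, (c k • (hf k).toLp _ : LpC d p) x = c k • f k x := by
    rw [Filter.eventually_all_finset]
    intro k _
    filter_upwards [Lp.coeFn_smul (c k) ((hf k).toLp _), (hf k).coeFn_toLp] with x h4 h5
    rw [h4, Pi.smul_apply, h5]
  rw [Lp.enorm_def]
  refine eLpNorm_congr_ae ?_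
  filter_upwards [h3, Lp.coeFn_finsetSum t fun k => (c k • (hf k).toLp _ : LpC d p)] with x h4 h5
  rw [h5, Finset.sum_apply]
  exact Finset.sum_congr rfl fun k hk => (h4 k hk).symm

variable [hp : Fact (p ≠ ⊤)]

/-- Use `|h|^p ≤ B^{p-1} |h|` and Cauchy–Schwarz on `K`. Smallness in `L^2` thus transfers to every
`L^p` with `1 ≤ p < ∞`, which avoids any duality in `L^p`. -/
theorem eLpNorm_rpow_le_of_bdd {h : Space d → ℂ} (hm : AEStronglyMeasurable h volume) {B : ℝ}
    (hB : ∀ x, ‖h x‖ ≤ B) {K : Set (Space d)}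
    (hKm : MeasurableSet K) (hK : ∀ x ∉ K, h x = 0) :
    eLpNorm h p volume ^ p.toReal
      ≤ ENNReal.ofReal B ^ (p.toReal - 1) * (eLpNorm h 2 volume * volume K ^ (1 / 2 : ℝ)) := by
  have hq : 1 ≤ p.toReal := one_le_toReal
  have h1 : eLpNorm h p volume ^ p.toReal = ∫⁻ x, ‖h x‖ₑ ^ p.toReal := by
    rw [eLpNorm_eq_lintegral_rpow_enorm_toReal ne_zero_of_one_le hp.out, ← ENNReal.rpow_mul,
      one_div_mul_cancel toReal_pos.ne', ENNReal.rpow_one]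
  have h2 : ∀ x, ‖h x‖ₑ ^ p.toReal
      ≤ ENNReal.ofReal B ^ (p.toReal - 1) * K.indicator (fun x => ‖h x‖ₑ) x := by
    intro x
    by_cases hx : x ∈ K
    · rw [Set.indicator_of_mem hx]
      calc ‖h x‖ₑ ^ p.toReal = ‖h x‖ₑ ^ (p.toReal - 1) * ‖h x‖ₑ ^ (1 : ℝ) := by
            rw [← ENNReal.rpow_add_of_nonneg _ _ (by linarith) (by norm_num), sub_add_cancel]
        _ ≤ _ := by
            rw [ENNReal.rpow_one]
            refine mul_le_mul_left (ENNReal.rpow_le_rpow ?_ (by linarith)) _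
            rw [← ofReal_norm]
            exact ENNReal.ofReal_le_ofReal (hB x)
    · rw [hK x hx, enorm_zero, ENNReal.zero_rpow_of_pos (by linarith)]
      exact zero_le
  have h3 := eLpNorm_le_eLpNorm_mul_rpow_measure_univ (μ := volume.restrict K) (p := 1) (q := 2)
    (by norm_num) (hm.restrict)
  rw [eLpNorm_one_eq_lintegral_enorm, Measure.restrict_apply_univ] at h3
  rw [h1]
  refine (lintegral_mono h2).trans ?_
  rw [lintegral_const_mul' _ _ (ENNReal.rpow_ne_top_of_nonneg (by linarith) ENNReal.ofReal_ne_top),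
    lintegral_indicator hKm]
  refine mul_le_mul_right (h3.trans ?_) _
  have e : 1 / (1 : ℝ≥0∞).toReal - 1 / (2 : ℝ≥0∞).toReal = 1 / 2 := by norm_num
  rw [e]
  exact mul_le_mul_left (eLpNorm_mono_measure _ Measure.restrict_le_self) _

/-- Convex combinations of the functions `v (g(a_j ·) - M)` that are small in `L^p`. -/
theorem exists_small_combination {ι : Type*} [Fintype ι] {J : Type*} {l : Filter J} [l.NeBot]
    [l.IsCountablyGenerated] {a : J → ℝˣ} (ha : Tendsto (fun j => |(a j : ℝ)|) l atTop)
    {v g : ι → Space d → ℂ} (hv : ∀ i, Continuous (v i)) (hc : ∀ i, HasCompactSupport (v i))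
    (hg : ∀ i, AEStronglyMeasurable (g i) volume) {G : ι → ℝ} (hG : ∀ i x, ‖g i x‖ ≤ G i)
    {M : ι → ℂ} (hM : ∀ i x, ∫ y, g i (x + y) ∂(cubeMeasure d) = M i)
    {S : Set J} (hS : S ∈ l) {ε : ℝ≥0∞} (hε : ε ≠ 0) :
    ∃ (K : Type) (t : Finset K) (c : K → ℝ) (z : K → J), (∀ k ∈ t, 0 ≤ c k) ∧ ∑ k ∈ t, c k = 1 ∧
      (∀ k ∈ t, z k ∈ S) ∧ ∀ i, eLpNorm (fun x => ∑ k ∈ t, c k •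
        (v i x * (g i ((a (z k) : ℝ) • x) - M i))) p volume ≤ ε := by
  have hbd : ∀ i, ∃ V, ∀ x, ‖v i x‖ ≤ V := fun i =>
    (hv i).bounded_above_of_compact_support (hc i)
  choose V hV using hbd
  have hG0 : ∀ i, 0 ≤ G i := fun i => (norm_nonneg _).trans (hG i 0)
  have hV0 : ∀ i, 0 ≤ V i := fun i => (norm_nonneg _).trans (hV i 0)
  have hB : ∀ j i x, ‖v i x * (g i ((a j : ℝ) • x) - M i)‖ ≤ V i * (G i + ‖M i‖) := by
    intro j i x
    rw [norm_mul]
    exact mul_le_mul (hV i x) ((norm_sub_le _ _).trans (by gcongr; exact hG i _))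
      (norm_nonneg _) (hV0 i)
  have hm : ∀ j i, AEStronglyMeasurable (fun x => v i x * (g i ((a j : ℝ) • x) - M i)) volume :=
    fun j i => (hv i).aestronglyMeasurable.mul
      ((aestronglyMeasurable_comp_smul (hg i) (a j)).sub aestronglyMeasurable_const)
  have hv2 : ∀ i, MemLp (v i) 2 volume := fun i => (hv i).memLp_of_hasCompactSupport (hc i)
  have hL : ∀ j i, MemLp (fun x => v i x * (g i ((a j : ℝ) • x) - M i)) 2 volume := fun j i =>
    memLp_mul_dilated (hv2 i) (hg i) (hG i) (M i) (a j)
  have hweak : ∀ i (Φ : LpC d 2 →L[ℂ] ℂ),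
      Tendsto (fun j => Φ ((hL j i).toLp _)) l (𝓝 0) := by
    intro i Φ
    -- A functional on `L^2` is an inner product with some `z`; the conjugate of `z` times `v i` is
    -- integrable, so the Riemann–Lebesgue lemma applies.
    set z := (InnerProductSpace.toDual ℂ (LpC d 2)).symm Φ with hz
    have hu : Integrable (fun x => star (z x) * v i x) volume :=
      (Lp.memLp z).star.integrable_mul (hv2 i)
    refine (tendsto_integral_mul_dilated ha hu (hg i) (hG i) (hM i)).congr fun j => ?_
    rw [← InnerProductSpace.toDual_symm_apply, ← hz, L2.inner_def]
    refine integral_congr_ae ?_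
    filter_upwards [(hL j i).coeFn_toLp] with x hx
    rw [hx, RCLike.inner_apply']
    simp only [RCLike.star_def]
    ring
  have hC : ∀ i, ENNReal.ofReal (V i * (G i + ‖M i‖)) ^ (p.toReal - 1)
      * volume (tsupport (v i)) ^ (1 / 2 : ℝ) ≠ ⊤ := fun i =>
    ENNReal.mul_ne_top (ENNReal.rpow_ne_top_of_nonneg (sub_nonneg.mpr one_le_toReal)
      ENNReal.ofReal_ne_top)
      (ENNReal.rpow_ne_top_of_nonneg (by norm_num) (hc i).isCompact.measure_lt_top.ne)
  have hεq : 0 < ε ^ p.toReal := by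
    rw [pos_iff_ne_zero, Ne, ENNReal.rpow_eq_zero_iff_of_pos toReal_pos]
    exact hε
  -- Since `ι` is finite, a single `L^2` tolerance `δ` suffices for all indices.
  have hδ : ∀ᶠ δ : ℝ in 𝓝[>] 0, ∀ i, ENNReal.ofReal (V i * (G i + ‖M i‖)) ^ (p.toReal - 1)
      * volume (tsupport (v i)) ^ (1 / 2 : ℝ) * ENNReal.ofReal δ ≤ ε ^ p.toReal := by
    rw [eventually_all]
    intro i
    have h1 : Tendsto (fun δ : ℝ => ENNReal.ofReal (V i * (G i + ‖M i‖)) ^ (p.toReal - 1)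
        * volume (tsupport (v i)) ^ (1 / 2 : ℝ) * ENNReal.ofReal δ) (𝓝[>] 0) (𝓝 0) := by
      have := ENNReal.Tendsto.const_mul (ENNReal.tendsto_ofReal
        (tendsto_nhdsWithin_of_tendsto_nhds (s := Set.Ioi (0 : ℝ)) (tendsto_id (x := 𝓝 (0 : ℝ)))))
        (Or.inr (hC i))
      simpa using this
    exact h1.eventually (ge_mem_nhds hεq)
  obtain ⟨δ, hδ, hδ0⟩ := (hδ.and self_mem_nhdsWithin).exists
  obtain ⟨K, t, c, z, hc0, hc1, hz, hsm⟩ := exists_convex_combination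
    (fun j i => (hL j i).toLp _) hweak hS hδ0
  refine ⟨K, t, c, z, hc0, hc1, hz, fun i => ?_⟩
  set h : Space d → ℂ := fun x => ∑ k ∈ t, c k • (v i x * (g i ((a (z k) : ℝ) • x) - M i)) with hh
  have hhm : AEStronglyMeasurable h volume :=
    Finset.aestronglyMeasurable_fun_sum t fun k _ => (hm (z k) i).const_smul (c k)
  have hhB : ∀ x, ‖h x‖ ≤ V i * (G i + ‖M i‖) := by
    intro x
    calc ‖h x‖ ≤ ∑ k ∈ t, c k * (V i * (G i + ‖M i‖)) := by
          refine norm_sum_le_of_le t fun k hk => ?_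
          rw [norm_smul, Real.norm_of_nonneg (hc0 k hk)]
          exact mul_le_mul_of_nonneg_left (hB _ i x) (hc0 k hk)
      _ = _ := by rw [← Finset.sum_mul, hc1, one_mul]
  have hh0 : ∀ x ∉ tsupport (v i), h x = 0 := fun x hx => by
    simp [hh, image_eq_zero_of_notMem_tsupport hx]
  have h2 : eLpNorm h 2 volume ≤ ENNReal.ofReal δ := by
    rw [hh, eLpNorm_sum_smul t c fun k => hL (z k) i, ← ofReal_norm]
    exact ENNReal.ofReal_le_ofReal (hsm i)
  have h4 := eLpNorm_rpow_le_of_bdd (p := p) hhm hhB (isClosed_tsupport (v i)).measurableSet hh0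
  rw [← ENNReal.rpow_le_rpow_iff (z := p.toReal) toReal_pos]
  refine h4.trans (le_trans ?_ (hδ i))
  rw [mul_assoc, mul_comm (volume _ ^ _)]
  gcongr

end WeakConvergence

/-! ### Bounded compactly supported kernels, their periodizations, and truncation. -/

section Kernels

variable {d : ℕ} {p : ℝ≥0∞}

/-! ### Bounded kernels of bounded support -/

/-- A lattice point with `‖x - k‖ ≤ R` has its whole tile in the ball of radius `R + √d` about `x`.
Disjointness of the tiles bounds the number of such points by the volume of that ball. -/
theorem exists_perSum_le {κ : Space d → ℂ} {M R : ℝ} (hM : ∀ x, ‖κ x‖ ≤ M)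
    (hR : ∀ x, R < ‖x‖ → κ x = 0) : ∃ C : ℝ, 0 ≤ C ∧ ∀ x, perSum κ x ≤ ENNReal.ofReal C := by
  set D : ℝ≥0∞ := ENNReal.ofReal M * volume (Metric.closedBall (0 : Space d) (R + √d)) with hD
  have hDt : D ≠ ⊤ := ENNReal.mul_ne_top ENNReal.ofReal_ne_top measure_closedBall_lt_top.ne
  refine ⟨D.toReal, ENNReal.toReal_nonneg, fun x => ?_⟩
  rw [ENNReal.ofReal_toReal hDt, hD, ← Measure.addHaar_closedBall_center volume x,
    ← lintegral_indicator_one Metric.isClosed_closedBall.measurableSet, lintegral_eq_tsum_unitCube,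
    ← ENNReal.tsum_mul_left]
  refine ENNReal.tsum_le_tsum fun k => ?_
  by_cases hk : R < ‖x - intPoint k‖
  · rw [hR _ hk, enorm_zero]
    exact zero_le
  · have h1 : ∀ᵐ y ∂(cubeMeasure d), (1 : ℝ≥0∞)
        ≤ (Metric.closedBall x (R + √d)).indicator (1 : Space d → ℝ≥0∞) (y + intPoint k) := by
      filter_upwards [ae_restrict_mem measurableSet_unitCube] with y hy
      rw [Set.indicator_of_mem, Pi.one_apply]
      rw [Metric.mem_closedBall, dist_eq_norm]
      have e : y + intPoint k - x = y - (x - intPoint k) := by abel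
      rw [e]
      refine (norm_sub_le _ _).trans ?_
      linarith [norm_le_of_mem_unitCube hy, not_lt.mp hk]
    have h2 := lintegral_mono_ae h1
    rw [lintegral_one, measure_univ] at h2
    calc ‖κ (x - intPoint k)‖ₑ ≤ ENNReal.ofReal M * 1 := by
          rw [mul_one, ← ofReal_norm]
          exact ENNReal.ofReal_le_ofReal (hM _)
      _ ≤ _ := mul_le_mul_right h2 _

theorem perNorm_lt_top_of_bdd {κ : Space d → ℂ} {M R : ℝ} (hM : ∀ x, ‖κ x‖ ≤ M)
    (hR : ∀ x, R < ‖x‖ → κ x = 0) : perNorm p κ < ⊤ := by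
  obtain ⟨C, -, hC⟩ := exists_perSum_le hM hR
  rw [perNorm]
  refine (eLpNorm_mono_enorm (g := fun _ => C) fun x => ?_).trans_lt
    (memLp_const C : MemLp (fun _ : Space d => C) p (cubeMeasure d)).2
  rw [enorm_eq_self]
  exact (hC x).trans (Real.ofReal_le_enorm _)

theorem memLp_of_bdd {κ : Space d → ℂ} (hm : AEStronglyMeasurable κ volume) {M R : ℝ}
    (hM : ∀ x, ‖κ x‖ ≤ M) (hR : ∀ x, R < ‖x‖ → κ x = 0) : MemLp κ p volume := by
  refine (memLp_indicator_const p (Metric.isClosed_closedBall (x := (0 : Space d))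
    (ε := R)).measurableSet M (Or.inr measure_closedBall_lt_top.ne)).mono hm
    (Eventually.of_forall fun x => ?_)
  by_cases hx : R < ‖x‖
  · simp [hR x hx]
  · rw [Set.indicator_of_mem (by simpa using hx)]
    exact (hM x).trans (le_abs_self M)

theorem volume_eq_sum_map :
    (volume : Measure (Space d)) = Measure.sum fun k : Fin d → ℤ =>
      Measure.map (fun y => y - intPoint k) (cubeMeasure d) := by
  ext s hs
  rw [Measure.sum_apply _ hs, ← lintegral_indicator_one hs, lintegral_eq_tsum_unitCube,
    ← (Equiv.neg (Fin d → ℤ)).tsum_eq]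
  refine tsum_congr fun k => ?_
  rw [← lintegral_indicator_one hs, lintegral_map (measurable_one.indicator hs) (by fun_prop)]
  simp [intPoint_neg, sub_eq_add_neg]

theorem integral_tsum_cube {f : Space d → ℂ} (hf : Integrable f) :
    ∫ y, ∑' k : Fin d → ℤ, f (y - intPoint k) ∂(cubeMeasure d) = ∫ y, f y := by
  rw [integral_tsum (μ := cubeMeasure d)
    (fun k => (aestronglyMeasurable_sub hf.1 (intPoint k)).restrict)]
  · have hf' := hf
    rw [volume_eq_sum_map] at hf'
    have h := hasSum_integral_measure hf'
    rw [← volume_eq_sum_map] at h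
    rw [← h.tsum_eq]
    refine tsum_congr fun k => ?_
    have he : MeasurableEmbedding fun y : Space d => y - intPoint k :=
      (MeasurableEquiv.subRight (intPoint k)).measurableEmbedding
    rw [he.integral_map]
  · have h := hf.2.ne
    rw [lintegral_eq_tsum_unitCube, ← (Equiv.neg (Fin d → ℤ)).tsum_eq] at h
    simpa [intPoint_neg, sub_eq_add_neg] using h

/-- The periodization `∑_k κ(x - k)`. -/
def periodize (κ : Space d → ℂ) (x : Space d) : ℂ := ∑' k : Fin d → ℤ, κ (x - intPoint k)

theorem norm_periodize_le {κ : Space d → ℂ} {C : ℝ} (hC0 : 0 ≤ C)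
    (hC : ∀ x, perSum κ x ≤ ENNReal.ofReal C) (x : Space d) : ‖periodize κ x‖ ≤ C := by
  have h : ‖periodize κ x‖ₑ ≤ ENNReal.ofReal C := enorm_tsum_le_tsum_enorm.trans (hC x)
  rwa [← ofReal_norm, ENNReal.ofReal_le_ofReal_iff hC0] at h

theorem summable_norm_perSum {κ : Space d → ℂ} {C : ℝ}
    (hC : ∀ x, perSum κ x ≤ ENNReal.ofReal C) (x : Space d) :
    Summable fun k => ‖κ (x - intPoint k)‖ :=
  summable_norm_of_tsum_enorm_lt_top ((hC x).trans_lt ENNReal.ofReal_lt_top)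

theorem aestronglyMeasurable_periodize {κ : Space d → ℂ} (hm : AEStronglyMeasurable κ volume)
    {C : ℝ} (hC : ∀ x, perSum κ x ≤ ENNReal.ofReal C) :
    AEStronglyMeasurable (periodize κ) volume :=
  aestronglyMeasurable_of_tendsto_ae atTop
    (f := fun (S : Finset (Fin d → ℤ)) x => ∑ k ∈ S, κ (x - intPoint k))
    (fun S => Finset.aestronglyMeasurable_fun_sum S fun _ _ => aestronglyMeasurable_sub hm _)
    (Eventually.of_forall fun x => (summable_norm_perSum hC x).of_norm.hasSum)

/-- Unfolding applied to the shifted kernel `κ(x + ·)`: the mean of the periodization over any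
translated cube is the full integral. -/
theorem integral_periodize_add {κ : Space d → ℂ} (hκ : Integrable κ) (x : Space d) :
    ∫ y, periodize κ (x + y) ∂(cubeMeasure d) = ∫ y, κ y := by
  have h := integral_tsum_cube (hκ.comp_add_left x)
  rw [integral_add_left_eq_self] at h
  rw [← h]
  simp only [periodize, add_sub_assoc]

variable [Fact (1 ≤ p)] [hp : Fact (p ≠ ⊤)]

/-- Cut `η` off to the set where both `‖x‖` and `‖η x‖` are at most `n`. Dominated convergence is
used twice: for the lattice sum at almost every point, then for its `p`-th power over the cube. -/
theorem exists_truncation {η : Space d → ℂ} (hη : AEStronglyMeasurable η volume)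
    (hN : perNorm p η < ⊤) {ε : ℝ≥0∞} (hε : 0 < ε) :
    ∃ (η' : Space d → ℂ) (M R : ℝ), AEStronglyMeasurable η' volume ∧ (∀ x, ‖η' x‖ ≤ M) ∧
      (∀ x, R < ‖x‖ → η' x = 0) ∧ perNorm p (fun x => η x - η' x) ≤ ε := by
  set A : ℕ → Set (Space d) := fun n => {x | ‖x‖ ≤ n ∧ ‖η x‖ ≤ n} with hA
  have hAm : ∀ n, NullMeasurableSet (A n) volume := fun n =>
    (nullMeasurableSet_le continuous_norm.aemeasurable aemeasurable_const).inter
      (nullMeasurableSet_le hη.norm.aemeasurable aemeasurable_const)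
  have hm : ∀ n, AEStronglyMeasurable ((A n).indicator η) volume := fun n =>
    hη.indicator₀ (hAm n)
  have hle : ∀ n x, ‖η x - (A n).indicator η x‖ₑ ≤ ‖η x‖ₑ := by
    intro n x
    by_cases hx : x ∈ A n <;> simp [hx]
  have hev : ∀ x, ∀ᶠ n in atTop, η x - (A n).indicator η x = 0 := by
    intro x
    obtain ⟨n₀, hn₀⟩ := exists_nat_ge (max ‖x‖ ‖η x‖)
    filter_upwards [eventually_ge_atTop n₀] with n hn
    have h1 : (n₀ : ℝ) ≤ n := by exact_mod_cast hn
    have : x ∈ A n := ⟨((le_max_left _ _).trans hn₀).trans h1,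
      ((le_max_right _ _).trans hn₀).trans h1⟩
    simp [this]
  have hq := toReal_pos (p := p)
  have hfin : ∫⁻ x, perSum η x ^ p.toReal ∂(cubeMeasure d) < ⊤ := by
    have := hN
    rw [perNorm, eLpNorm_eq_lintegral_rpow_enorm_toReal ne_zero_of_one_le hp.out,
      ENNReal.rpow_lt_top_iff_of_pos (by positivity)] at this
    simpa only [enorm_eq_self] using this
  have hlim : Tendsto (fun n => ∫⁻ x, perSum (fun x => η x - (A n).indicator η x) x ^ p.toReal
      ∂(cubeMeasure d)) atTop (𝓝 0) := by
    have h0 : ∫⁻ _, (0 : ℝ≥0∞) ∂(cubeMeasure d) = 0 := lintegral_zero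
    rw [← h0]
    refine tendsto_lintegral_of_dominated_convergence' _
      (fun n => ((aemeasurable_perSum (hη.sub (hm n))).restrict).pow_const _)
      (fun n => Eventually.of_forall fun x => ENNReal.rpow_le_rpow
        (ENNReal.tsum_le_tsum fun k => hle n _) hq.le) hfin.ne ?_
    have hae := ae_lt_top' ((aemeasurable_perSum hη).restrict.pow_const p.toReal) hfin.ne
    filter_upwards [hae] with x hx
    rw [ENNReal.rpow_lt_top_iff_of_pos hq] at hx
    have h1 : Tendsto (fun n => perSum (fun x => η x - (A n).indicator η x) x) atTop (𝓝 0) := by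
      simp only [perSum, ← lintegral_count]
      have h2 : ∫⁻ _, (0 : ℝ≥0∞) ∂(Measure.count : Measure (Fin d → ℤ)) = 0 := lintegral_zero
      rw [← h2]
      refine tendsto_lintegral_of_dominated_convergence
        (fun k : Fin d → ℤ => ‖η (x - intPoint k)‖ₑ) (fun n => measurable_of_countable _)
        (fun n => Eventually.of_forall fun k => hle n _) ?_
        (Eventually.of_forall fun k => ?_)
      · rw [lintegral_count]
        exact hx.ne
      · refine tendsto_const_nhds.congr' ?_
        filter_upwards [hev (x - intPoint k)] with n hn
        rw [hn, enorm_zero]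
    have h3 := h1.ennrpow_const p.toReal
    rwa [ENNReal.zero_rpow_of_pos hq] at h3
  have hεq : 0 < ε ^ p.toReal := ENNReal.rpow_pos_of_nonneg hε hq.le
  obtain ⟨n, hn⟩ := (hlim.eventually (ge_mem_nhds hεq)).exists
  refine ⟨(A n).indicator η, n, n, hm n, fun x => ?_, fun x hx => ?_, ?_⟩
  · by_cases hx : x ∈ A n
    · rw [Set.indicator_of_mem hx]
      exact hx.2
    · simp [hx]
  · exact Set.indicator_of_notMem (fun h => hx.not_ge h.1) _
  · rw [perNorm, eLpNorm_eq_lintegral_rpow_enorm_toReal ne_zero_of_one_le hp.out]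
    simp only [enorm_eq_self]
    rw [← ENNReal.rpow_le_rpow_iff (z := p.toReal) hq, ← ENNReal.rpow_mul,
      one_div_mul_cancel hq.ne', ENNReal.rpow_one]
    exact hn

/-- Averaging over a probability measure of bounded support preserves the sup bound, boundedness of
the support and the integral. The averages produced by differentiation can therefore be absorbed
into the kernel. -/
theorem exists_smoothed_kernel {η : Space d → ℂ} (hη : AEStronglyMeasurable η volume) {M R : ℝ}
    (hM : ∀ x, ‖η x‖ ≤ M) (hR : ∀ x, R < ‖x‖ → η x = 0) (μ : Measure (Space d))
    [IsProbabilityMeasure μ] (hμ : BddSupp μ) :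
    ∃ (κ : Space d → ℂ) (R' : ℝ), AEStronglyMeasurable κ volume ∧ (∀ x, ‖κ x‖ ≤ M) ∧
      (∀ x, R' < ‖x‖ → κ x = 0) ∧ ∫ x, κ x = ∫ x, η x ∧
      ∀ (h : MemLp η p volume) (h' : MemLp κ p volume),
        transAvg μ (h.toLp η) = h'.toLp κ := by
  obtain ⟨r, hr⟩ := hμ
  have h1 : MemLp η 1 volume := memLp_of_bdd hη hM hR
  have e1 := ae_eq_transAvg h1 μ
  refine ⟨fun x => ∫ y, η (x - y) ∂μ, R + r, ?_, fun x => ?_, fun x hx => ?_, ?_, fun h h' => ?_⟩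
  · exact (Lp.aestronglyMeasurable _).congr e1.symm
  · refine (norm_integral_le_of_norm_le_const (Eventually.of_forall fun y => hM _)).trans ?_
    simp
  · refine integral_eq_zero_of_ae ?_
    filter_upwards [hr] with y hy
    refine hR _ ?_
    have := norm_sub_norm_le x y
    linarith
  · rw [integral_congr_ae e1]
    have h2 := integral_transAvg_mul μ (h1.toLp η) (g := fun _ => 1) aestronglyMeasurable_const
      (G := 1) (by simp) (M := 1) (by simp)
    simp only [mul_one, one_mul] at h2
    rw [h2, integral_congr_ae h1.coeFn_toLp]
  · exact Lp.ext ((ae_eq_transAvg h μ).symm.trans h'.coeFn_toLp.symm)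

/-- Up to normalization the coefficient at `k` is the mean of `v` over `a⁻¹ (k + [0,1)^d)`. If `κ(a
x - k) ≠ 0`, this set lies within `(R + √d)/|a|` of `x`, so replacing the coefficient by `v x` costs
at most `θ`. Summing over `k` leaves `v x` times the periodized kernel. -/
theorem eLpNorm_dilate_latticeSum_sub_le {κ : Space d → ℂ}
    {R C : ℝ} (hR : ∀ x, R < ‖x‖ → κ x = 0) (hR0 : 0 ≤ R) (hC0 : 0 ≤ C)
    (hC : ∀ x, perSum κ x ≤ ENNReal.ofReal C)
    {F : lp (fun _ : Fin d → ℤ => ℂ) p →L[ℂ] LpC d p} (hF : IsLatticeSum κ F)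
    {v : Space d → ℂ} (hv : Continuous v) {r : ℝ} (hr : ∀ x, r < ‖x‖ → v x = 0)
    (hvp : MemLp v p volume) {a : ℝˣ} (ha : 1 ≤ |(a : ℝ)|) {θ : ℝ} (hθ : 0 ≤ θ)
    (hvθ : ∀ x y, ‖x - y‖ ≤ (R + √d) / |(a : ℝ)| → ‖v x - v y‖ ≤ θ) :
    eLpNorm (fun x => dilate a (F (sample (dilate a⁻¹ (hvp.toLp v)))) x
        - v x * periodize κ ((a : ℝ) • x)) p volume
      ≤ ENNReal.ofReal (θ * C)
        * volume (Metric.closedBall (0 : Space d) (r + (R + √d))) ^ (1 / p.toReal) := by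
  set B := Metric.closedBall (0 : Space d) (r + (R + √d)) with hB
  set s := sample (dilate a⁻¹ (hvp.toLp v)) with hs
  have ha0 : 0 < |(a : ℝ)| := by linarith
  set w : (Fin d → ℤ) → ℂ := fun k => ∫ y, v ((a : ℝ)⁻¹ • (y + intPoint k)) ∂(cubeMeasure d)
    with hw
  have hsw : ∀ k, (dilFactor d p a : ℂ) * s k = w k := by
    intro k
    have e : (dilate a⁻¹ (hvp.toLp v) : LpC d p) =ᵐ[volume]
        fun x => ((dilFactor d p a : ℂ))⁻¹ * v ((a : ℝ)⁻¹ • x) := by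
      filter_upwards [coeFn_dilate a⁻¹ (hvp.toLp v),
        ae_linearEquiv hvp.coeFn_toLp (scaleEquiv a⁻¹)] with x h1 h2
      rw [scaleEquiv_apply] at h2
      rw [h1, h2, dilFactor_inv, Complex.ofReal_inv, Units.val_inv_eq_inv_val]
    rw [hs, coe_sample, sampleFun_congr_ae e, sampleFun, integral_const_mul,
      mul_inv_cancel_left₀ (by exact_mod_cast (dilFactor_pos a).ne')]
  have hterm : ∀ x k, ‖(w k - v x) * κ ((a : ℝ) • x - intPoint k)‖ₑ
      ≤ B.indicator (fun _ => ENNReal.ofReal θ) x * ‖κ ((a : ℝ) • x - intPoint k)‖ₑ := by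
    intro x k
    by_cases hk : R < ‖(a : ℝ) • x - intPoint k‖
    · rw [hR _ hk, mul_zero, enorm_zero]
      exact zero_le
    have hclose : ∀ y ∈ unitCube d, ‖(a : ℝ)⁻¹ • (y + intPoint k) - x‖ ≤ (R + √d) / |(a : ℝ)| := by
      intro y hy
      have e : (a : ℝ)⁻¹ • (y + intPoint k) - x
          = (a : ℝ)⁻¹ • (y - ((a : ℝ) • x - intPoint k)) := by
        rw [smul_sub, smul_sub, smul_add, inv_smul_smul₀ a.ne_zero]
        abel
      rw [e, norm_smul, norm_inv, Real.norm_eq_abs, div_eq_inv_mul]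
      refine mul_le_mul_of_nonneg_left ((norm_sub_le _ _).trans ?_) (by positivity)
      linarith [norm_le_of_mem_unitCube hy, not_lt.mp hk]
    have hwx : w k - v x = ∫ y, (v ((a : ℝ)⁻¹ • (y + intPoint k)) - v x) ∂(cubeMeasure d) := by
      rw [integral_sub _ (integrable_const _)]
      · simp [hw]
      · obtain ⟨V, hV⟩ : ∃ V, ∀ x, ‖v x‖ ≤ V := by
          refine hv.bounded_above_of_compact_support (HasCompactSupport.intro
            (isCompact_closedBall (0 : Space d) r) fun x hx => hr x ?_)
          simpa using hx
        exact Integrable.of_bound (C := V) (by fun_prop) (Eventually.of_forall fun y => hV _)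
    rw [enorm_mul]
    refine mul_le_mul_left ?_ _
    by_cases hx : x ∈ B
    · rw [Set.indicator_of_mem hx, ← ofReal_norm, hwx]
      refine ENNReal.ofReal_le_ofReal ?_
      refine (norm_integral_le_of_norm_le_const (C := θ) ?_).trans (by simp)
      filter_upwards [ae_restrict_mem measurableSet_unitCube] with y hy
      exact hvθ _ _ (hclose y hy)
    · have hxr : r + (R + √d) < ‖x‖ := by simpa [hB] using hx
      have hpos : 0 ≤ R + √d := by positivity
      have e : w k - v x = 0 := by
        rw [hwx]
        refine integral_eq_zero_of_ae ?_
        filter_upwards [ae_restrict_mem measurableSet_unitCube] with y hy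
        have h1 := hclose y hy
        -- As `|a| ≥ 1`, for `x` outside `B` both `v x` and all values of `v` entering the mean
        -- vanish, so the error is supported in `B`.
        have h2 : (R + √d) / |(a : ℝ)| ≤ R + √d := div_le_self hpos ha
        have h3 := norm_sub_norm_le x ((a : ℝ)⁻¹ • (y + intPoint k))
        rw [norm_sub_rev] at h3
        rw [hr x (by linarith), hr _ (by linarith)]
        simp
      rw [e, enorm_zero]
      exact zero_le
  have hpt : ∀ᵐ x, ‖dilate a (F s) x - v x * periodize κ ((a : ℝ) • x)‖ₑ
      ≤ ‖B.indicator (fun _ => θ * C) x‖ₑ := by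
    filter_upwards [coeFn_dilate a (F s), ae_linearEquiv (hF s) (scaleEquiv a)] with x h1 h2
    rw [scaleEquiv_apply] at h2
    have h3 : HasSum (fun k => (w k - v x) * κ ((a : ℝ) • x - intPoint k))
        (dilate a (F s) x - v x * periodize κ ((a : ℝ) • x)) := by
      rw [h1]
      have h4 := (h2.2.mul_left (dilFactor d p a : ℂ)).sub
        ((summable_norm_perSum hC ((a : ℝ) • x)).of_norm.hasSum.mul_left (v x))
      refine h4.congr_fun fun k => ?_
      rw [← hsw]
      ring
    rw [← h3.tsum_eq]
    refine enorm_tsum_le_tsum_enorm.trans ((ENNReal.tsum_le_tsum (hterm x)).trans ?_)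
    rw [ENNReal.tsum_mul_left]
    by_cases hx : x ∈ B
    · rw [Set.indicator_of_mem hx, Set.indicator_of_mem hx]
      refine (mul_le_mul_right (hC _) _).trans ?_
      rw [← ENNReal.ofReal_mul hθ]
      exact (Real.ofReal_le_enorm _)
    · rw [Set.indicator_of_notMem hx, zero_mul]
      exact zero_le
  refine (eLpNorm_mono_enorm_ae hpt).trans ?_
  rw [eLpNorm_indicator_const Metric.isClosed_closedBall.measurableSet ne_zero_of_one_le hp.out,
    Real.enorm_of_nonneg (mul_nonneg hθ hC0)]

end Kernels

/-! ### Sampling followed by synthesis at one large scale. -/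

section Approximation

variable {d : ℕ} {p : ℝ≥0∞} [Fact (1 ≤ p)] [hp : Fact (p ≠ ⊤)]

/-! ### Approximation by sampling and synthesis at a single scale -/

theorem eventually_norm_dilate_latticeSum_sub_le {J : Type*} {l : Filter J} {a : J → ℝˣ}
    (ha : Tendsto (fun j => |(a j : ℝ)|) l atTop) {κ : Space d → ℂ}
    {M R : ℝ} (hM : ∀ x, ‖κ x‖ ≤ M) (hR : ∀ x, R < ‖x‖ → κ x = 0)
    {F : lp (fun _ : Fin d → ℤ => ℂ) p →L[ℂ] LpC d p} (hF : IsLatticeSum κ F)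
    {v : Space d → ℂ} (hv : Continuous v) (hc : HasCompactSupport v)
    (hvp : MemLp v p volume) {δ : ℝ} (hδ : 0 < δ) :
    ∀ᶠ j in l, eLpNorm (fun x => dilate (a j) (F (sample (dilate (a j)⁻¹ (hvp.toLp v)))) x
      - v x * periodize κ ((a j : ℝ) • x)) p volume ≤ ENNReal.ofReal δ := by
  obtain ⟨C, hC0, hC⟩ := exists_perSum_le hM hR
  obtain ⟨r, hr⟩ := hc.isCompact.isBounded.exists_norm_le
  have hr' : ∀ x, r < ‖x‖ → v x = 0 := fun x hx =>
    image_eq_zero_of_notMem_tsupport fun h => hx.not_ge (hr x h)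
  have hR' : ∀ x, max R 0 < ‖x‖ → κ x = 0 := fun x hx => hR x ((le_max_left _ _).trans_lt hx)
  set L : ℝ := max R 0 + √d with hL
  have hL0 : 0 ≤ L := by positivity
  set D : ℝ≥0∞ := volume (Metric.closedBall (0 : Space d) (r + L)) ^ (1 / p.toReal) with hD
  have hDt : D ≠ ⊤ := ENNReal.rpow_ne_top_of_nonneg (by positivity) measure_closedBall_lt_top.ne
  -- Chosen so that `θ C D ≤ δ`; the `+ 1` avoids division by zero.
  set θ : ℝ := δ / (C * D.toReal + 1) with hθ
  have hpos : 0 < C * D.toReal + 1 := by positivity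
  have hθ0 : 0 < θ := div_pos hδ hpos
  obtain ⟨τ, hτ, hvτ⟩ := Metric.uniformContinuous_iff.mp
    (hc.uniformContinuous_of_continuous hv) θ hθ0
  filter_upwards [ha.eventually_ge_atTop 1, ha.eventually_gt_atTop (L / τ)] with j h1 h2
  refine (eLpNorm_dilate_latticeSum_sub_le hR' (le_max_right _ _) hC0 hC hF hv hr' hvp h1 hθ0.le
    fun x y hxy => ?_).trans ?_
  · have h3 : L / |(a j : ℝ)| < τ := by
      rw [div_lt_iff₀ (by linarith)]
      rwa [div_lt_iff₀ hτ, mul_comm] at h2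
    rw [← dist_eq_norm] at hxy ⊢
    exact (hvτ (hxy.trans_lt h3)).le
  · rw [← hL, ← hD, ← ENNReal.ofReal_toReal hDt, ← ENNReal.ofReal_mul (by positivity)]
    refine ENNReal.ofReal_le_ofReal ?_
    rw [hθ, mul_assoc, div_mul_eq_mul_div, div_le_iff₀ hpos]
    nlinarith

/-- Sampling and synthesis at the scale `a_j` is multiplication with `1 + g(a_j ·) - M`, up to a
small error, where `g` is bounded and periodic with mean `M`. -/
theorem exists_approx_dilated {J : Type*} {l : Filter J} [l.IsCountablyGenerated] {a : J → ℝˣ}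
    (ha : Tendsto (fun j => |(a j : ℝ)|) l atTop) {η : Space d → ℂ}
    (hη : MemLp η p volume) (hN : perNorm p η < ⊤) (hint : ∫ x, η x = 1)
    {F : lp (fun _ : Fin d → ℤ => ℂ) p →L[ℂ] LpC d p} (hF : IsLatticeSum η F)
    (μ ν : Measure (Space d)) [IsProbabilityMeasure μ] [IsProbabilityMeasure ν] (hμ : BddSupp μ)
    (u : LpC d p) {δ : ℝ} (hδ : 0 < δ) :
    ∃ (v g : Space d → ℂ) (G : ℝ) (M : ℂ), Continuous v ∧ HasCompactSupport v ∧
      AEStronglyMeasurable g volume ∧ (∀ x, ‖g x‖ ≤ G) ∧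
      (∀ x, ∫ y, g (x + y) ∂(cubeMeasure d) = M) ∧
      ∀ᶠ j in l, eLpNorm (fun x =>
        (dilate (a j) (transAvg μ (F (sample (transAvg ν (dilate (a j)⁻¹ u))))) - u : LpC d p) x
          - v x * (g ((a j : ℝ) • x) - M)) p volume ≤ ENNReal.ofReal δ := by
  set N : ℝ := (perNorm p η).toReal with hNd
  have hN0 : 0 ≤ N := ENNReal.toReal_nonneg
  -- Five errors are added below: two of size `N δ₁`, at most `δ₁ (‖u‖ + δ₁)` and `δ₁ (‖u‖ + δ₁) +
  -- δ₁`, and one of size `δ₁`. With `δ₁ ≤ 1` they sum to at most `δ`.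
  set δ₁ : ℝ := min 1 (δ / (2 * N + 2 * ‖u‖ + 6)) with hδ₁
  have hpos : 0 < 2 * N + 2 * ‖u‖ + 6 := by positivity
  have hδ₁0 : 0 < δ₁ := lt_min one_pos (div_pos hδ hpos)
  have hδ₁1 : δ₁ ≤ 1 := min_le_left _ _
  have hδ₁δ : δ₁ * (2 * N + 2 * ‖u‖ + 6) ≤ δ := by
    rw [← le_div_iff₀ hpos]
    exact min_le_right _ _
  have hle : ∀ {η : Space d → ℂ} {F : lp (fun _ : Fin d → ℤ => ℂ) p →L[ℂ] LpC d p}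
      (_ : AEStronglyMeasurable η volume) (_ : perNorm p η < ⊤) (_ : IsLatticeSum η F) (f : LpC d p),
      ‖F (sample f)‖ ≤ (perNorm p η).toReal * ‖f‖ := by
    intro η F hη hN hF f
    have h := hF.enorm_le hη (sample f)
    have h2 := ENNReal.toReal_mono (ENNReal.mul_lt_top enorm_lt_top hN).ne h
    rw [toReal_enorm, ENNReal.toReal_mul, toReal_enorm, mul_comm] at h2
    exact h2.trans (mul_le_mul_of_nonneg_left (norm_sample_le f) ENNReal.toReal_nonneg)
  obtain ⟨η', M', R', hm', hM', hR', hηη'⟩ := exists_truncation hη.1 hN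
    (ENNReal.ofReal_pos.mpr hδ₁0)
  have hη' : MemLp η' p volume := memLp_of_bdd hm' hM' hR'
  have hdm : AEStronglyMeasurable (fun x => η x - η' x) volume := hη.1.sub hm'
  have hdN : perNorm p (fun x => η x - η' x) < ⊤ := hηη'.trans_lt ENNReal.ofReal_lt_top
  obtain ⟨F', hF'⟩ := exists_isLatticeSum (p := p) hm' (perNorm_lt_top_of_bdd hM' hR')
  obtain ⟨κ, R, hκm, hκM, hκR, hκi, hκ⟩ := exists_smoothed_kernel (p := p) hm' hM' hR' μ hμ
  have hκp : MemLp κ p volume := memLp_of_bdd hκm hκM hκR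
  have hκ1 : Integrable κ := memLp_one_iff_integrable.mp (memLp_of_bdd hκm hκM hκR)
  obtain ⟨H, hH⟩ := exists_isLatticeSum (p := p) hκm (perNorm_lt_top_of_bdd hκM hκR)
  obtain ⟨C, hC0, hC⟩ := exists_perSum_le hκM hκR
  obtain ⟨v, hvc, hvu, hv, hvp⟩ := (Lp.memLp u).exists_hasCompactSupport_eLpNorm_sub_le hp.out
    (ENNReal.ofReal_pos.mpr hδ₁0).ne'
  set V : LpC d p := hvp.toLp v with hV
  have huV : ‖u - V‖ ≤ δ₁ := by
    have e : u - V = ((Lp.memLp u).sub hvp).toLp _ := by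
      rw [MemLp.toLp_sub (Lp.memLp u) hvp, Lp.toLp_coeFn u (Lp.memLp u)]
    rw [e, Lp.norm_toLp]
    exact ENNReal.toReal_le_of_le_ofReal hδ₁0.le hvu
  have hVn : ‖V‖ ≤ ‖u‖ + δ₁ := by
    have := norm_sub_norm_le V u
    rw [norm_sub_rev] at this
    linarith
  set M : ℂ := ∫ x, κ x with hMd
  -- Smoothing keeps the integral, and truncation changes it by at most the periodized norm of `η -
  -- η'`. This is where `∫ η = 1` enters.
  have hM1 : ‖M - 1‖ ≤ δ₁ := by
    have hi : Integrable η := ⟨hη.1, by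
      rw [hasFiniteIntegral_iff_enorm]
      exact (lintegral_enorm_le_perNorm hη.1).trans_lt hN⟩
    have hi' : Integrable η' := memLp_one_iff_integrable.mp (memLp_of_bdd hm' hM' hR')
    have h1 : ‖∫ x, (η x - η' x)‖ₑ ≤ ENNReal.ofReal δ₁ :=
      (enorm_integral_le_lintegral_enorm _).trans ((lintegral_enorm_le_perNorm hdm).trans hηη')
    rw [← ofReal_norm, ENNReal.ofReal_le_ofReal_iff hδ₁0.le, integral_sub hi hi', hint,
      ← hκi] at h1
    rwa [norm_sub_rev]
  refine ⟨v, periodize κ, C, M, hv, hvc, aestronglyMeasurable_periodize hκm hC,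
    norm_periodize_le hC0 hC, integral_periodize_add hκ1, ?_⟩
  have hlim := (tendsto_dilate_transAvg (μ := ν) ha u).sub_const u
  rw [sub_self] at hlim
  have hlim' := hlim.norm
  rw [norm_zero] at hlim'
  filter_upwards [eventually_norm_dilate_latticeSum_sub_le ha hκM hκR hH hv hvc hvp hδ₁0,
    hlim'.eventually (ge_mem_nhds hδ₁0)] with j h1 h2
  set b := a j
  set f₁ := dilate b⁻¹ u with hf₁
  -- The errors, one change at a time: `P` drops the average over `ν`, `Q` replaces `u` by `V`, `Y`
  -- truncates the kernel, and `W` compares `M • V` with `u`. The oscillating main term is `Z - M •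
  -- V`.
  set P : LpC d p := dilate b (transAvg μ (F (sample (transAvg ν f₁ - f₁)))) with hP
  set Q : LpC d p := dilate b (transAvg μ (F (sample (dilate b⁻¹ (u - V))))) with hQ
  set Y : LpC d p := dilate b (transAvg μ ((F - F') (sample (dilate b⁻¹ V)))) with hY
  set Z : LpC d p := dilate b (H (sample (dilate b⁻¹ V))) with hZ
  set W : LpC d p := (M • V - u) with hW
  have hdec : dilate b (transAvg μ (F (sample (transAvg ν f₁)))) - u
      = (P + Q + Y + W) + (Z - M • V) := by
    have hFH : H (sample (dilate b⁻¹ V)) = transAvg μ (F' (sample (dilate b⁻¹ V))) :=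
      (hF'.transAvg hH hη' hκp μ (hκ hη' hκp) _).symm
    rw [hP, hQ, hY, hZ, hW, hFH, hf₁]
    simp only [map_sub, sub_apply]
    abel
  have hPn : ‖P‖ ≤ N * δ₁ := by
    rw [hP, norm_dilate]
    refine (norm_transAvg_le μ _).trans ((hle hη.1 hN hF _).trans
      (mul_le_mul_of_nonneg_left (le_trans (le_of_eq ?_) h2) hN0))
    rw [← norm_dilate b, map_sub, hf₁, dilate_dilate_inv]
  have hQn : ‖Q‖ ≤ N * δ₁ := by
    rw [hQ, norm_dilate]
    refine (norm_transAvg_le μ _).trans ((hle hη.1 hN hF _).trans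
      (mul_le_mul_of_nonneg_left ?_ hN0))
    rwa [norm_dilate]
  have hYn : ‖Y‖ ≤ δ₁ * (‖u‖ + δ₁) := by
    rw [hY, norm_dilate]
    refine (norm_transAvg_le μ _).trans ((hle hdm hdN (hF.sub hF') _).trans ?_)
    rw [norm_dilate]
    exact mul_le_mul (ENNReal.toReal_le_of_le_ofReal hδ₁0.le hηη') hVn (norm_nonneg _) hδ₁0.le
  have hWn : ‖W‖ ≤ δ₁ * (‖u‖ + δ₁) + δ₁ := by
    have e : W = (M - 1) • V + (V - u) := by
      rw [hW, sub_smul, one_smul]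
      abel
    rw [e]
    refine (norm_add_le _ _).trans (add_le_add ?_ (by rwa [norm_sub_rev]))
    rw [norm_smul]
    exact mul_le_mul hM1 hVn (norm_nonneg _) hδ₁0.le
  have hae : (fun x => (dilate b (transAvg μ (F (sample (transAvg ν f₁)))) - u : LpC d p) x
      - v x * (periodize κ ((b : ℝ) • x) - M))
      =ᵐ[volume] (P + Q + Y + W : LpC d p)
        + fun x => Z x - v x * periodize κ ((b : ℝ) • x) := by
    rw [hdec]
    filter_upwards [Lp.coeFn_add (P + Q + Y + W) (Z - M • V), Lp.coeFn_sub Z (M • V),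
      Lp.coeFn_smul M V, hvp.coeFn_toLp] with x h3 h4 h5 h6
    rw [h3, Pi.add_apply, h4, Pi.sub_apply, h5, Pi.smul_apply, hV, h6, smul_eq_mul, Pi.add_apply]
    ring
  have hmeas : AEStronglyMeasurable (fun x => Z x - v x * periodize κ ((b : ℝ) • x)) volume :=
    (Lp.aestronglyMeasurable _).sub (hv.aestronglyMeasurable.mul
      (aestronglyMeasurable_comp_smul (aestronglyMeasurable_periodize hκm hC) b))
  rw [eLpNorm_congr_ae hae]
  refine (eLpNorm_add_le (Lp.aestronglyMeasurable _) hmeas Fact.out).trans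
    ((add_le_add_right h1 _).trans ?_)
  rw [← Lp.enorm_def, ← ofReal_norm, ← ENNReal.ofReal_add (norm_nonneg _) hδ₁0.le]
  refine ENNReal.ofReal_le_ofReal (le_trans ?_ hδ₁δ)
  have h3 : ‖P + Q + Y + W‖ ≤ ‖P‖ + ‖Q‖ + ‖Y‖ + ‖W‖ := norm_add₄_le
  nlinarith [norm_nonneg u]

end Approximation

/-! ### Approximation by convex combinations of scales. -/

section Synthesis

variable {d : ℕ} {p : ℝ≥0∞} [Fact (1 ≤ p)] [hp : Fact (p ≠ ⊤)] {m : ℕ}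

/-! ### Approximate and exact right inverses of the synthesis operator -/

/-- Apply `exists_multiDiff_sample` to the derivatives of the dilated function; each derivative of
`f(a⁻¹ ·)` brings out a factor `a⁻¹`. -/
theorem exists_multiDiffLp_sample {ρ : Fin d → ℕ} (hρ : ρ ∈ multiIndices d m) :
    ∃ (ν : Measure (Space d)) (_ : IsProbabilityMeasure ν), ∀ (f : Sobolev d p m) (a : ℝˣ),
      multiDiffLp ρ (sample (dilate a⁻¹ (Sobolev.toLp f)))
        = (((a : ℝ) : ℂ) ^ (∑ i, ρ i))⁻¹ •
          sample (transAvg ν (dilate a⁻¹ (weakDeriv ρ (Sobolev.toLp f)))) := by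
  obtain ⟨ν, hν, h⟩ := exists_multiDiff_sample (p := p) ρ
  refine ⟨ν, hν, fun f a => ?_⟩
  have h1 := h (fun σ => (((a⁻¹ : ℝˣ) : ℝ) : ℂ) ^ (∑ i, σ i) •
    dilate a⁻¹ (weakDeriv σ (Sobolev.toLp f))) fun σ t hσ => by
      have hσm : σ ∈ multiIndices d m := by
        rw [mem_multiIndices] at hρ ⊢
        omega
      have hσm' : σ + Pi.single t 1 ∈ multiIndices d m := by
        rw [mem_multiIndices] at hρ ⊢
        rw [sum_add_single]
        omega
      have h2 := (((Sobolev.isWeakDeriv f hσm).of_comp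
        (Sobolev.isWeakDeriv f hσm')).dilate a⁻¹).smul ((((a⁻¹ : ℝˣ) : ℝ) : ℂ) ^ (∑ i, σ i))
      rw [smul_smul, ← pow_add, sum_single] at h2
      rwa [sum_add_single]
  have h0 : weakDeriv 0 (Sobolev.toLp f) = Sobolev.toLp f :=
    (isWeakDeriv_zero_index _).weakDeriv_eq
  ext1
  rw [coe_multiDiffLp]
  simp only [Pi.zero_apply, Finset.sum_const_zero, pow_zero, one_smul, h0] at h1
  rw [h1, map_smul, map_smul, Units.val_inv_eq_inv_val, Complex.ofReal_inv, inv_pow]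

/-- The weight `|a|^{|ρ|}` cancels the factor from the dilated derivative, and sampling, averaging
and dilation do not increase norms. This is the source of the constant one in the final estimate. -/
theorem scaleNorm_sample_le (f : Sobolev d p m) (a : ℝˣ) :
    scaleNorm m (a : ℝ) (sample (dilate a⁻¹ (Sobolev.toLp f))) ≤ ‖f‖ := by
  rw [scaleNorm, Sobolev.norm_def]
  refine Finset.sum_le_sum fun ρ hρ => ?_
  obtain ⟨ν, hν, h⟩ := exists_multiDiffLp_sample (p := p) hρ
  rw [h, norm_smul, norm_inv, norm_pow, Complex.norm_real, Real.norm_eq_abs,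
    mul_inv_cancel_left₀ (pow_ne_zero _ (abs_ne_zero.mpr a.ne_zero))]
  refine (norm_sample_le _).trans ((norm_transAvg_le ν _).trans ?_)
  rw [norm_dilate]

namespace WeightedSeq

variable {α : ℕ+ → ℝ}

/-- The sequence with a single nonzero scale. -/
theorem exists_single (j : ℕ+) (s : lp (fun _ : Fin d → ℤ => ℂ) p) :
    ∃ c : WeightedSeq d p m α, ‖c‖ = scaleNorm m (α j) s ∧ level j c = s ∧
      ∀ i, i ≠ j → level i c = 0 := by
  classical
  have h0 : ∀ a : ℝ, scaleNorm m a (0 : lp (fun _ : Fin d → ℤ => ℂ) p) = 0 := fun a => by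
    simp [scaleNorm]
  obtain ⟨c, hc⟩ := exists_of_levels (m := m) (α := α) (Pi.single j s)
    (summable_of_ne_finset_zero (s := {j}) fun i hi => by
      rw [Pi.single_eq_of_ne (by simpa using hi), h0])
  have hj : level j c = s := by rw [hc, Pi.single_eq_same]
  have hi : ∀ i, i ≠ j → level i c = 0 := fun i hi => by rw [hc, Pi.single_eq_of_ne hi]
  refine ⟨c, ?_, hj, hi⟩
  have h := hasSum_single j (f := fun i => scaleNorm m (α i) (level i c)) fun i hij => by
    rw [hi i hij, h0]
  rw [hj] at h
  exact (hasSum_scaleNorm c).unique h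

end WeightedSeq

-- At each scale, synthesizing the samples of `f` reproduces every `D^ρ f` up to an oscillating term
-- and a small error. A convex combination over scales, with the same weights for all `ρ`, removes
-- the oscillation while keeping the coefficient norm at most `‖f‖`.
open WeightedSeq in
theorem exists_approx_synthesis {α : ℕ+ → ℝ} {a : ℕ+ → ℝˣ} (haα : ∀ j, (a j : ℝ) = α j)
    (ha : Tendsto (fun j => |(a j : ℝ)|) atTop atTop) {η : Space d → ℂ}
    (hη : MemLp η p volume) (hN : perNorm p η < ⊤) (hint : ∫ x, η x = 1)
    {F : lp (fun _ : Fin d → ℤ => ℂ) p →L[ℂ] LpC d p} (hF : IsLatticeSum η F)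
    {G : ℕ+ → lp (fun _ : Fin d → ℤ => ℂ) p →ₗ[ℂ] Sobolev d p m}
    (hG : ∀ j s, Sobolev.toLp (G j s) = dilate (a j) ((transAvg (cubeMeasure d))^[m] (F s)))
    {S : WeightedSeq d p m α →L[ℂ] Sobolev d p m}
    (hS : ∀ c, HasSum (fun j => G j (level j c)) (S c)) (f : Sobolev d p m) {δ : ℝ} (hδ : 0 < δ) :
    ∃ c, ‖f - S c‖ ≤ δ ∧ ‖c‖ ≤ ‖f‖ + δ := by
  set s : ℕ+ → lp (fun _ : Fin d → ℤ => ℂ) p := fun j => sample (dilate (a j)⁻¹ (Sobolev.toLp f))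
    with hs
  have hcard : 0 < ((multiIndices d m).card : ℝ) := by
    exact_mod_cast Finset.card_pos.mpr ⟨0, zero_mem_multiIndices d m⟩
  -- Each multi-index contributes at most `2 δ'`: once for the approximation error, once for the
  -- combined oscillations.
  set δ' : ℝ := δ / (2 * (multiIndices d m).card) with hδ'
  have hδ'0 : 0 < δ' := by positivity
  have hex : ∀ ρ : multiIndices d m, ∃ (R : ℕ+ → LpC d p) (v g : Space d → ℂ) (C : ℝ) (M : ℂ),
      (∀ j, IsWeakDeriv ρ (Sobolev.toLp (G j (s j))) (R j)) ∧
      Continuous v ∧ HasCompactSupport v ∧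
      AEStronglyMeasurable g volume ∧ (∀ x, ‖g x‖ ≤ C) ∧
      (∀ x, ∫ y, g (x + y) ∂(cubeMeasure d) = M) ∧
      ∀ᶠ j in atTop, eLpNorm (fun x => (R j - weakDeriv ρ (Sobolev.toLp f) : LpC d p) x
          - v x * (g ((a j : ℝ) • x) - M)) p volume ≤ ENNReal.ofReal δ' := by
    rintro ⟨ρ, hρ⟩
    obtain ⟨μ, hμ, hμb, h1⟩ := exists_isWeakDeriv_latticeSum (p := p) hρ
    obtain ⟨ν, hν, h2⟩ := exists_multiDiffLp_sample (p := p) hρ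
    obtain ⟨v, g, C, M, h3⟩ := exists_approx_dilated ha hη hN hint hF μ ν hμb
      (weakDeriv ρ (Sobolev.toLp f)) hδ'0
    refine ⟨_, v, g, C, M, fun j => ?_, h3⟩
    rw [hG]
    have h4 := h1 η F hF (a j) (s j)
    rw [hs] at h4 ⊢
    simp only [h2, map_smul] at h4
    -- The factor `a^{|ρ|}` from differentiating the dilated sum cancels `a^{-|ρ|}` from the sampled
    -- derivatives.
    rwa [smul_inv_smul₀ (pow_ne_zero _ (by exact_mod_cast (a j).ne_zero))] at h4
  choose R v g C M hR hv hc hg hC hM hev using hex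
  -- Only scales at which the approximation error is small for every `ρ` are admitted; finitely many
  -- eventual conditions leave such a set in the filter.
  obtain ⟨K, t, w, z, hw0, hw1, hz, hsm⟩ := exists_small_combination (p := p) ha hv hc hg hC hM
    (eventually_all.mpr hev) (ENNReal.ofReal_pos.mpr hδ'0).ne'
  choose e he he1 he2 using fun j => exists_single (m := m) (α := α) j (s j)
  have hSe : ∀ j, S (e j) = G j (s j) := fun j => by
    refine (hS (e j)).unique ?_
    have := hasSum_single j (f := fun i => G i (level i (e j))) fun i hi => by
      rw [he2 j i hi, map_zero]
    rwa [he1] at this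
  refine ⟨∑ k ∈ t, (w k : ℂ) • e (z k), ?_, ?_⟩
  · rw [Sobolev.norm_def]
    have hterm : ∀ ρ ∈ multiIndices d m, ‖weakDeriv ρ
        (Sobolev.toLp (f - S (∑ k ∈ t, (w k : ℂ) • e (z k))))‖ ≤ δ' + δ' := by
      intro ρ hρ
      set u := weakDeriv ρ (Sobolev.toLp f) with hu
      set W : K → Space d → ℂ := fun k x =>
        v ⟨ρ, hρ⟩ x * (g ⟨ρ, hρ⟩ ((a (z k) : ℝ) • x) - M ⟨ρ, hρ⟩) with hW
      have hWp : ∀ k, MemLp (W k) p volume := fun k =>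
        memLp_mul_dilated ((hv ⟨ρ, hρ⟩).memLp_of_hasCompactSupport (hc ⟨ρ, hρ⟩)) (hg ⟨ρ, hρ⟩)
          (hC ⟨ρ, hρ⟩) (M ⟨ρ, hρ⟩) (a (z k))
      have hd : IsWeakDeriv ρ (Sobolev.toLp (f - S (∑ k ∈ t, (w k : ℂ) • e (z k))))
          (u - ∑ k ∈ t, (w k : ℂ) • R ⟨ρ, hρ⟩ (z k) : LpC d p) := by
        have h5 := (isWeakDeriv_sum t fun k _ => (hR ⟨ρ, hρ⟩ (z k)).smul (w k : ℂ)).smul (-1)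
        have h6 := (Sobolev.isWeakDeriv f hρ).add h5
        rw [neg_one_smul, neg_one_smul, ← sub_eq_add_neg, ← sub_eq_add_neg] at h6
        convert h6 using 2
        simp only [map_sub, map_sum, map_smul, hSe]
      have hWsum : ‖∑ k ∈ t, w k • (hWp k).toLp (W k)‖ ≤ δ' := by
        have h5 : eLpNorm (fun x => ∑ k ∈ t, w k • W k x) p volume ≤ ENNReal.ofReal δ' :=
          hsm ⟨ρ, hρ⟩
        rw [eLpNorm_sum_smul t w hWp, ← ofReal_norm, ENNReal.ofReal_le_ofReal_iff hδ'0.le] at h5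
        exact h5
      have hRW : ∀ k ∈ t, ‖R ⟨ρ, hρ⟩ (z k) - u - (hWp k).toLp (W k)‖ ≤ δ' := by
        intro k hk
        have h5 := hz k hk ⟨ρ, hρ⟩
        have h6 : (R ⟨ρ, hρ⟩ (z k) - u - (hWp k).toLp (W k) : LpC d p) =ᵐ[volume]
            fun x => (R ⟨ρ, hρ⟩ (z k) - u : LpC d p) x - W k x := by
          filter_upwards [Lp.coeFn_sub (R ⟨ρ, hρ⟩ (z k) - u) ((hWp k).toLp (W k)),
            (hWp k).coeFn_toLp] with x h7 h8
          rw [h7, Pi.sub_apply, h8]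
        rw [Lp.norm_def, eLpNorm_congr_ae h6]
        exact ENNReal.toReal_le_of_le_ofReal hδ'0.le h5
      have hdec : u - ∑ k ∈ t, (w k : ℂ) • R ⟨ρ, hρ⟩ (z k)
          = -(∑ k ∈ t, w k • (R ⟨ρ, hρ⟩ (z k) - u - (hWp k).toLp (W k))
            + ∑ k ∈ t, w k • (hWp k).toLp (W k)) := by
        rw [← Finset.sum_add_distrib]
        simp only [sub_add_cancel, smul_sub, Finset.sum_sub_distrib,
          ← Finset.sum_smul, hw1, one_smul, Complex.coe_smul]
        abel
      rw [hd.weakDeriv_eq, hdec, norm_neg]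
      refine (norm_add_le _ _).trans (add_le_add ?_ hWsum)
      calc _ ≤ ∑ k ∈ t, w k * δ' := norm_sum_le_of_le t fun k hk => by
            rw [norm_smul, Real.norm_of_nonneg (hw0 k hk)]
            exact mul_le_mul_of_nonneg_left (hRW k hk) (hw0 k hk)
        _ = δ' := by rw [← Finset.sum_mul, hw1, one_mul]
    refine (Finset.sum_le_card_nsmul _ _ _ hterm).trans (le_of_eq ?_)
    rw [nsmul_eq_mul, hδ']
    field_simp
    ring
  · have h1 : ‖∑ k ∈ t, (w k : ℂ) • e (z k)‖ ≤ ∑ k ∈ t, w k * ‖f‖ := by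
      refine norm_sum_le_of_le t fun k hk => ?_
      rw [norm_smul, Complex.norm_real, Real.norm_of_nonneg (hw0 k hk), he, ← haα]
      exact mul_le_mul_of_nonneg_left (scaleNorm_sample_le f _) (hw0 k hk)
    rw [← Finset.sum_mul, hw1, one_mul] at h1
    linarith

end Synthesis

/-! ### Return to the lattice `b ℤ^d` and assembly of the synthesis operator. -/

section Synthesis

variable {d : ℕ} {p : ℝ≥0∞} [Fact (1 ≤ p)] [hp : Fact (p ≠ ⊤)] {m : ℕ}
  {b : Matrix (Fin d) (Fin d) ℝ}

/-! ### The synthesis operator for the lattice `b ℤ^d` -/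

theorem actEquiv_symm_apply (hb : b.det ≠ 0) (x : Space d) :
    (actEquiv hb).symm x = act b⁻¹ x := by
  rw [ContinuousLinearEquiv.symm_apply_eq, actEquiv_apply, act_act,
    Matrix.mul_nonsing_inv b (isUnit_iff_ne_zero.mpr hb)]
  simp [act]

theorem act_dilation (α : ℕ+ → ℝ) (j : ℕ+) (x : Space d) : act (dilation d α j) x = α j • x := by
  simp [act, dilation]

/-- Linear substitutions preserve `W^{m,p}`; substituting `b` and rescaling gives a right inverse,
whence surjectivity. -/
theorem exists_matrixRescaleInv (hb : b.det ≠ 0) :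
    ∃ V : Sobolev d p m →L[ℂ] Sobolev d p m, Function.Surjective V ∧
      ∀ f, Sobolev.toLp (V f) =ᵐ[volume] matrixRescaleInv b (Sobolev.toLp f) := by
  obtain ⟨V, hV⟩ := Sobolev.exists_compLin (p := p) (m := m) (actEquiv hb).symm
  obtain ⟨U, hU⟩ := Sobolev.exists_compLin (p := p) (m := m) (actEquiv hb)
  have hne : ((|b.det|⁻¹ : ℝ) : ℂ) ≠ 0 := by
    exact_mod_cast inv_ne_zero (abs_ne_zero.mpr hb)
  have hVU : ∀ f, V (U f) = f := fun f => by
    refine Sobolev.toLp_injective (Lp.ext ?_)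
    rw [hV, hU]
    filter_upwards [coeFn_compLin (actEquiv hb).symm (compLin (actEquiv hb) (Sobolev.toLp f)),
      ae_linearEquiv (coeFn_compLin (actEquiv hb) (Sobolev.toLp f)) (actEquiv hb).symm]
      with x h1 h2
    rw [h1, h2, ContinuousLinearEquiv.apply_symm_apply]
  refine ⟨((|b.det|⁻¹ : ℝ) : ℂ) • V, fun f => ⟨(((|b.det|⁻¹ : ℝ) : ℂ))⁻¹ • U f, ?_⟩, fun f => ?_⟩
  · rw [map_smul, smul_apply, hVU, inv_smul_smul₀ hne]
  · rw [smul_apply, map_smul, hV]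
    filter_upwards [Lp.coeFn_smul ((|b.det|⁻¹ : ℝ) : ℂ)
      (compLin (actEquiv hb).symm (Sobolev.toLp f)),
      coeFn_compLin (actEquiv hb).symm (Sobolev.toLp f)] with x h1 h2
    rw [h1, Pi.smul_apply, h2, actEquiv_symm_apply, smul_eq_mul, matrixRescaleInv]

/-- Evaluate the integer-lattice sum at `a_j b⁻¹ x`. As `a_j` is scalar it commutes with `b`, so `b
(a_j b⁻¹ x - k) = a_j x - b k`. -/
theorem ae_hasSum_rescaled (hb : b.det ≠ 0) {α : ℕ+ → ℝ} {a : ℕ+ → ℝˣ}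
    (haα : ∀ j, (a j : ℝ) = α j) {η : Space d → ℂ} (hη : MemLp (matrixRescale b η) p volume)
    (hN : perNorm p (matrixRescale b η) < ⊤)
    {F : lp (fun _ : Fin d → ℤ => ℂ) p →L[ℂ] LpC d p} (hF : IsLatticeSum (matrixRescale b η) F)
    (j : ℕ+) (s : lp (fun _ : Fin d → ℤ => ℂ) p) {g : Space d → ℂ}
    (hg : g =ᵐ[volume] matrixRescaleInv b
      (dilate (a j) ((transAvg (cubeMeasure d))^[m] (F s)) : LpC d p)) :
    ∀ᵐ x, (Summable fun k => ‖s k * rescaled p (dilation d α j) b (synthesizer b η m) k x‖) ∧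
      HasSum (fun k => s k * rescaled p (dilation d α j) b (synthesizer b η m) k x) (g x) := by
  have h1 := hF.iterate_cubeAvg hη hN m s
  rw [← matrixRescale_synthesizer hb] at h1
  have hne : ((|b.det| : ℝ) : ℂ) ≠ 0 := by exact_mod_cast abs_ne_zero.mpr hb
  filter_upwards [hg, ae_linearEquiv (ae_linearEquiv h1 (scaleEquiv (a j))) (actEquiv hb).symm,
    ae_linearEquiv (coeFn_dilate (a j) ((transAvg (cubeMeasure d))^[m] (F s))) (actEquiv hb).symm]
    with x h2 h3 h4
  rw [scaleEquiv_apply, actEquiv_symm_apply] at h3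
  rw [actEquiv_symm_apply] at h4
  have e : (fun k => s k * rescaled p (dilation d α j) b (synthesizer b η m) k x)
      = fun k => ((|b.det|⁻¹ : ℝ) : ℂ) * dilFactor d p (a j) * (s k *
        matrixRescale b (synthesizer b η m) ((a j : ℝ) • act b⁻¹ x - intPoint k)) := by
    funext k
    have h5 : act b ((a j : ℝ) • act b⁻¹ x) = α j • x := by
      rw [haα, act, map_smul, ← act, act_act, Matrix.mul_nonsing_inv b (isUnit_iff_ne_zero.mpr hb)]
      simp [act]
    have h6 : |(dilation d α j).det| ^ (1 / p.toReal) = dilFactor d p (a j) := by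
      rw [dilFactor, haα]
      simp [dilation, abs_pow]
    rw [rescaled, h6, act_dilation, matrixRescale, act_sub, act_intPoint, h5, Complex.ofReal_inv]
    field_simp
  rw [e, h2, matrixRescaleInv, h4, ← mul_assoc]
  refine ⟨?_, h3.2.mul_left _⟩
  refine (h3.1.mul_left ‖((|b.det|⁻¹ : ℝ) : ℂ) * dilFactor d p (a j)‖).congr fun k => ?_
  rw [← norm_mul]
  exact congrArg norm (congrFun e k).symm

/-- The operator is `V ∘ S₀`, with `V` the bounded surjection `M_b⁻¹` on `W^{m,p}` and `S₀` the
synthesis on the integer lattice. The norm bound is that for solving `S₀ c = f`, so the norm of `V`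
does not enter it. -/
theorem exists_synthesisOperator (α : ℕ+ → ℝ) (hα0 : ∀ j, α j ≠ 0)
    (hα : Tendsto (fun j => |α j|) atTop atTop) (hb : b.det ≠ 0) {η : Space d → ℂ}
    (hη : MemLp η p volume) (hPη : PeriodizationLocLp p b η) (hint : ∫ x, η x = 1) :
    ∃ S : WeightedSeq d p m α →L[ℂ] Sobolev d p m,
      (∀ c, IsSynthesis α b (synthesizer b η m) (WeightedSeq.toSeq c) (S c)) ∧
      IsOpenMap S ∧ Function.Surjective S ∧
      ∀ (f : Sobolev d p m) (ε : ℝ), 0 < ε → ∃ c : WeightedSeq d p m α,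
        (Sobolev.toLp (S c) =ᵐ[volume] matrixRescaleInv b (Sobolev.toLp f)) ∧
        ‖c‖ ≤ ‖f‖ + ε := by
  set a : ℕ+ → ℝˣ := fun j => Units.mk0 (α j) (hα0 j) with ha
  have haα : ∀ j, (a j : ℝ) = α j := fun _ => rfl
  have hη' := memLp_matrixRescale hb hη
  have hN := perNorm_matrixRescale_lt_top hb hPη
  have hint' : ∫ x, matrixRescale b η x = 1 := by rw [integral_matrixRescale hb, hint]
  obtain ⟨F, hF⟩ := exists_isLatticeSum hη'.1 hN
  choose G hG hGn using fun j => exists_levelMap hη'.1 hF hN m (a j)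
  obtain ⟨S₀, hS₀⟩ := WeightedSeq.exists_sum_levels (α := α) G hGn
  obtain ⟨V, hVs, hV⟩ := exists_matrixRescaleInv (p := p) (m := m) hb
  have hexact : ∀ (f : Sobolev d p m) {ε : ℝ}, 0 < ε → ∃ c, S₀ c = f ∧ ‖c‖ ≤ ‖f‖ + ε :=
    exists_preimage_of_approx S₀ fun f δ hδ =>
      exists_approx_synthesis haα hα hη' hN hint' hF hG (fun c => (hS₀ c).2) f hδ
  have hsurj : Function.Surjective (V.comp S₀) := fun f => by
    obtain ⟨g, rfl⟩ := hVs f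
    obtain ⟨c, rfl, -⟩ := hexact g one_pos
    exact ⟨c, rfl⟩
  refine ⟨V.comp S₀, fun c => ⟨fun j => V (G j (WeightedSeq.level j c)), fun j => ?_, ?_,
    (hS₀ c).2.mapL V⟩, (V.comp S₀).isOpenMap hsurj, hsurj, fun f ε hε => ?_⟩
  · refine ae_hasSum_rescaled hb haα hη' hN hF j (WeightedSeq.level j c) ?_
    rw [← hG]
    exact hV _
  · exact Summable.of_nonneg_of_le (fun _ => norm_nonneg _) (fun j => V.le_opNorm _)
      ((hS₀ c).1.mul_left _)
  · obtain ⟨c, rfl, hc⟩ := hexact f hε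
    exact ⟨c, hV _, hc⟩

end Synthesis

end AffineSynthesis

end

theorem mainTheorem11 {d : ℕ} (hd : 0 < d) (m : ℕ) (p : ℝ≥0∞) [Fact (1 ≤ p)] (hp : p ≠ ⊤)
    (α : ℕ+ → ℝ) (hα0 : ∀ j, α j ≠ 0) (hα : Tendsto (fun j => |α j|) atTop atTop)
    (b : Matrix (Fin d) (Fin d) ℝ) (hb : b.det ≠ 0)
    (η : AffineSynthesis.Space d → ℂ) (hη : MemLp η p volume)
    (hPη : AffineSynthesis.PeriodizationLocLp p b η) (hint : ∫ x, η x = 1) :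
    ∃ S : AffineSynthesis.WeightedSeq d p m α →L[ℂ] AffineSynthesis.Sobolev d p m,
      (∀ c, AffineSynthesis.IsSynthesis α b (AffineSynthesis.synthesizer b η m)
        (AffineSynthesis.WeightedSeq.toSeq c) (S c)) ∧
      IsOpenMap S ∧ Function.Surjective S ∧
      ∀ (f : AffineSynthesis.Sobolev d p m) (ε : ℝ), 0 < ε →
        ∃ c : AffineSynthesis.WeightedSeq d p m α,
          (AffineSynthesis.Sobolev.toLp (S c) =ᵐ[volume]
            AffineSynthesis.matrixRescaleInv b (AffineSynthesis.Sobolev.toLp f)) ∧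
          ‖c‖ ≤ ‖f‖ + ε :=
  have : Fact (p ≠ ⊤) := ⟨hp⟩
  AffineSynthesis.exists_synthesisOperator α hα0 hα hb hη hPη hint
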